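/- Let $K$ be an algebraically closed field of characteristic $0$ and let $d>3$. Conventions. Let $R=\bigoplus_{k\ge 0}R_k$ be a graded finitely generated $K$-domain. A $K$-valuation on $R$ is a map $\nu\colon R\setminus\{0\}\to\Gamma$ to a totally ordered finitely generated free abelian group $\Gamma$ such that $\nu(K^*)=0$, $\nu(fg)=\nu(f)+\nu(g)$, and $\nu(f+g)\ge\min\{\nu(f),\nu(g)\}$ whenever $f+g\neq 0$. It is homogeneous if $\nu(f)=\min\{\nu(f_k) : f_k\ne 0\}$ for every nonzero $f=\sum_k f_k$ with $f_k\in R_k$. Its value semigroup is $S(R,\nu)=\nu(R\setminus\{0\})$. It has full rank if the rank of the subgroup of $\Gamma$ generated by $S(R,\nu)$ equals the Krull dimension of $R$, and it is Khovanskii-finite if $S(R,\nu)$ is a finitely generated semigroup. A property holds for a very general member of a family $V$ of points of a projective space or a Grassmannian if it holds for all members of $V$ outside a countable union of Zariski closed subsets, none of which contains $V$. (i) Let $Y=\{f=0\}\subset\mathbb{P}^2$ be a very general member of the family of integral rational plane curves of degree $d$ (regarded as points of the projective space of ternary forms of degree $d$), and let $R=K[x,y,z]/(f)$, with its standard grading,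 be the coordinate ring of the affine cone over $Y$. Then no full rank homogeneous valuation on $R$ is Khovanskii-finite. (ii) Let $L$ be a very general $3$-dimensional linear subspace of $\mathrm{Sym}^d(K^2)=K[s,t]_d$, and let $R(L)=\bigoplus_{k\ge 0}L^k$, where $L^k\subseteq K[s,t]_{kd}$ is the linear span of the products of $k$ elements of $L$. Then no full rank homogeneous valuation on $R(L)$ is Khovanskii-finite. -/

import Mathlib

open MvPolynomial
open scoped LinearAlgebra.Projectivization

universe w

namespace Khovanskii

noncomputable section

/-! ### Valuations on graded algebras -/

section Valuations

variable (K : Type*) {R Γ : Type*} [Field K] [CommRing R] [Algebra K R]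
  [AddCommGroup Γ] [LinearOrder Γ] [IsOrderedAddMonoid Γ]

/-- A `K`-valuation `R ∖ {0} → Γ`, extended by the value `⊤` at `0` only, with `K^*` sent to `0`. -/
structure IsKValuation (ν : AddValuation R (WithTop Γ)) : Prop where
  eq_zero_of_top : ∀ f : R, ν f = ⊤ → f = 0
  map_const : ∀ c : K, c ≠ 0 → ν (algebraMap K R c) = 0

variable {K}

/-- The value semigroup `S(R, ν)`: the values in `Γ` taken by `ν` (on nonzero elements). -/
def valueSemigroup (ν : AddValuation R (WithTop Γ)) : AddSubmonoid Γ where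
  carrier := {γ | ∃ f : R, ν f = (γ : WithTop Γ)}
  zero_mem' := ⟨1, by simp⟩
  add_mem' := by
    rintro a b ⟨f, hf⟩ ⟨g, hg⟩
    exact ⟨f * g, by rw [AddValuation.map_mul, hf, hg, WithTop.coe_add]⟩

/-- `ν` is homogeneous for a grading `R = ⨁ 𝒜 u`: the value of a finite sum of homogeneous
elements of distinct degrees is the minimum of their values. -/
def IsHomogeneousValuation (𝒜 : ℕ → Submodule K R) (ν : AddValuation R (WithTop Γ)) : Prop :=
  ∀ (s : Finset ℕ) (f : ℕ → R), (∀ u ∈ s, f u ∈ 𝒜 u) →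
    ν (∑ u ∈ s, f u) = s.inf fun u => ν (f u)

/-- The rank of the lattice generated by the value semigroup equals the Krull dimension. -/
def IsFullRank (ν : AddValuation R (WithTop Γ)) : Prop :=
  ((Module.finrank ℤ (Submodule.span ℤ (valueSemigroup ν : Set Γ)) : ℕ) : WithBot ℕ∞)
    = ringKrullDim R

/-- The value semigroup is finitely generated. (It contains `0`, so it does not matter whether
generation is as a semigroup or as a monoid.) -/
def IsKhovanskiiFinite (ν : AddValuation R (WithTop Γ)) : Prop :=
  (valueSemigroup ν).FG

end Valuations

/-- No full rank homogeneous `K`-valuation of the graded `K`-algebra `R = ⨁ 𝒜 u`, with values in a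
totally ordered finitely generated free abelian group, is Khovanskii-finite. -/
def NoKhovanskiiFiniteValuation {K R : Type*} [Field K] [CommRing R] [Algebra K R]
    (𝒜 : ℕ → Submodule K R) : Prop :=
  ∀ (Γ : Type w) [AddCommGroup Γ] [LinearOrder Γ] [IsOrderedAddMonoid Γ]
    [Module.Finite ℤ Γ] [Module.Free ℤ Γ] (ν : AddValuation R (WithTop Γ)),
    IsKValuation K ν → IsHomogeneousValuation 𝒜 ν → IsFullRank ν → ¬ IsKhovanskiiFinite ν

/-! ### Zariski closed sets and very general points -/

section Zariski

variable (K : Type*) {E : Type*} [Field K] [AddCommGroup E] [Module K E]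

/-- Zariski closed subsets of a vector space: common zeros of a set of polynomials in the linear
coordinate functions. -/
def IsZariskiClosed (S : Set E) : Prop :=
  ∃ I : Set (MvPolynomial (Module.Dual K E) K),
    S = {v | ∀ P ∈ I, eval (fun φ : Module.Dual K E => φ v) P = 0}

/-- Zariski closed subsets of the projective space `ℙ(E)`, as the quotient of `E ∖ {0}`. -/
def IsClosedInProjectiveSpace (Z : Set (ℙ K E)) : Prop :=
  ∃ S : Set E, IsZariskiClosed K S ∧
    ∀ (v : E) (hv : v ≠ 0), v ∈ S ↔ Projectivization.mk K v hv ∈ Z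

/-- Zariski closed subsets of the Grassmannian `Gr(m, E)` of `m`-dimensional subspaces, as the
quotient of the (Zariski open) set of linearly independent `m`-tuples of vectors of `E`. -/
def IsClosedInGrassmannian (m : ℕ) (Z : Set (Submodule K E)) : Prop :=
  ∃ S : Set (Fin m → E), IsZariskiClosed K S ∧
    ∀ v : Fin m → E, LinearIndependent K v → (v ∈ S ↔ Submodule.span K (Set.range v) ∈ Z)

end Zariski

/-- `P` holds for a very general point of `V`, where `V` is a subset of a space `X` with the given
notion of closed subset: there are countably many closed sets, none of which contains `V`, such
that `P` holds at every point of `V` outside of their union. -/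
def HoldsVeryGenerally {X : Type*} (IsClosedSet : Set X → Prop) (V : Set X) (P : X → Prop) :
    Prop :=
  ∃ Z : ℕ → Set X, (∀ i, IsClosedSet (Z i) ∧ ¬ V ⊆ Z i) ∧ ∀ x ∈ V, (∀ i, x ∉ Z i) → P x

/-! ### Plane curves and their affine cones -/

section PlaneCurves

variable {K : Type*} [Field K]

/-- The homogeneous coordinate ring of the plane curve `f = 0`, i.e. the coordinate ring of its
affine cone. -/
abbrev ConeRing (f : MvPolynomial (Fin 3) K) : Type _ :=
  MvPolynomial (Fin 3) K ⧸ Ideal.span {f}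

/-- The grading of the homogeneous coordinate ring by degree. -/
def coneGrading (f : MvPolynomial (Fin 3) K) (k : ℕ) : Submodule K (ConeRing f) :=
  (homogeneousSubmodule (Fin 3) K k).map (Ideal.Quotient.mkₐ K (Ideal.span {f})).toLinearMap

/-- The field of homogeneous fractions (quotients of two homogeneous elements of the same degree)
of a graded domain. -/
def homogeneousFractions {R : Type*} [CommRing R] [IsDomain R] [Algebra K R]
    (𝒜 : ℕ → Submodule K R) : IntermediateField K (FractionRing R) :=
  IntermediateField.adjoin K
    {q | ∃ k : ℕ, ∃ a ∈ 𝒜 k, ∃ b ∈ 𝒜 k, b ≠ 0 ∧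
      q = algebraMap R (FractionRing R) a / algebraMap R (FractionRing R) b}

/-- The plane curve `f = 0` is integral and rational: its homogeneous coordinate ring is a domain,
and its function field is `K`-isomorphic to the field `K(t)`. -/
def IsIntegralRationalCurve (f : MvPolynomial (Fin 3) K) : Prop :=
  ∃ _ : IsDomain (ConeRing f), Nonempty (homogeneousFractions (coneGrading f) ≃ₐ[K] RatFunc K)

variable (K)

/-- Plane curves of degree `d`, as points of the projective space of ternary forms of degree `d`. -/
abbrev PlaneCurve (d : ℕ) : Type _ := ℙ K (homogeneousSubmodule (Fin 3) K d)

variable {K}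

/-- A defining form of a plane curve. It is unique up to a nonzero scalar, so the ideal it
generates does not depend on the choice. -/
def definingForm {d : ℕ} (Y : PlaneCurve K d) : MvPolynomial (Fin 3) K :=
  (Projectivization.rep Y : homogeneousSubmodule (Fin 3) K d)

variable (K)

/-- The family of integral rational plane curves of degree `d`. -/
def integralRationalPlaneCurves (d : ℕ) : Set (PlaneCurve K d) :=
  {Y | IsIntegralRationalCurve (definingForm Y)}

end PlaneCurves

/-! ### Linear systems on the projective line -/

section LinearSystems

variable (K : Type*) [Field K]

/-- `Sym^d(K^2)`, the space of binary forms of degree `d`. -/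
abbrev BinaryForms (d : ℕ) : Type _ := homogeneousSubmodule (Fin 2) K d

variable {K} {d : ℕ}

/-- A space of binary forms, as a subspace of the polynomial ring `K[s,t]`. -/
def toPolys (L : Submodule K (BinaryForms K d)) : Submodule K (MvPolynomial (Fin 2) K) :=
  L.map (homogeneousSubmodule (Fin 2) K d).subtype

/-- The ring `R(L) = ⨁ₖ Lᵏ`, realized inside `K[s,t]` (for `d > 0` the spaces `Lᵏ` lie in the
different degrees `kd`, so that their sum is direct); it is generated by `L`. -/
abbrev SectionRing (L : Submodule K (BinaryForms K d)) : Subalgebra K (MvPolynomial (Fin 2) K) :=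
  Algebra.adjoin K (toPolys L : Set (MvPolynomial (Fin 2) K))

/-- The grading of `R(L)`: the piece of degree `k` is `Lᵏ`, the span of the `k`-fold products. -/
def sectionGrading (L : Submodule K (BinaryForms K d)) (k : ℕ) : Submodule K (SectionRing L) :=
  (toPolys L ^ k).comap (SectionRing L).val.toLinearMap

end LinearSystems

end

end Khovanskii

namespace Khovanskii

/-! ### Homogeneous valuations on standard graded algebras with three generators -/

section HomogeneousValuations

/-! A finitely generated value semigroup forces some form to meet the curve in a single point. One
explicit curve admits no such form, and the curves that do are covered by countably many closed sets
missing that example.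

Valuations. Let `ν` be homogeneous of full rank on a ring of dimension at least two, generated by
three elements of degree one and without three algebraically independent elements. Pairs (degree,
value) span a lattice of rank at most two, so with `γ₀` the least value in degree one, the offsets
`γ - n • γ₀` lie on a line. Moreover two elements of equal degree and value become, after
subtracting a scalar multiple, an element of larger value (`exists_sub_smul_lt`). If the semigroup
is finitely generated, a generator with the largest offset per degree is a summand of every value of
large offset (`exists_absorbing_value`). Let `F` realize it. Repeated subtraction of multiples of
`F` terminates, so elements of large offset are divisible by `F`. In particular, linear forms of
value above `γ₀` are nilpotent modulo `F` (`exists_hasOnePointSection`).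

The example. The curve `((w + 1)² : w : (w + 1)² (w - 1)ⁿ)` of degree `n + 2` has cusps at `w = 1`
and `w = -1`; the condition `d > 3` says `n ≥ 2`. If a form of degree `k` pulls back to `ρ`, the
cusps prescribe `ρ'/ρ = k` at `1` and `-k` at `-1`, wherever `ρ` does not vanish. A single
intersection point makes the roots of `ρ` a pair `w, w⁻¹`, or `0` alone, with total multiplicity `k
(n + 2)`. A pair gives total multiplicity `2k`, and the root `0` gives `k (n + 2) = k`; both are
absurd in characteristic zero (`not_onePoint_bicuspidal`).

Specialization. For every `k` and `M`, take the Zariski closure of the curves having a one-point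
form of degree `k` with certificates of degree `M`. A point of the closure is the reduction, over a
valuation ring, of a point of the family over a large field (`exists_specialization`). The
certificates, made primitive modulo the equation, reduce too (`false_of_specializes_bicuspidal`), so
the example lies in no closure. Part (i) also needs that the example is integral and rational
(`isIntegralRationalCurve_bicuspidalForm`). Part (ii) needs an equation for the generic parametrized
curve (`exists_equation_of_specializes_bicuspidal`). -/

lemma exists_map_sum_eq {R Γ₀ ι : Type*} [Ring R] [LinearOrderedAddCommMonoidWithTop Γ₀]
    (ν : AddValuation R Γ₀) (t : ι → R) (s : Finset ι) (hs : s.Nonempty)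
    (h : Set.InjOn (fun i => ν (t i)) s) : ∃ i ∈ s, ν (∑ i ∈ s, t i) = ν (t i) := by
  classical
  induction hs using Finset.Nonempty.cons_induction with
  | singleton a => exact ⟨a, by simp⟩
  | cons a s ha hs ih =>
    obtain ⟨b, hb, hb'⟩ := ih (h.mono (by simp))
    have hne : ν (t a) ≠ ν (∑ i ∈ s, t i) := by
      rw [hb']
      intro hab
      have := h (by simp) (by simp [hb]) hab
      exact ha (this ▸ hb)
    rw [Finset.sum_cons, AddValuation.map_add_of_distinct_val _ hne]
    rcases min_choice (ν (t a)) (ν (∑ i ∈ s, t i)) with h1 | h1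
    · exact ⟨a, by simp, h1⟩
    · exact ⟨b, by simp [hb], by rw [h1, hb']⟩

variable {K R Γ : Type*} [Field K] [CommRing R] [Algebra K R]
  [AddCommGroup Γ] [LinearOrder Γ] [IsOrderedAddMonoid Γ]

/-- Within one degree the values are distinct, so the least one survives; across degrees homogeneity
of `ν` rules out cancellation. Algebraic independence is always obtained from this. -/
lemma IsHomogeneousValuation.sum_ne_zero {𝒜 : ℕ → Submodule K R}
    {ν : AddValuation R (WithTop Γ)} (hν : IsHomogeneousValuation 𝒜 ν) {ι : Type*}
    {s : Finset ι} (hs : s.Nonempty) (t : ι → R) (u : ι → ℕ) (ht : ∀ i ∈ s, t i ∈ 𝒜 (u i))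
    (htop : ∀ i ∈ s, ν (t i) ≠ ⊤) (hinj : Set.InjOn (fun i => (u i, ν (t i))) s) :
    ∑ i ∈ s, t i ≠ 0 := by
  classical
  intro h0
  obtain ⟨i₀, hi₀⟩ := hs
  have h1 := hν (s.image u) (fun n => ∑ i ∈ s with u i = n, t i) (by
    intro n _
    refine Submodule.sum_mem _ fun i hi => ?_
    rw [Finset.mem_filter] at hi
    exact hi.2 ▸ ht i hi.1)
  rw [Finset.sum_fiberwise_of_maps_to (fun i hi => Finset.mem_image_of_mem u hi), h0,
    AddValuation.map_zero, eq_comm, Finset.inf_eq_top_iff] at h1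
  have h2 := h1 (u i₀) (Finset.mem_image_of_mem u hi₀)
  obtain ⟨i, hi, hi'⟩ := exists_map_sum_eq ν t {i ∈ s | u i = u i₀} ⟨i₀, by simp [hi₀]⟩ (by
    intro i hi j hj hij
    simp only [Finset.coe_filter, Set.mem_ofPred_eq] at hi hj
    exact hinj hi.1 hj.1 (by simp only [Prod.mk.injEq]; exact ⟨hi.2.trans hj.2.symm, hij⟩))
  rw [Finset.mem_filter] at hi
  exact htop i hi.1 (hi'.symm.trans h2)

/-- `R = ⨁ 𝒜 n` is generated by the three elements `x i` of degree one. -/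
structure IsGradedBy (𝒜 : ℕ → Submodule K R) (x : Fin 3 → R) : Prop where
  mem_iff : ∀ n a, a ∈ 𝒜 n ↔ ∃ F : MvPolynomial (Fin 3) K, F.IsHomogeneous n ∧ aeval x F = a
  surjective : Function.Surjective (aeval x : MvPolynomial (Fin 3) K →ₐ[K] R)

namespace IsGradedBy

variable {𝒜 : ℕ → Submodule K R} {x : Fin 3 → R} (hx : IsGradedBy 𝒜 x)

include hx

lemma mul_mem {m n : ℕ} {a b : R} (ha : a ∈ 𝒜 m) (hb : b ∈ 𝒜 n) : a * b ∈ 𝒜 (m + n) := by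
  obtain ⟨F, hF, rfl⟩ := (hx.mem_iff _ _).1 ha
  obtain ⟨G, hG, rfl⟩ := (hx.mem_iff _ _).1 hb
  exact (hx.mem_iff _ _).2 ⟨F * G, hF.mul hG, map_mul _ _ _⟩

lemma algebraMap_mem (c : K) : algebraMap K R c ∈ 𝒜 0 :=
  (hx.mem_iff _ _).2 ⟨C c, isHomogeneous_C _ _, by simp⟩

lemma one_mem : (1 : R) ∈ 𝒜 0 := by
  simpa using hx.algebraMap_mem 1

lemma pow_mem {n : ℕ} {a : R} (ha : a ∈ 𝒜 n) (k : ℕ) : a ^ k ∈ 𝒜 (k * n) := by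
  induction k with
  | zero => simpa using hx.one_mem
  | succ k ih => rw [pow_succ, add_mul, one_mul]; exact hx.mul_mem ih ha

lemma prod_mem {ι : Type*} (s : Finset ι) (g : ι → R) (n : ι → ℕ) (hg : ∀ i, g i ∈ 𝒜 (n i)) :
    ∏ i ∈ s, g i ∈ 𝒜 (∑ i ∈ s, n i) := by
  classical
  induction s using Finset.induction_on with
  | empty => simpa using hx.one_mem
  | insert i s hi ih => rw [Finset.prod_insert hi, Finset.sum_insert hi]; exact hx.mul_mem (hg i) ih

lemma X_mem (i : Fin 3) : x i ∈ 𝒜 1 :=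
  (hx.mem_iff _ _).2 ⟨X i, isHomogeneous_X _ _, by simp⟩

lemma mem_zero {a : R} (ha : a ∈ 𝒜 0) : ∃ c : K, a = algebraMap K R c := by
  obtain ⟨F, hF, rfl⟩ := (hx.mem_iff _ _).1 ha
  rw [← totalDegree_zero_iff_isHomogeneous, totalDegree_eq_zero_iff_eq_C] at hF
  exact ⟨coeff 0 F, by rw [hF]; simp⟩

end IsGradedBy

/-- The value `γ` is taken by `ν` in degree `n`. -/
def HasValue (𝒜 : ℕ → Submodule K R) (ν : AddValuation R (WithTop Γ)) (n : ℕ) (γ : Γ) : Prop :=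
  ∃ a ∈ 𝒜 n, ν a = (γ : WithTop Γ)

section

variable {𝒜 : ℕ → Submodule K R} {x : Fin 3 → R} (hx : IsGradedBy 𝒜 x)
  {ν : AddValuation R (WithTop Γ)}

include hx

lemma HasValue.add {m n : ℕ} {γ δ : Γ} (h1 : HasValue 𝒜 ν m γ) (h2 : HasValue 𝒜 ν n δ) :
    HasValue 𝒜 ν (m + n) (γ + δ) := by
  obtain ⟨a, ha, ha'⟩ := h1
  obtain ⟨b, hb, hb'⟩ := h2
  exact ⟨a * b, hx.mul_mem ha hb, by rw [AddValuation.map_mul, ha', hb', WithTop.coe_add]⟩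

lemma hasValue_zero : HasValue 𝒜 ν 0 (0 : Γ) := ⟨1, hx.one_mem, by simp⟩

lemma HasValue.nsmul {n : ℕ} {γ : Γ} (h : HasValue 𝒜 ν n γ) (k : ℕ) :
    HasValue 𝒜 ν (k * n) (k • γ) := by
  induction k with
  | zero => simpa using hasValue_zero hx
  | succ k ih => rw [add_mul, one_mul, succ_nsmul]; exact ih.add hx h

lemma HasValue.sum {ι : Type*} (s : Finset ι) (n : ι → ℕ) (γ : ι → Γ)
    (h : ∀ i ∈ s, HasValue 𝒜 ν (n i) (γ i)) : HasValue 𝒜 ν (∑ i ∈ s, n i) (∑ i ∈ s, γ i) := by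
  classical
  induction s using Finset.induction_on with
  | empty => simpa using hasValue_zero hx
  | insert i s hi ih =>
    rw [Finset.sum_insert hi, Finset.sum_insert hi]
    exact (h i (by simp)).add hx (ih fun j hj => h j (by simp [hj]))

lemma exists_hasValue_of_mem (hν : IsHomogeneousValuation 𝒜 ν) {γ : Γ}
    (hγ : γ ∈ valueSemigroup ν) : ∃ n, HasValue 𝒜 ν n γ := by
  obtain ⟨f, hf⟩ := hγ
  obtain ⟨F, rfl⟩ := hx.surjective f
  have h1 := hν (Finset.range (F.totalDegree + 1)) (fun i => aeval x (homogeneousComponent i F))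
    (fun u _ => (hx.mem_iff _ _).2 ⟨_, homogeneousComponent_isHomogeneous _ _, rfl⟩)
  rw [← map_sum, sum_homogeneousComponent, hf] at h1
  obtain ⟨i, -, hi⟩ := Finset.exists_mem_eq_inf (Finset.range (F.totalDegree + 1)) (by simp)
    (fun i => ν (aeval x (homogeneousComponent i F)))
  exact ⟨i, _, (hx.mem_iff _ _).2 ⟨_, homogeneousComponent_isHomogeneous _ _, rfl⟩,
    hi.symm.trans h1.symm⟩

end

lemma HasValue.mem {𝒜 : ℕ → Submodule K R} {ν : AddValuation R (WithTop Γ)} {n : ℕ} {γ : Γ}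
    (h : HasValue 𝒜 ν n γ) : γ ∈ valueSemigroup ν := by
  obtain ⟨a, -, ha⟩ := h
  exact ⟨a, ha⟩

lemma IsKValuation.map_smul {ν : AddValuation R (WithTop Γ)} (hK : IsKValuation K ν) {c : K}
    (hc : c ≠ 0) (a : R) : ν (c • a) = ν a := by
  rw [Algebra.smul_def, AddValuation.map_mul, hK.map_const c hc, zero_add]

lemma map_prod_pow {ν : AddValuation R (WithTop Γ)} {ι : Type*} (s : Finset ι) (g : ι → R)
    (γ : ι → Γ) (hg : ∀ i, ν (g i) = (γ i : WithTop Γ)) (m : ι → ℕ) :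
    ν (∏ i ∈ s, g i ^ m i) = ((∑ i ∈ s, m i • γ i : Γ) : WithTop Γ) := by
  classical
  induction s using Finset.induction_on with
  | empty => simp
  | insert i s hi ih =>
    rw [Finset.prod_insert hi, Finset.sum_insert hi, AddValuation.map_mul, ih,
      AddValuation.map_pow, hg, WithTop.coe_add, WithTop.coe_nsmul]

/-- Without such a relation, distinct monomials in three elements realizing the pairs would have
distinct (degree, value), and the three elements would be algebraically independent. -/
lemma exists_relation {𝒜 : ℕ → Submodule K R} {x : Fin 3 → R} (hx : IsGradedBy 𝒜 x)
    (htr : ∀ g : Fin 3 → R, ¬ AlgebraicIndependent K g)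
    {ν : AddValuation R (WithTop Γ)} (hK : IsKValuation K ν) (hν : IsHomogeneousValuation 𝒜 ν)
    (n : Fin 3 → ℕ) (γ : Fin 3 → Γ) (h : ∀ i, HasValue 𝒜 ν (n i) (γ i)) :
    ∃ m : Fin 3 → ℤ, m ≠ 0 ∧ ∑ i, m i * n i = 0 ∧ ∑ i, m i • γ i = 0 := by
  classical
  choose g hg hgν using h
  by_contra! hcon
  refine htr g (algebraicIndependent_iff.2 fun P hP => ?_)
  by_contra hP0
  rw [aeval_def, eval₂_eq'] at hP
  refine hν.sum_ne_zero (s := P.support) (support_nonempty.2 hP0) _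
    (fun m => ∑ i, m i * n i) (fun m _ => ?_) (fun m hm => ?_) (fun m hm m' hm' hmm => ?_) hP
  · have := hx.mul_mem (hx.algebraMap_mem (coeff m P))
      (hx.prod_mem Finset.univ (fun i => g i ^ m i) (fun i => m i * n i)
        (fun i => hx.pow_mem (hg i) (m i)))
    simpa using this
  · rw [← Algebra.smul_def, hK.map_smul (by simpa using hm), map_prod_pow _ g γ hgν]
    exact WithTop.coe_ne_top
  · simp only [Prod.mk.injEq] at hmm
    rw [← Algebra.smul_def, hK.map_smul (by simpa using hm), map_prod_pow _ g γ hgν,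
      ← Algebra.smul_def, hK.map_smul (by simpa using hm'), map_prod_pow _ g γ hgν,
      WithTop.coe_inj] at hmm
    by_contra hne
    refine hcon (fun i => (m i : ℤ) - m' i) (fun h0 => hne ?_) ?_ ?_
    · ext i
      have := congrFun h0 i
      simp only [Pi.zero_apply] at this
      omega
    · have := hmm.1
      zify at this
      simp only [sub_mul, Finset.sum_sub_distrib]
      rw [this, sub_self]
    · simp only [sub_smul, Finset.sum_sub_distrib, natCast_zsmul]
      rw [hmm.2, sub_self]

/-- Commensurability with a fixed `γ₁` extends from `S` to its span, where it would make two basis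
vectors proportional. -/
lemma not_commensurable_of_two_le_finrank [Module.Finite ℤ Γ] [Module.Free ℤ Γ] {S : Set Γ}
    (hS : 2 ≤ Module.finrank ℤ (Submodule.span ℤ S)) (γ₁ : Γ) :
    ¬ ∀ γ ∈ S, ∃ k m : ℤ, k ≠ 0 ∧ k • γ = m • γ₁ := by
  intro h
  have h2 : ∀ e ∈ Submodule.span ℤ S, ∃ k m : ℤ, k ≠ 0 ∧ k • e = m • γ₁ := by
    intro e he
    induction he using Submodule.span_induction with
    | mem e he => exact h e he
    | zero => exact ⟨1, 0, one_ne_zero, by simp⟩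
    | add a b _ _ iha ihb =>
      obtain ⟨k, m, hk, h1⟩ := iha
      obtain ⟨k', m', hk', h2⟩ := ihb
      refine ⟨k * k', m * k' + m' * k, mul_ne_zero hk hk', ?_⟩
      rw [smul_add, mul_comm k k', mul_smul, h1, mul_comm k' k, mul_smul, h2, add_smul,
        mul_comm m, mul_smul, mul_comm m', mul_smul]
    | smul c a _ iha =>
      obtain ⟨k, m, hk, h1⟩ := iha
      exact ⟨k, c * m, hk, by rw [smul_comm, h1, mul_smul]⟩
  let b := Module.finBasis ℤ (Submodule.span ℤ S)
  let i : Fin (Module.finrank ℤ (Submodule.span ℤ S)) := ⟨0, by omega⟩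
  let j : Fin (Module.finrank ℤ (Submodule.span ℤ S)) := ⟨1, by omega⟩
  have hij : i ≠ j := by simp [i, j]
  obtain ⟨k, m, hk, h1⟩ := h2 (b i) (b i).2
  obtain ⟨k', m', hk', h1'⟩ := h2 (b j) (b j).2
  have key : (m' * k) • b i = (m * k') • b j := by
    apply Subtype.ext
    push_cast
    rw [mul_smul, h1, mul_smul, h1', smul_comm]
  have h3 := congrArg (fun e => b.repr e i) key
  have h4 := congrArg (fun e => b.repr e j) key
  simp [hij, hij.symm, hk, hk'] at h3 h4
  rw [h3, zero_smul] at h1'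
  have : b j = 0 := Subtype.ext ((smul_eq_zero.1 h1').resolve_left hk')
  exact b.ne_zero j this

end HomogeneousValuations


/-! ### One-dimensional leaves -/

section Leaves

variable {K R Γ : Type*} [Field K] [CommRing R] [Algebra K R]
  [AddCommGroup Γ] [LinearOrder Γ] [IsOrderedAddMonoid Γ]

/-- The homogenization of degree `l` of the polynomial `q`, evaluated at `(a, b)`. -/
noncomputable def homogEval (a b : R) (l : ℕ) : Polynomial K →ₗ[K] R :=
  ∑ i ∈ Finset.range (l + 1), (LinearMap.toSpanSingleton K R (a ^ i * b ^ (l - i))) ∘ₗ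
    (Polynomial.lcoeff K i)

lemma homogEval_apply (a b : R) (l : ℕ) (q : Polynomial K) :
    homogEval a b l q = ∑ i ∈ Finset.range (l + 1), q.coeff i • (a ^ i * b ^ (l - i)) := by
  simp [homogEval]

lemma homogEval_monomial (a b : R) {l i : ℕ} (hi : i ≤ l) (c : K) :
    homogEval a b l (Polynomial.monomial i c) = c • (a ^ i * b ^ (l - i)) := by
  rw [homogEval_apply, Finset.sum_eq_single i]
  · simp
  · intro j _ hj
    rw [Polynomial.coeff_monomial, if_neg hj.symm, zero_smul]
  · intro h
    simp at h
    omega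

lemma homogEval_X_sub_C_mul (a b : R) (l : ℕ) (r : K) (q : Polynomial K) (hq : q.natDegree ≤ l) :
    homogEval a b (l + 1) ((Polynomial.X - Polynomial.C r) * q) =
      (a - r • b) * homogEval a b l q := by
  have h1 : homogEval a b (l + 1) (Polynomial.X * q) = a * homogEval a b l q := by
    rw [homogEval_apply, homogEval_apply, Finset.sum_range_succ', Finset.mul_sum]
    simp only [Polynomial.coeff_X_mul, Polynomial.mul_coeff_zero, Polynomial.coeff_X_zero,
      zero_mul, zero_smul, add_zero]
    refine Finset.sum_congr rfl fun i _ => ?_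
    rw [Nat.add_sub_add_right, mul_smul_comm, pow_succ', mul_assoc]
  have h2 : homogEval a b (l + 1) q = b * homogEval a b l q := by
    rw [homogEval_apply, homogEval_apply, Finset.sum_range_succ, Finset.mul_sum,
      Polynomial.coeff_eq_zero_of_natDegree_lt (Nat.lt_succ_of_le hq), zero_smul, add_zero]
    refine Finset.sum_congr rfl fun i hi => ?_
    rw [Nat.succ_sub (Nat.lt_succ_iff.1 (Finset.mem_range.1 hi)), mul_smul_comm, pow_succ']
    congr 1; ring
  rw [sub_mul, map_sub, h1, ← Polynomial.smul_eq_C_mul, map_smul, h2, sub_mul, smul_mul_assoc]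

/-- Over an algebraically closed field a binary form in `a, b` splits into factors `a - r • b` and
`b`, all of value `γ`. -/
lemma map_homogEval [IsAlgClosed K] {ν : AddValuation R (WithTop Γ)} (hK : IsKValuation K ν)
    {a b : R} {γ : Γ} (hb : ν b = γ) (hab : ∀ c : K, ν (a - c • b) = γ) (l : ℕ)
    (q : Polynomial K) (hq : q ≠ 0) (hql : q.natDegree ≤ l) :
    ν (homogEval a b l q) = ((l • γ : Γ) : WithTop Γ) := by
  induction hn : q.natDegree generalizing q l with
  | zero =>
    obtain ⟨c, rfl⟩ := Polynomial.natDegree_eq_zero.1 hn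
    have hc : c ≠ 0 := by rintro rfl; simp at hq
    rw [← Polynomial.monomial_zero_left, homogEval_monomial _ _ (Nat.zero_le _), hK.map_smul hc]
    simp [AddValuation.map_pow, hb]
  | succ n ih =>
    obtain ⟨r, hr⟩ := IsAlgClosed.exists_root q (by
      rw [Polynomial.degree_eq_natDegree hq, hn]; exact_mod_cast Nat.succ_ne_zero n)
    obtain ⟨q', rfl⟩ := Polynomial.dvd_iff_isRoot.2 hr
    have hq' : q' ≠ 0 := right_ne_zero_of_mul hq
    have hd : q'.natDegree = n := by
      rw [Polynomial.natDegree_mul (Polynomial.X_sub_C_ne_zero r) hq',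
        Polynomial.natDegree_X_sub_C] at hn
      omega
    obtain ⟨l, rfl⟩ : ∃ l', l = l' + 1 := ⟨l - 1, by omega⟩
    rw [homogEval_X_sub_C_mul _ _ _ _ _ (by omega), AddValuation.map_mul, hab,
      ih l q' hq' (by omega) hd, ← WithTop.coe_add, succ_nsmul']

variable {𝒜 : ℕ → Submodule K R} {x : Fin 3 → R} (hx : IsGradedBy 𝒜 x)
  (htr : ∀ g : Fin 3 → R, ¬ AlgebraicIndependent K g)
  {ν : AddValuation R (WithTop Γ)} (hK : IsKValuation K ν) (hν : IsHomogeneousValuation 𝒜 ν)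
  [Module.Finite ℤ Γ] [Module.Free ℤ Γ]
  (hrk : 2 ≤ Module.finrank ℤ (Submodule.span ℤ (valueSemigroup ν : Set Γ)))

include hx hν hrk in
lemma exists_independent_value (n : ℕ) (γ : Γ) :
    ∃ m δ, HasValue 𝒜 ν m δ ∧ ∀ j k : ℤ, j * n + k * m = 0 → j • γ + k • δ = 0 → k = 0 := by
  by_contra! hcon
  refine not_commensurable_of_two_le_finrank hrk γ fun δ hδ => ?_
  obtain ⟨m, hm⟩ := exists_hasValue_of_mem hx hν hδ
  obtain ⟨j, k, -, h2, hk⟩ := hcon m δ hm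
  exact ⟨k, -j, hk, by rw [neg_smul, ← sub_eq_zero, sub_neg_eq_add, add_comm, h2]⟩

include hx htr hK hν hrk

/-- A value taken in two degrees would use up one of the at most two dimensions of the lattice of
pairs (degree, value) on a vector of value zero. The values themselves would then have rank at most
one. -/
lemma HasValue.degree_unique {n n' : ℕ} {γ : Γ} (h : HasValue 𝒜 ν n γ)
    (h' : HasValue 𝒜 ν n' γ) : n = n' := by
  by_contra hne
  by_cases hγ : γ = 0
  · subst hγ
    obtain ⟨N, hN, hN0⟩ : ∃ N, HasValue 𝒜 ν N (0 : Γ) ∧ N ≠ 0 := by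
      rcases Nat.eq_zero_or_pos n with rfl | hn
      · exact ⟨n', h', fun h => hne h.symm⟩
      · exact ⟨n, h, hn.ne'⟩
    by_cases h1 : ∃ γ₁ ∈ valueSemigroup ν, γ₁ ≠ 0
    · obtain ⟨γ₁, hγ₁, hγ₁0⟩ := h1
      obtain ⟨n₁, hn₁⟩ := exists_hasValue_of_mem hx hν hγ₁
      refine not_commensurable_of_two_le_finrank hrk γ₁ fun γ₂ hγ₂ => ?_
      obtain ⟨n₂, hn₂⟩ := exists_hasValue_of_mem hx hν hγ₂
      obtain ⟨m, hm, hm1, hm2⟩ := exists_relation hx htr hK hν ![N, n₁, n₂] ![0, γ₁, γ₂]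
        (by intro i; fin_cases i <;> assumption)
      simp [Fin.sum_univ_three] at hm1 hm2
      refine ⟨m 2, -m 1, fun h2 => hm ?_, by
        rw [neg_smul, ← sub_eq_zero, sub_neg_eq_add, add_comm, hm2]⟩
      rw [h2, zero_smul, add_zero, smul_eq_zero] at hm2
      have h1 : m 1 = 0 := hm2.resolve_right hγ₁0
      have h0 : m 0 = 0 := by simpa [h1, h2, hN0] using hm1
      ext i; fin_cases i <;> assumption
    · push Not at h1
      exact not_commensurable_of_two_le_finrank hrk 0 fun γ₂ hγ₂ =>
        ⟨1, 0, one_ne_zero, by simp [h1 γ₂ hγ₂]⟩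
  · refine not_commensurable_of_two_le_finrank hrk γ fun γ₂ hγ₂ => ?_
    obtain ⟨n₂, hn₂⟩ := exists_hasValue_of_mem hx hν hγ₂
    obtain ⟨m, hm, hm1, hm2⟩ := exists_relation hx htr hK hν ![n, n', n₂] ![γ, γ, γ₂]
      (by intro i; fin_cases i <;> assumption)
    simp [Fin.sum_univ_three] at hm1 hm2
    refine ⟨m 2, -(m 0 + m 1), fun h2 => hm ?_, by
      rw [neg_smul, ← sub_eq_zero, sub_neg_eq_add, add_comm, add_smul, hm2]⟩
    rw [h2, zero_smul, add_zero, ← add_smul, smul_eq_zero] at hm2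
    have h1 : m 1 = - m 0 := by have := hm2.resolve_right hγ; omega
    have h0 : m 0 = 0 := by
      rw [h1, h2] at hm1
      have : m 0 * ((n : ℤ) - n') = 0 := by linear_combination hm1
      refine (mul_eq_zero.1 this).resolve_right fun h => hne ?_
      omega
    rw [h0, neg_zero] at h1
    ext i; fin_cases i <;> assumption

/-- If no scalar worked, every nonzero binary form of degree `l` in `a, b` would have value `l • γ`.
Adjoining an element `w` whose value is independent of that of `b` would then give three
algebraically independent elements. Degree zero is separate because it consists of constants. -/
lemma exists_sub_smul_lt [IsAlgClosed K] {n : ℕ} {a b : R} {γ : Γ} (ha : a ∈ 𝒜 n) (hb : b ∈ 𝒜 n)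
    (hνa : ν a = γ) (hνb : ν b = γ) : ∃ c : K, (γ : WithTop Γ) < ν (a - c • b) := by
  classical
  rcases Nat.eq_zero_or_pos n with rfl | hn
  · obtain ⟨c, rfl⟩ := hx.mem_zero ha
    obtain ⟨c', rfl⟩ := hx.mem_zero hb
    have hc' : c' ≠ 0 := by rintro rfl; simp at hνb
    refine ⟨c / c', ?_⟩
    rw [Algebra.smul_def, ← map_mul, div_mul_cancel₀ _ hc', sub_self, AddValuation.map_zero]
    exact WithTop.coe_lt_top _
  by_contra! hcon
  have hab : ∀ c : K, ν (a - c • b) = γ := by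
    intro c
    refine le_antisymm (hcon c) ?_
    refine AddValuation.map_le_sub ν hνa.ge ?_
    by_cases hc : c = 0
    · simp [hc]
    · rw [hK.map_smul hc, hνb]
  obtain ⟨m, δ, ⟨w, hw, hνw⟩, hind⟩ := exists_independent_value hx hν hrk n γ
  refine htr ![a, b, w] (algebraicIndependent_iff.2 fun P hP => ?_)
  by_contra hP0
  rw [aeval_def, eval₂_eq'] at hP
  simp only [Fin.prod_univ_three, Matrix.cons_val, ← Algebra.smul_def] at hP
  -- Monomials are grouped by their degree in `w` and their joint degree in `a, b`. Each group is `w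
  -- ^ k` times a binary form in `a, b`, of known value, and distinct groups differ in (degree,
  -- value).
  let key : (Fin 3 →₀ ℕ) → ℕ × ℕ := fun m => (m 2, m 0 + m 1)
  rw [← Finset.sum_fiberwise_of_maps_to
    (fun m hm => Finset.mem_image_of_mem key hm)] at hP
  have hterm : ∀ kl ∈ P.support.image key,
      ν (∑ m ∈ P.support with key m = kl, coeff m P • (a ^ m 0 * b ^ m 1 * w ^ m 2)) =
        ((kl.1 • δ + kl.2 • γ : Γ) : WithTop Γ) := by
    rintro ⟨k, l⟩ hkl
    obtain ⟨m₀, hm₀, hm₀'⟩ := Finset.mem_image.1 hkl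
    set q : Polynomial K := ∑ m ∈ P.support with key m = (k, l),
      Polynomial.monomial (m 0) (coeff m P) with hq
    have hkey : ∀ m, key m = (k, l) ↔ m 2 = k ∧ m 0 + m 1 = l := fun m => by simp [key]
    have h1 : ∑ m ∈ P.support with key m = (k, l), coeff m P • (a ^ m 0 * b ^ m 1 * w ^ m 2) =
        w ^ k * homogEval a b l q := by
      rw [hq, map_sum, Finset.mul_sum]
      refine Finset.sum_congr rfl fun m hm => ?_
      have hm' := (hkey m).1 (Finset.mem_filter.1 hm).2
      rw [homogEval_monomial _ _ (by omega), hm'.1, ← hm'.2, Nat.add_sub_cancel_left,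
        mul_smul_comm, mul_comm]
    have hq0 : q ≠ 0 := by
      intro h0
      have := congrArg (fun q => q.coeff (m₀ 0)) h0
      simp only [hq, Polynomial.finsetSum_coeff, Polynomial.coeff_zero] at this
      rw [Finset.sum_eq_single m₀] at this
      · simp only [Polynomial.coeff_monomial, if_pos] at this
        exact (mem_support_iff.1 hm₀) this
      · intro m hm hne
        rw [Polynomial.coeff_monomial, if_neg]
        intro hm0
        apply hne
        have hm' := (hkey m).1 (Finset.mem_filter.1 hm).2
        have hm₀'' := (hkey m₀).1 hm₀'
        ext i; fin_cases i
        · exact hm0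
        · simp only [Fin.mk_one]; omega
        · simp only [Fin.reduceFinMk]; omega
      · intro h; exact absurd (Finset.mem_filter.2 ⟨hm₀, hm₀'⟩) h
    have hql : q.natDegree ≤ l := by
      refine Polynomial.natDegree_sum_le_of_forall_le _ _ fun m hm => ?_
      have hm' := (hkey m).1 (Finset.mem_filter.1 hm).2
      exact (Polynomial.natDegree_monomial_le _).trans (by omega)
    rw [h1, AddValuation.map_mul, map_homogEval hK hνb hab l q hq0 hql, AddValuation.map_pow, hνw,
      WithTop.coe_add, WithTop.coe_nsmul, WithTop.coe_nsmul]
  refine hν.sum_ne_zero ((support_nonempty.2 hP0).image key) _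
    (fun kl => kl.1 * m + kl.2 * n) (fun kl hkl => ?_) (fun kl hkl => ?_)
    (fun kl hkl kl' hkl' h => ?_) hP
  · refine Submodule.sum_mem _ fun m' hm' => Submodule.smul_mem _ _ ?_
    have := (Finset.mem_filter.1 hm').2
    have h1 := hx.mul_mem (hx.mul_mem (hx.pow_mem ha (m' 0)) (hx.pow_mem hb (m' 1)))
      (hx.pow_mem hw (m' 2))
    rw [← this]
    simp only [key]
    convert h1 using 2
    ring
  · rw [hterm kl hkl]; exact WithTop.coe_ne_top
  · simp only [Prod.mk.injEq] at h
    rw [hterm kl hkl, hterm kl' hkl', WithTop.coe_inj] at h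
    have h1 : ((kl.1 : ℤ) - kl'.1) = 0 := by
      refine hind ((kl.2 : ℤ) - kl'.2) ((kl.1 : ℤ) - kl'.1) ?_ ?_
      · have := h.1
        zify at this
        linear_combination this
      · simp only [sub_smul, natCast_zsmul]
        rw [sub_add_sub_comm, add_comm, h.2, add_comm, sub_self]
    have h2 : kl.1 = kl'.1 := by omega
    have h3 := h.1
    rw [h2] at h3
    have h4 : kl.2 = kl'.2 := Nat.eq_of_mul_eq_mul_right hn (by omega)
    exact Prod.ext h2 h4

end Leaves


/-! ### From finite generation to a form vanishing at one point at most -/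

section Absorption

variable {K R Γ : Type*} [Field K] [CommRing R] [Algebra K R]
  [AddCommGroup Γ] [LinearOrder Γ] [IsOrderedAddMonoid Γ]

omit [LinearOrder Γ] [IsOrderedAddMonoid Γ] in
lemma exists_linearMap_pos [Module.Finite ℤ Γ] [Module.Free ℤ Γ] {e : Γ} (he : e ≠ 0) :
    ∃ ψ : Γ →ₗ[ℤ] ℤ, 0 < ψ e := by
  obtain ⟨f, hf⟩ : ∃ f : Module.Dual ℤ Γ, f e ≠ 0 := by
    by_contra! h
    exact he ((Module.forall_dual_apply_eq_zero_iff ℤ e).1 h)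
  rcases lt_or_gt_of_ne hf with h | h
  · exact ⟨-f, by simpa using h⟩
  · exact ⟨f, h⟩

/-- On the line of elements commensurable with `e`, a functional positive at `e` respects the order.
This lets integers replace values in `Γ`. -/
lemma pos_of_commensurable {ψ : Γ →ₗ[ℤ] ℤ} {e g : Γ} (he : 0 < e) (hψ : 0 < ψ e)
    (hg : ∃ k j : ℤ, k ≠ 0 ∧ k • g = j • e) (h : 0 < g) : 0 < ψ g := by
  obtain ⟨k, j, hk, hkj⟩ := hg
  have hkk : 0 < k * k := mul_self_pos.2 hk
  have h1 : (k * k) • g = (k * j) • e := by rw [mul_smul, hkj, mul_smul]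
  have h2 : 0 < (k * j) • e := h1 ▸ zsmul_pos h hkk
  have h3 : 0 < k * j := by
    by_contra! hcon
    have : 0 ≤ (-(k * j)) • e := zsmul_nonneg he.le (by omega)
    rw [neg_smul] at this
    exact absurd (neg_nonneg.1 this) (not_le.2 h2)
  have h4 : (k * k) * ψ g = (k * j) * ψ e := by
    have := congrArg ψ h1
    simpa using this
  exact pos_of_mul_pos_right (h4 ▸ mul_pos h3 hψ) hkk.le

omit [LinearOrder Γ] [IsOrderedAddMonoid Γ] in
lemma commensurable_sub {e g g' : Γ} (hg : ∃ k j : ℤ, k ≠ 0 ∧ k • g = j • e)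
    (hg' : ∃ k j : ℤ, k ≠ 0 ∧ k • g' = j • e) (a b : ℤ) :
    ∃ k j : ℤ, k ≠ 0 ∧ k • (a • g - b • g') = j • e := by
  obtain ⟨k, j, hk, h⟩ := hg
  obtain ⟨k', j', hk', h'⟩ := hg'
  refine ⟨k * k', a * (k' * j) - b * (k * j'), mul_ne_zero hk hk', ?_⟩
  rw [smul_sub, sub_smul, smul_smul, smul_smul, show k * k' * a = a * k' * k by ring,
    show k * k' * b = b * k * k' by ring, mul_smul (a * k'), h, mul_smul (b * k), h', smul_smul,
    smul_smul, mul_assoc, mul_assoc]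

variable {𝒜 : ℕ → Submodule K R} {x : Fin 3 → R} (hx : IsGradedBy 𝒜 x)
  (htr : ∀ g : Fin 3 → R, ¬ AlgebraicIndependent K g)
  {ν : AddValuation R (WithTop Γ)} (hK : IsKValuation K ν) (hν : IsHomogeneousValuation 𝒜 ν)
  [Module.Finite ℤ Γ] [Module.Free ℤ Γ]
  (hrk : 2 ≤ Module.finrank ℤ (Submodule.span ℤ (valueSemigroup ν : Set Γ)))

include hx hK hrk in
-- The least value of the three generators bounds every monomial. It is finite, since otherwise all
-- generators vanish and only constants, of value zero, remain.
lemma exists_min_value : ∃ γ₀ : Γ, HasValue 𝒜 ν 1 γ₀ ∧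
    ∀ n, ∀ a ∈ 𝒜 n, ((n • γ₀ : Γ) : WithTop Γ) ≤ ν a := by
  obtain ⟨i, hi⟩ := Finite.exists_min (fun i => ν (x i))
  have htop : ν (x i) ≠ ⊤ := by
    intro htop
    have hx0 : x = 0 := by
      ext j
      exact hK.eq_zero_of_top _ (top_le_iff.1 (htop ▸ hi j))
    refine not_commensurable_of_two_le_finrank hrk 0 fun γ hγ => ⟨1, 0, one_ne_zero, ?_⟩
    obtain ⟨f, hf⟩ := hγ
    obtain ⟨F, rfl⟩ := hx.surjective f
    rw [hx0, aeval_zero] at hf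
    have hc : constantCoeff F ≠ 0 := by
      intro h; rw [h] at hf; simp at hf
    rw [hK.map_const _ hc, eq_comm, WithTop.coe_eq_zero] at hf
    simp [hf]
  obtain ⟨γ₀, hγ₀⟩ := WithTop.ne_top_iff_exists.1 htop
  refine ⟨γ₀, ⟨x i, hx.X_mem i, hγ₀.symm⟩, fun n a ha => ?_⟩
  obtain ⟨F, hF, rfl⟩ := (hx.mem_iff _ _).1 ha
  rw [aeval_def, eval₂_eq']
  refine AddValuation.map_le_sum ν fun m hm => ?_
  have hm0 : coeff m F ≠ 0 := by simpa using hm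
  have hmn : m 0 + m 1 + m 2 = n := by
    have := hF hm0
    simpa [Finsupp.weight_apply, Finsupp.sum_fintype, Fin.sum_univ_three] using this
  rw [← Algebra.smul_def, hK.map_smul hm0, Fin.prod_univ_three]
  simp only [AddValuation.map_mul, AddValuation.map_pow]
  rw [← hmn, add_smul, add_smul]
  simp only [WithTop.coe_add, WithTop.coe_nsmul, hγ₀]
  exact add_le_add (add_le_add (nsmul_le_nsmul_right (hi 0) _) (nsmul_le_nsmul_right (hi 1) _))
    (nsmul_le_nsmul_right (hi 2) _)

include hx htr hK hν hrk in
-- Passing to offsets `γ - n • γ₀` divides the lattice of pairs, of rank at most two, by the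
-- direction of `(1, γ₀)`; a line remains.
lemma exists_commensurable {γ₀ : Γ} (h₀ : HasValue 𝒜 ν 1 γ₀) :
    ∃ m δ, HasValue 𝒜 ν m δ ∧ δ - m • γ₀ ≠ 0 ∧ ∀ n γ, HasValue 𝒜 ν n γ →
      ∃ k j : ℤ, k ≠ 0 ∧ k • (γ - n • γ₀) = j • (δ - m • γ₀) := by
  obtain ⟨m, δ, hδ, hδ0⟩ : ∃ m δ, HasValue 𝒜 ν m δ ∧ δ - m • γ₀ ≠ 0 := by
    by_contra! hcon
    refine not_commensurable_of_two_le_finrank hrk γ₀ fun γ hγ => ?_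
    obtain ⟨n, hn⟩ := exists_hasValue_of_mem hx hν hγ
    exact ⟨1, n, one_ne_zero, by rw [one_smul, natCast_zsmul, ← sub_eq_zero]; exact hcon n γ hn⟩
  refine ⟨m, δ, hδ, hδ0, fun n γ hγ => ?_⟩
  obtain ⟨c, hc, hc1, hc2⟩ := exists_relation hx htr hK hν ![1, m, n] ![γ₀, δ, γ]
    (by intro i; fin_cases i <;> assumption)
  simp [Fin.sum_univ_three] at hc1 hc2
  have hrel : c 2 • (γ - n • γ₀) + c 1 • (δ - m • γ₀) = 0 := by
    have h0 : c 0 = -(c 1 * m) - c 2 * n := by linarith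
    rw [h0, sub_smul, neg_smul, mul_smul, mul_smul, natCast_zsmul, natCast_zsmul] at hc2
    rw [smul_sub, smul_sub, ← hc2]
    abel
  refine ⟨c 2, -c 1, fun h2 => hc ?_, by rw [neg_smul]; exact eq_neg_of_add_eq_zero_left hrel⟩
  rw [h2, zero_smul, zero_add, smul_eq_zero] at hrel
  have h1 := hrel.resolve_right hδ0
  have h0 : c 0 = 0 := by simpa [h1, h2] using hc1
  ext i; fin_cases i <;> assumption

include hx htr hK hν hrk in
-- Let `τ` be a generator of largest offset per degree. Many copies of another generator of positive
-- offset can be traded for copies of `τ`, the degree left over being filled with `γ₀`. A value of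
-- large offset must contain many copies of some such generator.
lemma exists_absorbing_value (hfin : IsKhovanskiiFinite ν) {γ₀ : Γ} (h₀ : HasValue 𝒜 ν 1 γ₀)
    (hmin : ∀ n, ∀ a ∈ 𝒜 n, ((n • γ₀ : Γ) : WithTop Γ) ≤ ν a) :
    ∃ (ψ : Γ →ₗ[ℤ] ℤ) (k : ℕ) (γF : Γ) (C : ℤ), 0 < k ∧ HasValue 𝒜 ν k γF ∧
      (∀ n γ γ', HasValue 𝒜 ν n γ → HasValue 𝒜 ν n γ' → γ < γ' → ψ γ < ψ γ') ∧
      (∀ n γ, HasValue 𝒜 ν n γ → k * ψ (γ - n • γ₀) ≤ ψ (γF - k • γ₀) * n) ∧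
      ∀ n γ, HasValue 𝒜 ν n γ → C ≤ ψ (γ - n • γ₀) →
        ∃ n' γ', HasValue 𝒜 ν n' γ' ∧ n' + k = n ∧ γ' + γF = γ := by
  classical
  obtain ⟨m, δ, hδ, hδ0, hcomm⟩ := exists_commensurable hx htr hK hν hrk h₀
  have hnonneg : ∀ n γ, HasValue 𝒜 ν n γ → 0 ≤ γ - n • γ₀ := by
    rintro n γ ⟨a, ha, haγ⟩
    have := hmin n a ha
    rw [haγ, WithTop.coe_le_coe] at this
    exact sub_nonneg.2 this
  have hδpos : 0 < δ - m • γ₀ := lt_of_le_of_ne (hnonneg m δ hδ) hδ0.symm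
  obtain ⟨ψ, hψ⟩ := exists_linearMap_pos hδ0
  have hψ0 : ∀ n γ, HasValue 𝒜 ν n γ → 0 ≤ ψ (γ - n • γ₀) := by
    intro n γ hγ
    rcases (hnonneg n γ hγ).eq_or_lt with h | h
    · rw [← h, map_zero]
    · exact (pos_of_commensurable hδpos hψ (hcomm n γ hγ) h).le
  have hψinj : ∀ n γ n' γ' (a b : ℤ), HasValue 𝒜 ν n γ → HasValue 𝒜 ν n' γ' →
      a * ψ (γ - n • γ₀) = b * ψ (γ' - n' • γ₀) → a • (γ - n • γ₀) = b • (γ' - n' • γ₀) := by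
    intro n γ n' γ' a b h h' hab
    have h1 : ψ (a • (γ - n • γ₀) - b • (γ' - n' • γ₀)) = 0 := by
      rw [map_sub, map_smul, map_smul, smul_eq_mul, smul_eq_mul, hab, sub_self]
    have h2 := commensurable_sub (hcomm n γ h) (hcomm n' γ' h') a b
    have h3 := commensurable_sub (hcomm n' γ' h') (hcomm n γ h) b a
    rcases lt_trichotomy (a • (γ - n • γ₀)) (b • (γ' - n' • γ₀)) with h4 | h4 | h4
    · have := pos_of_commensurable hδpos hψ h3 (sub_pos.2 h4)
      rw [← neg_sub, map_neg, h1] at this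
      simp at this
    · exact h4
    · have := pos_of_commensurable hδpos hψ h2 (sub_pos.2 h4)
      exact absurd h1 this.ne'
  have hψmono : ∀ n γ γ', HasValue 𝒜 ν n γ → HasValue 𝒜 ν n γ' → γ < γ' → ψ γ < ψ γ' := by
    intro n γ γ' h h' hlt
    have h3 := commensurable_sub (hcomm n γ' h') (hcomm n γ h) 1 1
    have := pos_of_commensurable hδpos hψ h3 (by simpa using hlt)
    simpa using this
  obtain ⟨T, hT⟩ := hfin
  have hTS : ∀ t ∈ T, t ∈ valueSemigroup ν := fun t ht => hT ▸ AddSubmonoid.subset_closure ht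
  have hdeg : ∀ t : Γ, ∃ n, t ∈ T → HasValue 𝒜 ν n t := by
    intro t
    by_cases ht : t ∈ T
    · obtain ⟨n, hn⟩ := exists_hasValue_of_mem hx hν (hTS t ht)
      exact ⟨n, fun _ => hn⟩
    · exact ⟨0, fun h => absurd h ht⟩
  choose deg hdeg using hdeg
  set o : Γ → ℤ := fun t => ψ (t - deg t • γ₀) with ho
  have ho0 : ∀ t ∈ T, 0 ≤ o t := fun t ht => hψ0 _ _ (hdeg t ht)
  have hrep : ∀ n γ, HasValue 𝒜 ν n γ → ∃ c : Γ → ℕ, ∑ t ∈ T, c t • t = γ ∧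
      n = ∑ t ∈ T, c t * deg t ∧ ψ (γ - n • γ₀) = ∑ t ∈ T, c t * o t := by
    intro n γ h
    have h1 := h.mem
    rw [← hT, AddSubmonoid.mem_closure_finset] at h1
    obtain ⟨c, -, hc⟩ := h1
    have h2 := HasValue.sum hx T (fun t => c t * deg t) (fun t => c t • t)
      (fun t ht => (hdeg t ht).nsmul hx (c t))
    rw [hc] at h2
    have h3 := h.degree_unique hx htr hK hν hrk h2
    refine ⟨c, hc, h3, ?_⟩
    rw [h3, ← hc, Finset.sum_smul, ← Finset.sum_sub_distrib, map_sum]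
    refine Finset.sum_congr rfl fun t _ => ?_
    rw [mul_smul, ← smul_sub, map_nsmul, nsmul_eq_mul]
  have hne : ({t ∈ T | 0 < o t}).Nonempty := by
    by_contra hcon
    rw [Finset.not_nonempty_iff_eq_empty, Finset.filter_eq_empty_iff] at hcon
    obtain ⟨c, -, -, hc⟩ := hrep m δ hδ
    rw [hc, Finset.sum_eq_zero] at hψ
    · exact lt_irrefl _ hψ
    · intro t ht
      have := hcon ht
      have := ho0 t ht
      rw [show o t = 0 by omega, mul_zero]
  obtain ⟨τ, hτ, hτmax⟩ := Finset.exists_max_image _ (fun t => (o t : ℚ) / deg t) hne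
  rw [Finset.mem_filter] at hτ
  have hdegpos : ∀ t ∈ T, 0 < o t → 0 < deg t := by
    intro t ht hot
    rw [Nat.pos_iff_ne_zero]
    intro h0
    obtain ⟨a, ha, hat⟩ := hdeg t ht
    rw [h0] at ha
    obtain ⟨c, rfl⟩ := hx.mem_zero ha
    have hc : c ≠ 0 := by rintro rfl; simp at hat
    rw [hK.map_const c hc, eq_comm, WithTop.coe_eq_zero] at hat
    have h1 : o t = 0 := by
      simp only [ho, h0, zero_smul, sub_zero]
      rw [hat, map_zero]
    exact hot.ne' h1
  have hslope : ∀ t ∈ T, o t * deg τ ≤ o τ * deg t := by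
    intro t ht
    rcases (ho0 t ht).eq_or_lt with h | h
    · rw [← h, zero_mul]; exact mul_nonneg hτ.2.le (by positivity)
    · have h1 := hτmax t (by simp [ht, h])
      have h2 : (0 : ℚ) < deg t := by exact_mod_cast hdegpos t ht h
      have h3 : (0 : ℚ) < deg τ := by exact_mod_cast hdegpos τ hτ.1 hτ.2
      rw [div_le_div_iff₀ h2 h3] at h1
      exact_mod_cast h1
  -- If every generator of positive offset occurred fewer than `o τ` times, the total offset would
  -- be at most `o τ * ∑ t ∈ T, o t`; the bound lies just above this.
  refine ⟨ψ, deg τ, τ, o τ * ∑ t ∈ T, o t + 1, hdegpos τ hτ.1 hτ.2, hdeg τ hτ.1, hψmono,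
    fun n γ h => ?_, fun n γ h hC => ?_⟩
  · obtain ⟨c, -, h1, h2⟩ := hrep n γ h
    rw [h2, h1, Finset.mul_sum]
    push_cast
    rw [Finset.mul_sum]
    refine Finset.sum_le_sum fun t ht => ?_
    have := mul_le_mul_of_nonneg_left (hslope t ht) (Int.natCast_nonneg (c t))
    calc (deg τ : ℤ) * (c t * o t) = c t * (o t * deg τ) := by ring
      _ ≤ c t * (o τ * deg t) := this
      _ = _ := by simp only [ho]; ring
  · obtain ⟨c, hc, h1, h2⟩ := hrep n γ h
    obtain ⟨t, ht, hot, hct⟩ : ∃ t ∈ T, 0 < o t ∧ o τ ≤ c t := by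
      by_contra! hcon
      rw [h2, Finset.mul_sum] at hC
      have : ∑ t ∈ T, (c t : ℤ) * o t ≤ ∑ t ∈ T, o τ * o t := by
        refine Finset.sum_le_sum fun t ht => ?_
        rcases (ho0 t ht).eq_or_lt with h | h
        · rw [← h, mul_zero, mul_zero]
        · exact mul_le_mul_of_nonneg_right (hcon t ht h).le h.le
      omega
    obtain ⟨a, ha⟩ := Int.eq_ofNat_of_zero_le hot.le
    obtain ⟨b, hb⟩ := Int.eq_ofNat_of_zero_le hτ.2.le
    -- The exchange trades `b = o τ` copies of `t` for `a = o t` copies of `τ` and `l` copies of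
    -- `γ₀`; both sides have offset `a * b`. The number `l` balances the degrees and is nonnegative
    -- because `τ` has the largest slope.
    obtain ⟨l, hl⟩ := Int.eq_ofNat_of_zero_le (sub_nonneg.2 (hslope t ht))
    have hab : (b : ℤ) • (t - deg t • γ₀) = (a : ℤ) • (τ - deg τ • γ₀) := by
      refine hψinj _ _ _ _ _ _ (hdeg t ht) (hdeg τ hτ.1) ?_
      change (b : ℤ) * o t = a * o τ
      rw [ha, hb]; ring
    have hab' : b • t = a • τ + l • γ₀ := by
      rw [smul_sub, smul_sub, natCast_zsmul, natCast_zsmul, natCast_zsmul, natCast_zsmul,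
        sub_eq_sub_iff_add_eq_add, ← mul_smul, ← mul_smul] at hab
      have hl' : b * deg t = l + a * deg τ := by
        rw [ha, hb] at hl
        have : (b : ℤ) * deg t = l + a * deg τ := by linear_combination hl
        exact_mod_cast this
      rw [hl', add_smul] at hab
      have := add_right_cancel (b := (a * deg τ) • γ₀) (a := b • t) (c := a • τ + l • γ₀)
        (by rw [hab]; abel)
      exact this
    have hcb : b ≤ c t := by rw [hb] at hct; exact_mod_cast hct
    have ha1 : 1 ≤ a := by rw [ha] at hot; exact_mod_cast hot
    have hval := ((HasValue.sum hx (T.erase t) (fun t => c t * deg t) (fun t => c t • t)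
      (fun t ht => (hdeg t (Finset.mem_of_mem_erase ht)).nsmul hx (c t))).add hx
      ((hdeg t ht).nsmul hx (c t - b))).add hx
      (((hdeg τ hτ.1).nsmul hx (a - 1)).add hx (h₀.nsmul hx l))
    refine ⟨_, _, hval, ?_, ?_⟩
    swap
    · rw [← hc, ← Finset.sum_erase_add _ _ ht]
      have h5 : c t • t = (c t - b) • t + b • t := by rw [← add_smul, Nat.sub_add_cancel hcb]
      have h6 : a • τ = (a - 1) • τ + τ := by rw [← succ_nsmul, Nat.sub_add_cancel ha1]
      rw [h5, hab', h6]
      abel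
    · refine HasValue.degree_unique hx htr hK hν hrk (hval.add hx (hdeg τ hτ.1)) ?_
      convert h using 1
      rw [← hc, ← Finset.sum_erase_add _ _ ht]
      have h5 : c t • t = (c t - b) • t + b • t := by rw [← add_smul, Nat.sub_add_cancel hcb]
      have h6 : a • τ = (a - 1) • τ + τ := by rw [← succ_nsmul, Nat.sub_add_cancel ha1]
      rw [h5, hab', h6]
      abel

/-- There is a nonzero form `F` of degree `k` such that all linear forms in some hyperplane are
nilpotent modulo `F`: geometrically, `F` vanishes at most at one point. -/
def HasOnePointSection (𝒜 : ℕ → Submodule K R) (k M : ℕ) : Prop :=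
  ∃ F ∈ 𝒜 k, F ≠ 0 ∧ ∃ H : Submodule K R, ∃ z ∈ 𝒜 1, z ∉ H ∧
    (∀ a ∈ 𝒜 1, ∃ c : K, a - c • z ∈ H) ∧
    ∀ u ∈ 𝒜 1, u ∈ H → ∃ G ∈ 𝒜 M, u ^ (k + M) = F * G

include hx htr hK hν hrk in
-- Take `F` with the absorbing value. An element of large offset shares its value with some multiple
-- of `F`; subtracting a scalar times that multiple raises the value, and the slope bound stops the
-- process. Powers of a linear form of value above `γ₀` reach large offset.
theorem exists_hasOnePointSection [IsAlgClosed K] (hfin : IsKhovanskiiFinite ν) :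
    ∃ k M, 0 < k ∧ HasOnePointSection 𝒜 k M := by
  obtain ⟨γ₀, ⟨z, hz, hzν⟩, hmin⟩ := exists_min_value hx hK hrk
  obtain ⟨ψ, k, γF, C, hk, ⟨F, hF, hFν⟩, hmono, hbound, habs⟩ :=
    exists_absorbing_value hx htr hK hν hrk hfin ⟨z, hz, hzν⟩ hmin
  have hF0 : F ≠ 0 := by rintro rfl; simp at hFν
  -- Here `N` exceeds the distance to the slope bound. Each subtraction raises the integral offset
  -- by at least one, and `N = 0` would violate the bound.
  have hdiv : ∀ (N : ℕ) (n : ℕ) (a : R) (γ : Γ), a ∈ 𝒜 n → ν a = γ → C ≤ ψ (γ - n • γ₀) →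
      ψ (γF - k • γ₀) * n < k * ψ (γ - n • γ₀) + N → ∃ n', n' + k = n ∧ ∃ G ∈ 𝒜 n', a = F * G := by
    intro N
    induction N with
    | zero =>
      intro n a γ ha haν _ hlt
      have := hbound n γ ⟨a, ha, haν⟩
      push_cast at hlt
      omega
    | succ N ih =>
      intro n a γ ha haν hC hlt
      obtain ⟨n', γ', ⟨G, hG, hGν⟩, rfl, rfl⟩ := habs n γ ⟨a, ha, haν⟩ hC
      have hFG : F * G ∈ 𝒜 (n' + k) := add_comm k n' ▸ hx.mul_mem hF hG
      obtain ⟨c, hc⟩ := exists_sub_smul_lt hx htr hK hν hrk ha hFG haν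
        (by rw [AddValuation.map_mul, hFν, hGν, add_comm, WithTop.coe_add])
      by_cases h0 : a - c • (F * G) = 0
      · exact ⟨n', rfl, c • G, Submodule.smul_mem _ _ hG, by
          rw [mul_smul_comm, ← sub_eq_zero, h0]⟩
      · have hmem : a - c • (F * G) ∈ 𝒜 (n' + k) :=
          Submodule.sub_mem _ ha (Submodule.smul_mem _ _ hFG)
        obtain ⟨γ₁, hγ₁⟩ := WithTop.ne_top_iff_exists.1
          (fun h => h0 (hK.eq_zero_of_top _ h))
        rw [← hγ₁, WithTop.coe_lt_coe] at hc
        have hψ := hmono _ _ _ ⟨a, ha, haν⟩ ⟨_, hmem, hγ₁.symm⟩ hc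
        have h1 : ψ (γ' + γF - (n' + k) • γ₀) < ψ (γ₁ - (n' + k) • γ₀) := by
          rw [map_sub, map_sub]; omega
        obtain ⟨n'', hn'', G', hG', h2⟩ := ih (n' + k) _ γ₁ hmem hγ₁.symm (by omega) (by
          have : (k : ℤ) * (ψ (γ' + γF - (n' + k) • γ₀) + 1) ≤
            k * ψ (γ₁ - (n' + k) • γ₀) := mul_le_mul_of_nonneg_left h1 (by positivity)
          have hk' : (1 : ℤ) ≤ k := by exact_mod_cast hk
          push_cast at hlt ⊢
          rw [mul_add, mul_one] at this
          omega)
        have : n'' = n' := by omega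
        subst this
        refine ⟨n'', rfl, c • G + G', Submodule.add_mem _ (Submodule.smul_mem _ _ hG) hG', ?_⟩
        rw [mul_add, ← h2, mul_smul_comm]
        abel
  -- The elements of value above `γ₀`. By one-dimensionality of leaves, every linear form is
  -- congruent to a multiple of `z` modulo `H`.
  let H : Submodule K R :=
    { carrier := {u | (γ₀ : WithTop Γ) < ν u}
      zero_mem' := by simp
      add_mem' := fun {a b} ha hb => AddValuation.map_lt_add ν ha hb
      smul_mem' := fun c a ha => by
        by_cases hc : c = 0
        · simp [hc]
        · simpa [hK.map_smul hc] using ha }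
  refine ⟨k, C.toNat, hk, F, hF, hF0, H, z, hz, fun h => ?_, fun a ha => ?_, fun u hu huH => ?_⟩
  · have : (γ₀ : WithTop Γ) < ν z := h
    rw [hzν] at this
    exact lt_irrefl _ this
  · have h1 := hmin 1 a ha
    rw [one_smul] at h1
    rcases h1.eq_or_lt with h | h
    · exact exists_sub_smul_lt hx htr hK hν hrk ha hz h.symm hzν
    · exact ⟨0, by simpa [H] using h⟩
  · by_cases hu0 : u = 0
    · exact ⟨0, Submodule.zero_mem _, by rw [hu0, mul_zero, zero_pow (by omega)]⟩
    obtain ⟨γ, hγ⟩ := WithTop.ne_top_iff_exists.1 (fun h => hu0 (hK.eq_zero_of_top _ h))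
    have hlt : γ₀ < γ := by
      have : (γ₀ : WithTop Γ) < ν u := huH
      rwa [← hγ, WithTop.coe_lt_coe] at this
    have hψ := hmono 1 _ _ ⟨z, hz, hzν⟩ ⟨u, hu, hγ.symm⟩ hlt
    have hN : ψ ((k + C.toNat) • γ - (k + C.toNat) • γ₀) = (k + C.toNat : ℕ) * (ψ γ - ψ γ₀) := by
      rw [← smul_sub, map_nsmul, map_sub, nsmul_eq_mul]
    -- The offset of `u` is a positive integer, so the power `k + C.toNat` has offset at least `C`
    -- and can be divided by `F`.
    have hge : (k + C.toNat : ℕ) ≤ ψ ((k + C.toNat) • γ - (k + C.toNat) • γ₀) := by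
      rw [hN]
      exact le_mul_of_one_le_right (by positivity) (by omega)
    have hmem : u ^ (k + C.toNat) ∈ 𝒜 (k + C.toNat) := by
      simpa using hx.pow_mem hu (k + C.toNat)
    obtain ⟨n', hn', G, hG, h⟩ := hdiv
      (ψ (γF - k • γ₀) * (k + C.toNat : ℕ) + 1).toNat (k + C.toNat) _ ((k + C.toNat) • γ) hmem
      (by rw [AddValuation.map_pow, ← hγ, WithTop.coe_nsmul])
      (by push_cast at hge; omega) (by
        have : 0 ≤ (k : ℤ) * ψ ((k + C.toNat) • γ - (k + C.toNat) • γ₀) :=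
          mul_nonneg (by positivity) (le_trans (by positivity) hge)
        omega)
    have : n' = C.toNat := by omega
    subst this
    exact ⟨G, hG, h⟩

end Absorption


/-! ### A rational plane curve with two cusps -/

section Evaluation

lemma _root_.MvPolynomial.IsHomogeneous.eval₂_mul {σ A B : Type*} [CommSemiring A] [CommSemiring B] {F : MvPolynomial σ A}
    {k : ℕ} (hF : F.IsHomogeneous k) (f : A →+* B) (t : B) (p : σ → B) :
    eval₂ f (fun i => t * p i) F = t ^ k * eval₂ f p F := by
  rw [eval₂_eq, eval₂_eq, Finset.mul_sum]
  refine Finset.sum_congr rfl fun m hm => ?_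
  simp only [mul_pow, Finset.prod_mul_distrib]
  rw [Finset.prod_pow_eq_pow_sum, show ∑ i ∈ m.support, m i = k from
    (hF.degree_eq_sum_deg_support hm).symm]
  ring

lemma _root_.MvPolynomial.IsHomogeneous.aeval_mul {σ A B : Type*} [CommSemiring A] [CommSemiring B] [Algebra A B]
    {F : MvPolynomial σ A} {k : ℕ} (hF : F.IsHomogeneous k) (t : B) (p : σ → B) :
    aeval (fun i => t * p i) F = t ^ k * aeval p F :=
  hF.eval₂_mul _ t p

lemma _root_.MvPolynomial.IsHomogeneous.eval_mul {σ A : Type*} [CommSemiring A]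
    {F : MvPolynomial σ A} {k : ℕ} (hF : F.IsHomogeneous k) (t : A) (p : σ → A) :
    eval (fun i => t * p i) F = t ^ k * eval p F :=
  hF.eval₂_mul _ t p

lemma _root_.MvPolynomial.IsHomogeneous.eval_single {σ A : Type*} [CommSemiring A] [DecidableEq σ]
    {F : MvPolynomial σ A} {k : ℕ} (hF : F.IsHomogeneous k) (i : σ) :
    eval (Pi.single i 1) F = coeff (Finsupp.single i k) F := by
  rw [eval_eq, Finset.sum_eq_single (Finsupp.single i k)]
  · rw [Finset.prod_eq_one, mul_one]
    intro j hj
    obtain rfl : j = i := by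
      by_contra hne
      simp [Ne.symm hne] at hj
    simp
  · intro m hm hne
    obtain ⟨j, hj, hji⟩ : ∃ j ∈ m.support, j ≠ i := by
      by_contra! hcon
      refine hne (Finsupp.ext fun j => ?_)
      have hs := hF.degree_eq_sum_deg_support hm
      by_cases hji : j = i
      · subst hji
        rw [Finsupp.single_eq_same, hs]
        by_cases hmj : m j = 0
        · rw [hmj, eq_comm]
          refine Finset.sum_eq_zero fun l hl => ?_
          rw [hcon l hl, hmj]
        · rw [Finset.sum_eq_single j (fun l hl hlj => absurd (hcon l hl) hlj)
            (fun h => by simpa using h)]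
      · rw [Finsupp.single_apply, if_neg (Ne.symm hji)]
        by_contra h
        exact hji (hcon j (by simpa using h))
    rw [Finset.prod_eq_zero hj, mul_zero]
    rw [Pi.single_eq_of_ne hji, zero_pow (by simpa using hj)]
  · intro h
    rw [notMem_support_iff.1 h, zero_mul]

lemma aeval_polynomial_eval {σ A : Type*} [CommRing A] (V : σ → Polynomial A)
    (F : MvPolynomial σ A) (t : A) :
    (aeval V F).eval t = eval (fun i => (V i).eval t) F := by
  have := eval₂_comp_left (Polynomial.evalRingHom t) (algebraMap A (Polynomial A)) V F
  rw [aeval_def, ← Polynomial.coe_evalRingHom, this]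
  have h2 : (Polynomial.evalRingHom t).comp (algebraMap A (Polynomial A)) = RingHom.id A := by
    ext; simp
  rw [h2]
  rfl

end Evaluation

/-! ### The bicuspidal curve and its parametrization -/

section Curve

variable (A : Type*) [CommRing A]

/-- The linear form `X₀ - 4 X₁`. -/
noncomputable def tangentForm : MvPolynomial (Fin 3) A := X 0 - 4 * X 1

/-- The form of degree `n` which takes the value `(w (w - 1)) ^ n + (1 - w) ^ n` on
`((w + 1) ^ 2, w)`. -/
noncomputable def traceForm : ℕ → MvPolynomial (Fin 3) A
  | 0 => 2
  | 1 => tangentForm A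
  | n + 2 => tangentForm A * traceForm (n + 1) + tangentForm A * X 1 * traceForm n

/-- A form of degree `n + 2` that defines a rational plane curve with two cusps. -/
noncomputable def bicuspidalForm (n : ℕ) : MvPolynomial (Fin 3) A :=
  X 1 ^ n * X 2 ^ 2 - traceForm A n * X 0 * X 2 + (-1) ^ n * tangentForm A ^ n * X 0 ^ 2

/-- The parametrization of the curve defined by `bicuspidalForm`. -/
noncomputable def bicuspidalParam (n : ℕ) : Fin 3 → Polynomial A :=
  ![(Polynomial.X + 1) ^ 2, Polynomial.X, (Polynomial.X + 1) ^ 2 * (Polynomial.X - 1) ^ n]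

lemma tangentForm_isHomogeneous : (tangentForm A).IsHomogeneous 1 := by
  refine (isHomogeneous_X _ _).sub ?_
  have : (4 : MvPolynomial (Fin 3) A) = C 4 := (map_ofNat C 4).symm
  rw [this]
  exact isHomogeneous_C_mul_X _ _

lemma traceForm_isHomogeneous (n : ℕ) : (traceForm A n).IsHomogeneous n := by
  induction n using Nat.twoStepInduction with
  | zero =>
    have : (2 : MvPolynomial (Fin 3) A) = C 2 := (map_ofNat C 2).symm
    rw [traceForm, this]
    exact isHomogeneous_C _ _
  | one => exact tangentForm_isHomogeneous A
  | more n ih1 ih2 =>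
    rw [traceForm]
    have h := tangentForm_isHomogeneous A
    have h1 := h.mul ih2
    have h2 := (h.mul (isHomogeneous_X A 1)).mul ih1
    rw [show 1 + (n + 1) = n + 2 by ring] at h1
    rw [show 1 + 1 + n = n + 2 by ring] at h2
    exact h1.add h2

lemma bicuspidalForm_isHomogeneous (n : ℕ) : (bicuspidalForm A n).IsHomogeneous (n + 2) := by
  have h1 := (isHomogeneous_X_pow (R := A) (1 : Fin 3) n).mul (isHomogeneous_X_pow (2 : Fin 3) 2)
  have h2 := ((traceForm_isHomogeneous A n).mul (isHomogeneous_X A 0)).mul (isHomogeneous_X A 2)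
  have h3 := ((isHomogeneous_C (Fin 3) ((-1 : A) ^ n)).mul
    ((tangentForm_isHomogeneous A).pow n)).mul (isHomogeneous_X_pow (R := A) (0 : Fin 3) 2)
  rw [show 0 + 1 * n + 2 = n + 2 by ring] at h3
  simp only [map_pow, map_neg, map_one] at h3
  exact (h1.sub h2).add h3

variable {A}

lemma map_tangentForm {B : Type*} [CommRing B] (φ : A →+* B) :
    map φ (tangentForm A) = tangentForm B := by
  simp [tangentForm]

lemma map_traceForm {B : Type*} [CommRing B] (φ : A →+* B) (n : ℕ) :
    map φ (traceForm A n) = traceForm B n := by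
  induction n using Nat.twoStepInduction with
  | zero => simp [traceForm]
  | one => exact map_tangentForm φ
  | more n ih1 ih2 => simp [traceForm, ih1, ih2, map_tangentForm]

lemma map_bicuspidalForm {B : Type*} [CommRing B] (φ : A →+* B) (n : ℕ) :
    map φ (bicuspidalForm A n) = bicuspidalForm B n := by
  simp [bicuspidalForm, map_traceForm, map_tangentForm]

lemma eval_tangentForm (p : Fin 3 → A) : eval p (tangentForm A) = p 0 - 4 * p 1 := by
  simp [tangentForm]

/-- The defining recursion is Newton's for power sums of `w (w - 1)` and `1 - w`, whose sum is `(w -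
1)²` and whose product is `-w (w - 1)²`. -/
lemma eval_traceForm {B : Type*} [CommRing B] [Algebra A B] (t w : B) (p : Fin 3 → B)
    (h0 : p 0 = t * (w + 1) ^ 2) (h1 : p 1 = t * w) (n : ℕ) :
    aeval p (traceForm A n) = t ^ n * ((w * (w - 1)) ^ n + (1 - w) ^ n) := by
  induction n using Nat.twoStepInduction with
  | zero => simp [traceForm]; norm_num
  | one => simp [traceForm, tangentForm, h0, h1]; ring
  | more n ih1 ih2 =>
    simp only [traceForm, tangentForm, map_add, map_mul, ih1, ih2, map_sub, aeval_X, h0, h1,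
      map_ofNat]
    ring

/-- The first two coordinates determine `w` up to inversion. The form is the quadratic in `X 2`
whose roots are the third coordinates at `w` and `w⁻¹`, cleared of denominators by `X 1 ^ n`. -/
lemma aeval_bicuspidalForm {B : Type*} [CommRing B] [Algebra A B] (t w : B) (n : ℕ) :
    aeval ![t * (w + 1) ^ 2, t * w, t * ((w + 1) ^ 2 * (w - 1) ^ n)] (bicuspidalForm A n) = 0 := by
  have h := eval_traceForm (A := A) t w ![t * (w + 1) ^ 2, t * w, t * ((w + 1) ^ 2 * (w - 1) ^ n)]
    (by simp) (by simp) n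
  simp only [bicuspidalForm, tangentForm, map_add, map_sub, map_mul, map_pow, aeval_X, h, map_neg,
    map_one, map_ofNat, Matrix.cons_val]
  have h1 : t * (w + 1) ^ 2 - 4 * (t * w) = t * (w - 1) ^ 2 := by ring
  have h2 : (1 - w) ^ n = (-1) ^ n * (w - 1) ^ n := by rw [← mul_pow]; ring
  rw [h1, h2]
  simp only [mul_pow, ← pow_mul]
  ring

lemma aeval_bicuspidalParam (n : ℕ) : aeval (bicuspidalParam A n) (bicuspidalForm A n) = 0 := by
  simpa [bicuspidalParam] using aeval_bicuspidalForm (A := A) (1 : Polynomial A) Polynomial.X n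

lemma eval_one_zero_zero_bicuspidalForm {n : ℕ} (hn : n ≠ 0) (c : A) :
    eval ![1, 0, c] (bicuspidalForm A n) = (-1) ^ n + (if n = 0 then 1 else 0) - c *
      eval ![1, 0, c] (traceForm A n) := by
  simp [bicuspidalForm, tangentForm, hn]
  ring

lemma eval_traceForm_one_zero {n : ℕ} (hn : n ≠ 0) (c : A) :
    eval ![1, 0, c] (traceForm A n) = 1 := by
  induction n using Nat.twoStepInduction with
  | zero => exact absurd rfl hn
  | one => simp [traceForm, tangentForm]
  | more n ih1 ih2 => simp [traceForm, tangentForm, ih2]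

lemma coeff_bicuspidalForm {n : ℕ} (hn : n ≠ 0) :
    coeff (Finsupp.single 0 (n + 2)) (bicuspidalForm A n) = (-1) ^ n := by
  rw [← (bicuspidalForm_isHomogeneous A n).eval_single]
  have : (Pi.single 0 1 : Fin 3 → A) = ![1, 0, 0] := by
    ext i; fin_cases i <;> rfl
  rw [this, eval_one_zero_zero_bicuspidalForm hn]
  simp [hn]

end Curve

/-! ### The homogeneous ideal of the bicuspidal curve -/

section Kernel

variable {Ω : Type*} [Field Ω]

/-- The form is quadratic in `X 2` with leading coefficient `X 1 ^ n`, so after multiplication by a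
power of `X 1` the remainder is linear in `X 2`. -/
lemma exists_pseudo_division (n : ℕ) (F : MvPolynomial (Fin 3) Ω) :
    ∃ M G, ∃ α ∈ (rename Fin.castSucc : MvPolynomial (Fin 2) Ω →ₐ[Ω] _).range,
      ∃ β ∈ (rename Fin.castSucc : MvPolynomial (Fin 2) Ω →ₐ[Ω] _).range,
      X 1 ^ M * F = bicuspidalForm Ω n * G + α * X 2 + β := by
  set B := (rename Fin.castSucc : MvPolynomial (Fin 2) Ω →ₐ[Ω] MvPolynomial (Fin 3) Ω).range
    with hB
  have h0 : X 0 ∈ B := ⟨X 0, by simp⟩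
  have h1 : X 1 ∈ B := ⟨X 1, by simp⟩
  have h4 : tangentForm Ω ∈ B := sub_mem h0 (mul_mem (ofNat_mem B 4) h1)
  have hT : traceForm Ω n ∈ B := by
    induction n using Nat.twoStepInduction with
    | zero => exact ofNat_mem B 2
    | one => exact h4
    | more n ih1 ih2 => exact add_mem (mul_mem h4 ih2) (mul_mem (mul_mem h4 h1) ih1)
  induction F using MvPolynomial.induction_on with
  | C a => exact ⟨0, 0, 0, zero_mem _, C a, ⟨C a, by simp⟩, by simp⟩
  | add F₁ F₂ ih₁ ih₂ =>
    obtain ⟨M₁, G₁, α₁, hα₁, β₁, hβ₁, e₁⟩ := ih₁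
    obtain ⟨M₂, G₂, α₂, hα₂, β₂, hβ₂, e₂⟩ := ih₂
    refine ⟨M₁ + M₂, X 1 ^ M₂ * G₁ + X 1 ^ M₁ * G₂, X 1 ^ M₂ * α₁ + X 1 ^ M₁ * α₂,
      add_mem (mul_mem (pow_mem h1 _) hα₁) (mul_mem (pow_mem h1 _) hα₂),
      X 1 ^ M₂ * β₁ + X 1 ^ M₁ * β₂,
      add_mem (mul_mem (pow_mem h1 _) hβ₁) (mul_mem (pow_mem h1 _) hβ₂), ?_⟩
    rw [pow_add]
    linear_combination X 1 ^ M₂ * e₁ + X 1 ^ M₁ * e₂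
  | mul_X F i ih =>
    obtain ⟨M, G, α, hα, β, hβ, e⟩ := ih
    have hcases : X i ∈ B ∨ i = 2 := by
      fin_cases i
      · exact Or.inl h0
      · exact Or.inl h1
      · exact Or.inr rfl
    rcases hcases with hi | rfl
    · exact ⟨M, G * X i, α * X i, mul_mem hα hi, β * X i, mul_mem hβ hi, by
        linear_combination X i * e⟩
    · refine ⟨M + n, X 1 ^ n * G * X 2 + α, α * traceForm Ω n * X 0 + X 1 ^ n * β,
        add_mem (mul_mem (mul_mem hα hT) h0) (mul_mem (pow_mem h1 _) hβ),
        -(α * ((-1) ^ n * tangentForm Ω ^ n * X 0 ^ 2)),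
        neg_mem (mul_mem hα (mul_mem (mul_mem (pow_mem (neg_mem (one_mem _)) _) (pow_mem h4 _))
          (pow_mem h0 _))), ?_⟩
      rw [pow_add]
      have hf : bicuspidalForm Ω n = X 1 ^ n * X 2 ^ 2 - traceForm Ω n * X 0 * X 2 +
        (-1) ^ n * tangentForm Ω ^ n * X 0 ^ 2 := rfl
      linear_combination X 1 ^ n * X 2 * e - α * hf

variable [IsAlgClosed Ω]

/-- The kernel of the parametrization is generated by `bicuspidalForm`. -/
theorem bicuspidalForm_dvd {n : ℕ} (hn : n ≠ 0) {k : ℕ} {F : MvPolynomial (Fin 3) Ω}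
    (hF : F.IsHomogeneous k) (h : aeval (bicuspidalParam Ω n) F = 0) :
    bicuspidalForm Ω n ∣ F := by
  obtain ⟨M, G, α, ⟨α, rfl⟩, β, ⟨β, rfl⟩, e⟩ := exists_pseudo_division n F
  set P : Ω → Ω → Fin 3 → Ω := fun t w =>
    ![t * (w + 1) ^ 2, t * w, t * ((w + 1) ^ 2 * (w - 1) ^ n)] with hP
  have hev : ∀ t w, eval (P t w) F = 0 := by
    intro t w
    have h1 : P t w = fun i => t * (bicuspidalParam Ω n i).eval w := by
      ext i; fin_cases i <;> simp [hP, bicuspidalParam]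
    rw [h1, hF.eval_mul, ← aeval_polynomial_eval, h, Polynomial.eval_zero, mul_zero]
  have hev0 : ∀ t w, eval (P t w) (bicuspidalForm Ω n) = 0 := fun t w =>
    aeval_bicuspidalForm (A := Ω) t w n
  have key : ∀ t w, eval ![t * (w + 1) ^ 2, t * w] α * (t * ((w + 1) ^ 2 * (w - 1) ^ n)) +
      eval ![t * (w + 1) ^ 2, t * w] β = 0 := by
    intro t w
    have h1 := congrArg (eval (P t w)) e
    have h2 : P t w ∘ Fin.castSucc = ![t * (w + 1) ^ 2, t * w] := by
      ext i; fin_cases i <;> rfl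
    simp only [map_mul, map_add, hev, hev0, mul_zero, zero_mul, zero_add, AlgHom.toRingHom_eq_coe,
      RingHom.coe_coe, eval_rename, h2, eval_X] at h1
    exact h1.symm
  -- The parameter `w` solves `b (w + 1)² = a w`; it is nonzero because the constant term is `b`.
  have hlift : ∀ a b : Ω, b ≠ 0 → ∃ t w, t * (w + 1) ^ 2 = a ∧ t * w = b ∧ w ≠ 0 := by
    intro a b hb
    obtain ⟨w, hw⟩ := IsAlgClosed.exists_root
      (Polynomial.C b * Polynomial.X ^ 2 + Polynomial.C (2 * b - a) * Polynomial.X +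
        Polynomial.C b) (by rw [Polynomial.degree_quadratic hb]; decide)
    simp only [Polynomial.IsRoot, Polynomial.eval_add, Polynomial.eval_mul, Polynomial.eval_C,
      Polynomial.eval_pow, Polynomial.eval_X] at hw
    have hw0 : w ≠ 0 := by rintro rfl; simp at hw; exact hb hw
    refine ⟨b / w, w, ?_, div_mul_cancel₀ _ hw0, hw0⟩
    field_simp
    linear_combination hw
  have hα : α = 0 := by
    -- Up to the factor `X 0 ^ 2`, the discriminant of the form as a quadratic in `X 2`.
    set D : MvPolynomial (Fin 3) Ω :=
      traceForm Ω n ^ 2 - 4 * (-1) ^ n * X 1 ^ n * tangentForm Ω ^ n with hD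
    have hD0 : D ≠ 0 := by
      intro h0
      have := congrArg (eval ![1, 0, 0]) h0
      simp [hD, eval_traceForm_one_zero hn, hn] at this
    have hz : rename Fin.castSucc α * (X 0 * X 1 * D) = 0 := by
      refine MvPolynomial.funext fun (p : Fin 3 → Ω) => ?_
      simp only [map_mul, eval_rename, eval_X, map_zero]
      by_contra hne
      have h0 : p 0 ≠ 0 := by rintro h; simp [h] at hne
      have h1 : p 1 ≠ 0 := by rintro h; simp [h] at hne
      have hDp : eval p D ≠ 0 := by rintro h; simp [h] at hne
      obtain ⟨t, w, ht0, ht1, hw⟩ := hlift (p 0) (p 1) h1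
      have hp : p ∘ Fin.castSucc = ![p 0, p 1] := by ext i; fin_cases i <;> rfl
      -- The parameters `(t, w)` and `(t w², w⁻¹)` agree in the first two coordinates. Where `X 0 *
      -- X 1 * D` is nonzero their third coordinates differ, so a linear polynomial in `X 2`
      -- vanishing at both has zero leading coefficient.
      have k1 := key t w
      have k2 := key (t * w ^ 2) w⁻¹
      have e0 : t * w ^ 2 * (w⁻¹ + 1) ^ 2 = p 0 := by rw [← ht0]; field_simp; ring
      have e1 : t * w ^ 2 * w⁻¹ = p 1 := by rw [← ht1]; field_simp
      rw [ht0, ht1] at k1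
      rw [e0, e1] at k2
      rw [← mul_assoc t, ht0] at k1
      rw [← mul_assoc (t * w ^ 2), e0] at k2
      have h3 : eval ![p 0, p 1] α * (p 0 * ((w - 1) ^ n - (w⁻¹ - 1) ^ n)) = 0 := by
        linear_combination k1 - k2
      have h4 : (w - 1) ^ n - (w⁻¹ - 1) ^ n = 0 := by
        rcases mul_eq_zero.1 h3 with h5 | h5
        · rw [hp, h5] at hne; simp at hne
        · exact (mul_eq_zero.1 h5).resolve_left h0
      have h5 : (w * (w - 1)) ^ n = (1 - w) ^ n := by
        rw [mul_pow, sub_eq_zero.1 h4, ← mul_pow]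
        congr 1
        field_simp
      apply hDp
      have h6 : eval p (traceForm Ω n) = t ^ n * ((w * (w - 1)) ^ n + (1 - w) ^ n) :=
        eval_traceForm (A := Ω) t w p ht0.symm ht1.symm n
      simp only [hD, map_sub, map_mul, map_pow, h6, eval_tangentForm, eval_X, map_neg, map_one,
        map_ofNat, ← ht0, ← ht1]
      have h7 : t * (w + 1) ^ 2 - 4 * (t * w) = t * (w - 1) ^ 2 := by ring
      have h8 : 4 * (-1) ^ n * (t * w) ^ n * (t * (w - 1) ^ 2) ^ n =
          4 * (t ^ n) ^ 2 * ((w * (w - 1)) ^ n * (1 - w) ^ n) := by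
        rw [show (1 - w) ^ n = (-1) ^ n * (w - 1) ^ n by rw [← mul_pow]; ring]
        simp only [mul_pow, ← pow_mul]
        ring
      rw [h7, h8, h5]
      ring
    have h9 : (rename Fin.castSucc α : MvPolynomial (Fin 3) Ω) = 0 :=
      (mul_eq_zero.1 hz).resolve_right (mul_ne_zero (mul_ne_zero (X_ne_zero _) (X_ne_zero _)) hD0)
    exact (rename_eq_zero_iff_of_injective _ (Fin.castSucc_injective 2)).1 h9
  have hβ : β = 0 := by
    have hz : β * X 1 = 0 := by
      refine MvPolynomial.funext fun p => ?_
      rw [map_mul, eval_X, map_zero]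
      by_contra hne
      obtain ⟨t, w, ht0, ht1, hw⟩ := hlift (p 0) (p 1) (by rintro h; simp [h] at hne)
      have k1 := key t w
      have hp : p = ![p 0, p 1] := by ext i; fin_cases i <;> rfl
      rw [ht0, ht1, hα, map_zero, zero_mul, zero_add, ← hp] at k1
      simp [k1] at hne
    exact (mul_eq_zero.1 hz).resolve_right (X_ne_zero _)
  rw [hα, hβ] at e
  simp only [map_zero, zero_mul, add_zero] at e
  have hX : Prime (X 1 : MvPolynomial (Fin 3) Ω) := X_prime
  have hnd : ¬ (X 1 : MvPolynomial (Fin 3) Ω) ∣ bicuspidalForm Ω n := by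
    rintro ⟨Q, hQ⟩
    have := congrArg (eval ![1, 0, 0]) hQ
    rw [eval_one_zero_zero_bicuspidalForm hn] at this
    simp [hn] at this
  obtain ⟨G', hG'⟩ := hX.pow_dvd_of_dvd_mul_left M hnd ⟨F, e.symm⟩
  refine ⟨G', mul_left_cancel₀ (pow_ne_zero M (X_ne_zero (R := Ω) (1 : Fin 3))) ?_⟩
  rw [e, hG']
  ring

end Kernel


/-! ### Forms meeting the bicuspidal curve in a single point -/

section OnePoint

/-- Modulo `D` the tuple `V` is `L` times a constant vector, so homogeneity evaluates `r`. At a cusp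
this applies with `D` the square of a local parameter, and it determines the logarithmic derivative
of the pullback. -/
lemma dvd_aeval_sub {A : Type*} [CommRing A] {k : ℕ} {r : MvPolynomial (Fin 3) A}
    (hr : r.IsHomogeneous k) (V : Fin 3 → Polynomial A) (v : Fin 3 → A) (L D : Polynomial A)
    (h : ∀ i, D ∣ V i - L * Polynomial.C (v i)) :
    D ∣ aeval V r - L ^ k * Polynomial.C (eval v r) := by
  have h1 : aeval (fun i => L * Polynomial.C (v i)) r = L ^ k * Polynomial.C (eval v r) := by
    rw [hr.aeval_mul]
    congr 1
    rw [aeval_def, eval, Polynomial.algebraMap_eq, coe_eval₂Hom, eval₂_comp_left]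
    rfl
  rw [← h1, ← Ideal.mem_span_singleton, ← Ideal.Quotient.eq]
  have h2 : ∀ V : Fin 3 → Polynomial A, Ideal.Quotient.mk (Ideal.span {D}) (aeval V r) =
      eval₂ ((Ideal.Quotient.mk (Ideal.span {D})).comp Polynomial.C)
        (fun i => Ideal.Quotient.mk (Ideal.span {D}) (V i)) r := by
    intro V
    rw [aeval_def, eval₂_comp_left]
    rfl
  rw [h2, h2]
  congr 1
  ext i
  rw [Ideal.Quotient.eq, Ideal.mem_span_singleton]
  exact h i

/-- The top coefficient of the pullback is the value of the form at the image of the parameter `∞`.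
-/
lemma coeff_aeval_of_natDegree_le {A : Type*} [CommRing A] {k d : ℕ} {r : MvPolynomial (Fin 3) A}
    (hr : r.IsHomogeneous k) {V : Fin 3 → Polynomial A} (hV : ∀ i, (V i).natDegree ≤ d) :
    (aeval V r).natDegree ≤ k * d ∧
      (aeval V r).coeff (k * d) = eval (fun i => (V i).coeff d) r := by
  have key : ∀ m ∈ r.support, (∏ i, V i ^ m i).natDegree ≤ k * d ∧
      (∏ i, V i ^ m i).coeff (k * d) = ∏ i, (V i).coeff d ^ m i := by
    intro m hm
    have hmk : m 0 + m 1 + m 2 = k := by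
      have := hr (mem_support_iff.1 hm)
      simpa [Finsupp.weight_apply, Finsupp.sum_fintype, Fin.sum_univ_three] using this
    have hp : ∀ i, (V i ^ m i).natDegree ≤ m i * d := fun i =>
      Polynomial.natDegree_pow_le_of_le _ (hV i)
    have h01 := Polynomial.natDegree_mul_le_of_le (hp 0) (hp 1)
    rw [Fin.prod_univ_three, Fin.prod_univ_three, ← hmk, add_mul, add_mul]
    refine ⟨Polynomial.natDegree_mul_le_of_le h01 (hp 2), ?_⟩
    rw [Polynomial.coeff_mul_add_eq_of_natDegree_le h01 (hp 2),
      Polynomial.coeff_mul_add_eq_of_natDegree_le (hp 0) (hp 1),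
      Polynomial.coeff_pow_of_natDegree_le (hV 0), Polynomial.coeff_pow_of_natDegree_le (hV 1),
      Polynomial.coeff_pow_of_natDegree_le (hV 2)]
  rw [aeval_def, eval₂_eq', eval_eq']
  constructor
  · refine Polynomial.natDegree_sum_le_of_forall_le _ _ fun m hm => ?_
    rw [Polynomial.algebraMap_eq]
    exact (Polynomial.natDegree_C_mul_le _ _).trans (key m hm).1
  · rw [Polynomial.finsetSum_coeff]
    refine Finset.sum_congr rfl fun m hm => ?_
    rw [Polynomial.algebraMap_eq, Polynomial.coeff_C_mul, (key m hm).2]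

lemma prod_map_of_forall_eq_or_eq {α M : Type*} [CommMonoid M] (f : α → M) (x y : α)
    (s : Multiset α) (h : ∀ a ∈ s, a = x ∨ a = y) :
    ∃ a b : ℕ, a + b = s.card ∧ (s.map f).prod = f x ^ a * f y ^ b := by
  induction s using Multiset.induction_on with
  | empty => exact ⟨0, 0, by simp, by simp⟩
  | cons c s ih =>
    obtain ⟨a, b, hab, he⟩ := ih fun e he => h e (by simp [he])
    rcases h c (by simp) with rfl | rfl
    · exact ⟨a + 1, b, by rw [Multiset.card_cons]; omega, by
        rw [Multiset.map_cons, Multiset.prod_cons, he, pow_succ']; simp only [mul_assoc]⟩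
    · exact ⟨a, b + 1, by rw [Multiset.card_cons]; omega, by
        rw [Multiset.map_cons, Multiset.prod_cons, he, pow_succ', mul_left_comm]⟩

lemma X_sub_C_mul_derivative_pow {A : Type*} [CommRing A] (x : A) (a : ℕ) :
    (Polynomial.X - Polynomial.C x) * Polynomial.derivative ((Polynomial.X - Polynomial.C x) ^ a) =
      (a : Polynomial A) * (Polynomial.X - Polynomial.C x) ^ a := by
  cases a with
  | zero => simp
  | succ a =>
    rw [Polynomial.derivative_X_sub_C_pow, Nat.add_sub_cancel, pow_succ]
    push_cast
    rw [map_add, map_natCast, map_one]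
    ring

lemma derivative_eval_of_sq_dvd {A : Type*} [CommRing A] {x : A} {P : Polynomial A}
    (h : (Polynomial.X - Polynomial.C x) ^ 2 ∣ P) : (Polynomial.derivative P).eval x = 0 := by
  obtain ⟨Q, rfl⟩ := h
  simp [Polynomial.derivative_mul, Polynomial.derivative_X_sub_C_pow]

lemma coeff_bicuspidalParam_two {Ω : Type*} [Field Ω] (n : ℕ) : (bicuspidalParam Ω n 2).coeff (n + 2) = 1 := by
  have h2 : ((Polynomial.X + Polynomial.C (1 : Ω)) ^ 2).Monic :=
    (Polynomial.monic_X_add_C 1).pow 2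
  have h3 : ((Polynomial.X - Polynomial.C (1 : Ω)) ^ n).Monic :=
    (Polynomial.monic_X_sub_C 1).pow n
  have h4 : ((Polynomial.X + Polynomial.C (1 : Ω)) ^ 2).natDegree = 2 := by
    rw [Polynomial.natDegree_pow, Polynomial.natDegree_X_add_C]
  have h5 : ((Polynomial.X - Polynomial.C (1 : Ω)) ^ n).natDegree = n := by
    rw [Polynomial.natDegree_pow, Polynomial.natDegree_X_sub_C, mul_one]
  have h6 := (h2.mul h3).coeff_natDegree
  rw [h2.natDegree_mul h3, h4, h5, add_comm 2 n, Polynomial.C_1] at h6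
  exact h6

lemma natDegree_bicuspidalParam_le {Ω : Type*} [Field Ω] (n : ℕ) (i : Fin 3) :
    (bicuspidalParam Ω n i).natDegree ≤ n + 2 := by
  have hX1 : ((Polynomial.X : Polynomial Ω) + 1).natDegree ≤ 1 := by compute_degree
  have hX2 : ((Polynomial.X : Polynomial Ω) - 1).natDegree ≤ 1 := by compute_degree
  have h2 := Polynomial.natDegree_pow_le_of_le 2 hX1
  have h3 := Polynomial.natDegree_pow_le_of_le n hX2
  fin_cases i
  · exact h2.trans (by omega)
  · exact Polynomial.natDegree_X_le.trans (by omega)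
  · exact (Polynomial.natDegree_mul_le_of_le h2 h3).trans (by omega)

lemma coeff_bicuspidalParam {Ω : Type*} [Field Ω] {n : ℕ} (hn : n ≠ 0) :
    (fun i => (bicuspidalParam Ω n i).coeff (n + 2)) = ![0, 0, 1] := by
  ext i
  fin_cases i
  · exact Polynomial.coeff_eq_zero_of_natDegree_lt (lt_of_le_of_lt
      (Polynomial.natDegree_pow_le_of_le 2 (by compute_degree :
        ((Polynomial.X : Polynomial Ω) + 1).natDegree ≤ 1)) (by omega))
  · exact Polynomial.coeff_eq_zero_of_natDegree_lt
      (Polynomial.natDegree_X_le.trans_lt (by omega))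
  · exact coeff_bicuspidalParam_two n

lemma map_bicuspidalParam {A B : Type*} [CommRing A] [CommRing B] (φ : A →+* B) (n : ℕ)
    (i : Fin 3) : (bicuspidalParam A n i).map φ = bicuspidalParam B n i := by
  fin_cases i <;> simp [bicuspidalParam]

variable {Ω : Type*} [Field Ω] [IsAlgClosed Ω] [CharZero Ω]

set_option maxHeartbeats 400000 in
/-- A curve that does not pass through all of the bicuspidal curve meets it in at least two
points. -/
theorem not_onePoint_bicuspidal {n : ℕ} (hn : 2 ≤ n) {k : ℕ} (hk : 0 < k)
    {r : MvPolynomial (Fin 3) Ω} (hr : r.IsHomogeneous k)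
    (hr0 : aeval (bicuspidalParam Ω n) r ≠ 0) {p : Fin 3 → Ω} (hp : p ≠ 0)
    (hroot : ∀ q, eval q (bicuspidalForm Ω n) = 0 → eval q r = 0 →
      ∀ i j, p j * q i = p i * q j) : False := by
  set V := bicuspidalParam Ω n with hV
  set ρ := aeval V r with hρ
  have hV0 : V 0 = (Polynomial.X + 1) ^ 2 := rfl
  have hV1 : V 1 = Polynomial.X := rfl
  have hV2 : V 2 = (Polynomial.X + 1) ^ 2 * (Polynomial.X - 1) ^ n := rfl
  -- the logarithmic derivatives at the cusps
  have hd1 : (Polynomial.derivative ρ).eval 1 = k * ρ.eval 1 := by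
    have h1 := derivative_eval_of_sq_dvd (dvd_aeval_sub hr V (fun i => (V i).eval 1) Polynomial.X
      ((Polynomial.X - Polynomial.C 1) ^ 2) (by
        intro i
        fin_cases i
        · refine ⟨1, ?_⟩
          simp [hV0]
          ring_nf
        · simp [hV1]
        · simp only [Fin.reduceFinMk, hV2]
          -- With `2 ≤ n` the third coordinate vanishes to second order at `1`, which makes `w = 1`
          -- a cusp.
          obtain ⟨m, rfl⟩ := Nat.exists_eq_add_of_le hn
          refine ⟨(Polynomial.X + 1) ^ 2 * (Polynomial.X - 1) ^ m, ?_⟩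
          simp [pow_add]
          ring))
    rw [← aeval_polynomial_eval, ← hρ] at h1
    simp [Polynomial.derivative_mul, Polynomial.derivative_X_pow] at h1
    linear_combination h1
  have hd2 : (Polynomial.derivative ρ).eval (-1) = - k * ρ.eval (-1) := by
    have h1 := derivative_eval_of_sq_dvd (dvd_aeval_sub hr V (fun i => (V i).eval (-1))
      (-Polynomial.X) ((Polynomial.X - Polynomial.C (-1)) ^ 2) (by
        intro i
        fin_cases i
        · simp [hV0]
        · simp [hV1]
        · simp [hV2]))
    rw [← aeval_polynomial_eval, ← hρ] at h1
    rw [Polynomial.derivative_sub, Polynomial.eval_sub, Polynomial.derivative_mul,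
      Polynomial.derivative_pow] at h1
    simp at h1
    linear_combination h1
  have hVdeg : ∀ i, (V i).natDegree ≤ n + 2 := natDegree_bicuspidalParam_le n
  obtain ⟨hρdeg, hρcoeff⟩ := coeff_aeval_of_natDegree_le hr hVdeg
  have hρroot : ∀ τ, ρ.eval τ = 0 → ∀ i j, p j * (V i).eval τ = p i * (V j).eval τ := by
    intro τ hτ
    refine hroot _ ?_ ?_
    · rw [← aeval_polynomial_eval, aeval_bicuspidalParam, Polynomial.eval_zero]
    · rw [← aeval_polynomial_eval, ← hρ, hτ]
  have hp' : ∃ l, p l ≠ 0 := by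
    by_contra! h
    exact hp (funext h)
  obtain ⟨l, hl⟩ := hp'
  -- All roots map to the point `p`. Comparing the first two coordinates, `(w + 1)² : w` separates
  -- parameters up to inversion.
  have hroots : ∀ τ τ', ρ.eval τ = 0 → ρ.eval τ' = 0 → τ' = τ ∨ τ * τ' = 1 := by
    intro τ τ' h h'
    have e1 := hρroot τ h
    have e2 := hρroot τ' h'
    have e3 : (V 0).eval τ * (V 1).eval τ' = (V 1).eval τ * (V 0).eval τ' := by
      refine mul_left_cancel₀ (mul_ne_zero hl hl) ?_
      linear_combination (p l * (V 1).eval τ') * e1 0 l - (p l * (V 0).eval τ') * e1 1 l +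
        (p 0 * (V l).eval τ) * e2 1 l - (p 1 * (V l).eval τ) * e2 0 l
    simp [hV0, hV1] at e3
    have e4 : (τ' - τ) * (τ * τ' - 1) = 0 := by linear_combination -e3
    rcases mul_eq_zero.1 e4 with h | h
    · exact Or.inl (sub_eq_zero.1 h)
    · exact Or.inr (sub_eq_zero.1 h)
  have hsplit := (IsAlgClosed.splits ρ).eq_prod_roots
  have hcard : ρ.roots.card = ρ.natDegree := (IsAlgClosed.splits ρ).natDegree_eq_card_roots.symm
  have hk0 : (k : Ω) ≠ 0 := by exact_mod_cast hk.ne'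
  have hlead : ρ.leadingCoeff ≠ 0 := by simpa using hr0
  -- the form does not vanish at the point at infinity
  have hnat : ρ.natDegree = k * (n + 2) := by
    refine le_antisymm hρdeg (not_lt.1 fun hlt => ?_)
    have hinf := Polynomial.coeff_eq_zero_of_natDegree_lt hlt
    rw [hρcoeff] at hinf
    have hcoord : (fun i => (V i).coeff (n + 2)) = ![0, 0, 1] :=
      coeff_bicuspidalParam (by omega)
    rw [hcoord] at hinf
    -- Then `p` is `(0 : 0 : 1)`, which no finite parameter reaches. So `ρ` is a nonzero constant,
    -- contradicting the logarithmic derivative `k` at `1`.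
    have e1 := hroot ![0, 0, 1] (by simp [bicuspidalForm]; omega) hinf
    have hno : ∀ τ, ρ.eval τ ≠ 0 := by
      intro τ hτ
      have e2 := hρroot τ hτ
      have p0 : p 0 = 0 := by simpa using (e1 0 2).symm
      have p1 : p 1 = 0 := by simpa using (e1 1 2).symm
      have p2 : p 2 ≠ 0 := by
        intro p2
        apply hp; ext i; fin_cases i <;> assumption
      have e3 := e2 0 2
      have e4 := e2 1 2
      rw [p0, zero_mul] at e3
      rw [p1, zero_mul] at e4
      have e5 := (mul_eq_zero.1 e3).resolve_left p2
      have e6 := (mul_eq_zero.1 e4).resolve_left p2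
      simp [hV0] at e5
      simp [hV1] at e6
      simp [e6] at e5
    have hdeg0 : ρ.degree = 0 := by
      by_contra h
      obtain ⟨τ, hτ⟩ := IsAlgClosed.exists_root ρ h
      exact hno τ hτ
    rw [Polynomial.eq_C_of_degree_eq_zero hdeg0] at hd1
    simp [hk0] at hd1
    rw [Polynomial.eq_C_of_degree_eq_zero hdeg0, hd1] at hr0
    simp at hr0
  -- Every root is `τ` or `τ⁻¹` for one fixed root `τ`; with the convention `0⁻¹ = 0` this covers `τ
  -- = 0`, where both coincide.
  obtain ⟨x, y, hxy, a, b, hab, hprod⟩ : ∃ x y : Ω, (x * y = 1 ∨ x = 0 ∧ y = 0) ∧ ∃ a b : ℕ,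
      a + b = k * (n + 2) ∧ ρ = Polynomial.C ρ.leadingCoeff *
        ((Polynomial.X - Polynomial.C x) ^ a * (Polynomial.X - Polynomial.C y) ^ b) := by
    have hpos : 0 < ρ.roots.card := by rw [hcard, hnat]; positivity
    obtain ⟨τ, hτ⟩ := Multiset.card_pos_iff_exists_mem.1 hpos
    have hτ0 : ρ.eval τ = 0 := (Polynomial.mem_roots'.1 hτ).2
    obtain ⟨a, b, hab, he⟩ := prod_map_of_forall_eq_or_eq
      (fun x => Polynomial.X - Polynomial.C x) τ τ⁻¹ ρ.roots (by
        intro τ' hτ'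
        refine (hroots τ τ' hτ0 (Polynomial.mem_roots'.1 hτ').2).imp_right fun h => ?_
        exact eq_inv_of_mul_eq_one_right h)
    refine ⟨τ, τ⁻¹, ?_, a, b, by rw [hab, hcard, hnat], by rw [← he]; exact hsplit⟩
    by_cases h0 : τ = 0
    · exact Or.inr ⟨h0, by simp [h0]⟩
    · exact Or.inl (mul_inv_cancel₀ h0)
  have hder : (Polynomial.X - Polynomial.C x) * (Polynomial.X - Polynomial.C y) *
      Polynomial.derivative ρ = ρ * ((a : Polynomial Ω) * (Polynomial.X - Polynomial.C y) +
        (b : Polynomial Ω) * (Polynomial.X - Polynomial.C x)) := by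
    rw [hprod, Polynomial.derivative_C_mul, Polynomial.derivative_mul]
    linear_combination (Polynomial.C ρ.leadingCoeff * (Polynomial.X - Polynomial.C y) *
      (Polynomial.X - Polynomial.C y) ^ b) * X_sub_C_mul_derivative_pow x a +
      (Polynomial.C ρ.leadingCoeff * (Polynomial.X - Polynomial.C x) *
      (Polynomial.X - Polynomial.C x) ^ a) * X_sub_C_mul_derivative_pow y b
  have hev : ∀ t, (t - x) * (t - y) * (Polynomial.derivative ρ).eval t =
      ρ.eval t * (a * (t - y) + b * (t - x)) := by
    intro t
    have := congrArg (Polynomial.eval t) hder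
    simpa using this
  have hzero : ∀ t, ρ.eval t = 0 → t = x ∨ t = y := by
    intro t ht
    rw [hprod] at ht
    simp only [Polynomial.eval_mul, Polynomial.eval_C, Polynomial.eval_pow, Polynomial.eval_sub,
      Polynomial.eval_X, mul_eq_zero, hlead, false_or] at ht
    rcases ht with h | h
    · exact Or.inl (sub_eq_zero.1 (eq_zero_of_pow_eq_zero h))
    · exact Or.inr (sub_eq_zero.1 (eq_zero_of_pow_eq_zero h))
  have habΩ : (a : Ω) + b = k * (n + 2) := by exact_mod_cast hab
  have hn0 : (n : Ω) ≠ 0 := by exact_mod_cast (by omega : n ≠ 0)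
  have hn1 : (n : Ω) + 1 ≠ 0 := by exact_mod_cast (by omega : n + 1 ≠ 0)
  rcases hxy with hxy | ⟨rfl, rfl⟩
  · have e1 : x ≠ 1 → k * (2 - x - y) = a * (1 - y) + b * (1 - x) := by
      intro hx
      have hρ1 : ρ.eval 1 ≠ 0 := by
        intro h
        rcases hzero 1 h with h | h
        · exact hx h.symm
        · exact hx (by simpa [← h] using hxy)
      refine mul_left_cancel₀ hρ1 ?_
      have := hev 1
      rw [hd1] at this
      linear_combination this - k * ρ.eval 1 * hxy
    have e2 : x ≠ -1 → k * (2 + x + y) = a * (1 + y) + b * (1 + x) := by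
      intro hx
      have hρ1 : ρ.eval (-1) ≠ 0 := by
        intro h
        rcases hzero _ h with h | h
        · exact hx h.symm
        · exact hx (by rw [← h] at hxy; linear_combination -hxy)
      refine mul_left_cancel₀ hρ1 ?_
      have := hev (-1)
      rw [hd2] at this
      linear_combination - this - k * ρ.eval (-1) * hxy
    -- The two cusp conditions add up to this identity. If `x` is `1` or `-1`, the condition there
    -- is lost, but the other one alone suffices.
    have hfin : (4 : Ω) * k = 2 * (a + b) := by
      by_cases hx1 : x = 1
      · have hy1 : y = 1 := by rw [hx1, one_mul] at hxy; exact hxy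
        have := e2 (by rw [hx1]; norm_num)
        rw [hx1, hy1] at this
        linear_combination this
      · by_cases hx2 : x = -1
        · have hy1 : y = -1 := by rw [hx2] at hxy; linear_combination -hxy
          have := e1 hx1
          rw [hx2, hy1] at this
          linear_combination this
        · linear_combination e1 hx1 + e2 hx2
    rw [habΩ] at hfin
    have : (2 : Ω) * k * n = 0 := by linear_combination -hfin
    simp [hk0, hn0] at this
  · have hρ1 : ρ.eval 1 ≠ 0 := by
      intro h
      rcases hzero 1 h with h | h <;> exact one_ne_zero h
    have := hev 1
    rw [hd1] at this
    -- With `0` as the only root, `ρ` has logarithmic derivative `k (n + 2)` at `1`, while the cusp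
    -- prescribes `k`.
    have h2 : (k : Ω) * (n + 1) = 0 := by
      refine mul_left_cancel₀ hρ1 ?_
      linear_combination -this - ρ.eval 1 * habΩ
    exact (mul_ne_zero hk0 hn1) h2

end OnePoint


/-! ### Specialization along the Zariski closure -/

section Specialization

/-- Since `ε` kills the kernel of `η`, its kernel generates a proper ideal in the image of `η`, and
a valuation ring of `𝓕` dominates that ideal. -/
lemma exists_valuationSubring_dominating {S 𝓕 K : Type*} [CommRing S] [Field 𝓕] [Field K]
    (η : S →+* 𝓕) (ε : S →+* K) (h : ∀ Q, η Q = 0 → ε Q = 0) :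
    ∃ O : ValuationSubring 𝓕, ∀ Q, η Q ∈ O ∧ (ε Q = 0 → η Q ∈ O.nonunits) := by
  have hη : Function.Surjective η.rangeRestrict := RingHom.rangeRestrict_surjective _
  obtain ⟨O, hAO, hnon⟩ := Ideal.image_subset_nonunits_valuationSubring
    ((RingHom.ker ε).map η.rangeRestrict) (by
      rw [Ideal.ne_top_iff_one, ← map_one η.rangeRestrict]
      intro h1
      obtain ⟨Q, hQ, h2⟩ := (Ideal.mem_map_iff_of_surjective _ hη).1 h1
      have h3 : ε (Q - 1) = 0 := h _ (by
        have := congrArg Subtype.val h2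
        rw [map_sub, sub_eq_zero]
        exact this)
      rw [map_sub, (show ε Q = 0 from hQ), map_one, zero_sub, neg_eq_zero] at h3
      exact one_ne_zero h3)
  exact ⟨O, fun Q => ⟨hAO ⟨Q, rfl⟩, fun hQ => hnon ⟨η.rangeRestrict Q,
    Ideal.mem_map_of_mem _ hQ, rfl⟩⟩⟩

lemma exists_residue_algClosed.{u} (O : Type u) [CommRing O] [IsLocalRing O] :
    ∃ (Ω : Type u) (_ : Field Ω) (_ : IsAlgClosed Ω) (res : O →+* Ω), IsLocalHom res ∧
      ∀ x, ¬ IsUnit x → res x = 0 := by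
  refine ⟨AlgebraicClosure (IsLocalRing.ResidueField O), inferInstance, inferInstance,
    (algebraMap (IsLocalRing.ResidueField O) _).comp (IsLocalRing.residue O), inferInstance,
    fun x hx => ?_⟩
  rw [RingHom.comp_apply, (IsLocalRing.residue_eq_zero_iff x).2 hx, map_zero]

/-- Each `Q - C (eval c₀ Q)` vanishes at `c₀`, hence lands in the maximal ideal: reduction is
evaluation at `c₀`. -/
lemma exists_residue_extending.{u} {K ι : Type*} {𝓕 : Type u} [Field K] [Field 𝓕]
    (η : MvPolynomial ι K →+* 𝓕) (c₀ : ι → K) (h : ∀ Q, η Q = 0 → eval c₀ Q = 0) :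
    ∃ (O : ValuationSubring 𝓕) (Ω : Type u) (_ : Field Ω) (_ : IsAlgClosed Ω)
      (σ : K →+* Ω) (res : O →+* Ω), IsLocalHom res ∧
      ∀ Q, ∃ h : η Q ∈ O, res ⟨_, h⟩ = σ (eval c₀ Q) := by
  obtain ⟨O, hO⟩ := exists_valuationSubring_dominating η (eval c₀) h
  obtain ⟨Ω, _, _, res, hloc, hres⟩ := exists_residue_algClosed O
  let ρ : MvPolynomial ι K →+* O :=
    { toFun := fun Q => ⟨η Q, (hO Q).1⟩
      map_one' := Subtype.ext (by simp)
      map_mul' := fun a b => Subtype.ext (by simp)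
      map_zero' := Subtype.ext (by simp)
      map_add' := fun a b => Subtype.ext (by simp) }
  refine ⟨O, Ω, inferInstance, inferInstance, (res.comp ρ).comp C, res,
    hloc, fun Q => ⟨(hO Q).1, ?_⟩⟩
  have h1 : res (ρ (Q - C (eval c₀ Q))) = 0 := by
    obtain ⟨ha, h3⟩ := ValuationSubring.mem_nonunits_iff_exists_mem_maximalIdeal.1
      ((hO (Q - C (eval c₀ Q))).2 (by simp))
    exact hres _ h3
  rw [map_sub, map_sub, sub_eq_zero] at h1
  exact h1

/-- A point `c₀` in the Zariski closure of a family `c` is a specialization of a point of the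
family over some field. -/
theorem exists_specialization.{u, v} {K : Type u} {B : Type v} {ι : Type*} [Field K] (c : B → ι → K) (c₀ : ι → K)
    (hc : ∀ Q : MvPolynomial ι K, (∀ b, eval (c b) Q = 0) → eval c₀ Q = 0) :
    ∃ (𝓕 : Type (max u v)) (_ : Field 𝓕) (π : (B → K) →+* 𝓕) (O : ValuationSubring 𝓕)
      (Ω : Type (max u v))
      (_ : Field Ω) (_ : IsAlgClosed Ω) (σ : K →+* Ω) (res : O →+* Ω), IsLocalHom res ∧
      ∀ Q, ∃ h : π (fun b => eval (c b) Q) ∈ O, res ⟨_, h⟩ = σ (eval c₀ Q) := by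
  let θ : MvPolynomial ι K →+* (B → K) := RingHom.pi fun b => eval (c b)
  have hP := RingHom.ker_isPrime (eval c₀)
  let S : Submonoid (B → K) := (RingHom.ker (eval c₀)).primeCompl.map θ
  -- Polynomials not vanishing at `c₀` give nonzero functions on `B`, by `hc`, so some prime of `B →
  -- K` avoids all of them. Identities valid at every member of the family pass to the quotient,
  -- hence to `𝓕`.
  obtain ⟨q, hq, -, hqS⟩ := Ideal.exists_le_prime_disjoint (⊥ : Ideal (B → K)) S (by
    rw [Set.disjoint_left]
    rintro x hx ⟨Q, hQ, rfl⟩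
    refine hQ (hc Q fun b => ?_)
    exact congrFun (show θ Q = 0 from hx) b)
  let π : (B → K) →+* FractionRing ((B → K) ⧸ q) :=
    (algebraMap ((B → K) ⧸ q) (FractionRing ((B → K) ⧸ q))).comp (Ideal.Quotient.mk q)
  have hker : ∀ Q, π (θ Q) = 0 → eval c₀ Q = 0 := by
    intro Q hQ
    by_contra h
    refine Set.disjoint_left.1 hqS ?_ ⟨Q, h, rfl⟩
    exact Ideal.Quotient.eq_zero_iff_mem.1 ((IsFractionRing.injective _
      (FractionRing ((B → K) ⧸ q))) (by rw [map_zero]; exact hQ))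
  exact ⟨FractionRing ((B → K) ⧸ q), inferInstance, π,
    exists_residue_extending (π.comp θ) c₀ hker⟩

/-- Choosing a nonvanishing index at each `b` shows that the `x i` generate the unit ideal of `B →
K`. Pointwise non-vanishing therefore survives in `𝓕`. -/
lemma exists_map_ne_zero {K B I 𝓕 : Type*} [Field K] [Field 𝓕] [Fintype I] (π : (B → K) →+* 𝓕)
    (x : I → B → K) (hx : ∀ b, ∃ i, x i b ≠ 0) : ∃ i, π (x i) ≠ 0 := by
  classical
  by_contra! h
  choose i hi using hx
  have h1 : ∑ j, (fun b => if i b = j then (x j b)⁻¹ else 0) * x j = 1 := by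
    ext b
    rw [Finset.sum_apply, Finset.sum_eq_single (i b)]
    · simp [hi b]
    · intro j _ hj
      simp [hj.symm]
    · simp
  have h2 := congrArg π h1
  rw [map_sum, map_one, Finset.sum_eq_zero] at h2
  · exact zero_ne_one h2
  · intro j _
    rw [map_mul, h j, mul_zero]

/-- A uniform degree bound lets polynomials over the members of the family be assembled into one
over `B → K`; for this the degrees `k` and `M` of the certificates are fixed. -/
lemma exists_mvPolynomial_pi {σ K B : Type*} [Finite σ] [CommSemiring K] {N : ℕ}
    (P : B → MvPolynomial σ K) (hP : ∀ b, (P b).totalDegree ≤ N) :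
    ∃ P' : MvPolynomial σ (B → K), ∀ m b, coeff m P' b = coeff m (P b) := by
  classical
  have hfin := Finsupp.finite_of_degree_le (σ := σ) N
  refine ⟨∑ m ∈ hfin.toFinset, monomial m fun b => coeff m (P b), fun m b => ?_⟩
  rw [coeff_sum]
  simp only [coeff_monomial, Finset.sum_ite_eq', Set.Finite.mem_toFinset]
  split_ifs with h
  · rfl
  · by_contra h2
    refine h ?_
    have h3 : m ∈ (P b).support := mem_support_iff.2 (Ne.symm h2)
    have := (le_totalDegree h3).trans (hP b)
    exact this

lemma map_evalRingHom_eq {σ K B : Type*} [CommSemiring K] {P' : MvPolynomial σ (B → K)}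
    {P : B → MvPolynomial σ K} (h : ∀ m b, coeff m P' b = coeff m (P b)) (b : B) :
    map (Pi.evalRingHom (fun _ : B => K) b) P' = P b := by
  ext m
  rw [coeff_map]
  exact h m b

lemma isHomogeneous_of_coeff {σ K B : Type*} [CommSemiring K] {P' : MvPolynomial σ (B → K)}
    {P : B → MvPolynomial σ K} (h : ∀ m b, coeff m P' b = coeff m (P b)) {k : ℕ}
    (hP : ∀ b, (P b).IsHomogeneous k) : P'.IsHomogeneous k := by
  intro m hm
  obtain ⟨b, hb⟩ := Function.ne_iff.1 hm
  rw [h] at hb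
  exact hP b hb

lemma mvPolynomial_pi_ext {σ K B : Type*} [CommSemiring K] {P Q : MvPolynomial σ (B → K)}
    (h : ∀ b, map (Pi.evalRingHom (fun _ : B => K) b) P =
      map (Pi.evalRingHom (fun _ : B => K) b) Q) : P = Q := by
  ext m b
  have := congrArg (coeff m) (h b)
  simpa [coeff_map] using this

lemma exists_polynomial_pi {K B : Type*} [CommSemiring K] {N : ℕ} (P : B → Polynomial K)
    (hP : ∀ b, (P b).natDegree ≤ N) :
    ∃ P' : Polynomial (B → K), P'.natDegree ≤ N ∧ ∀ m b, P'.coeff m b = (P b).coeff m := by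
  refine ⟨∑ m ∈ Finset.range (N + 1), Polynomial.monomial m fun b => (P b).coeff m,
    Polynomial.natDegree_sum_le_of_forall_le _ _ fun m hm => ?_, fun m b => ?_⟩
  · exact (Polynomial.natDegree_monomial_le _).trans (by simpa [Nat.lt_succ_iff] using hm)
  · rw [Polynomial.finsetSum_coeff]
    simp only [Polynomial.coeff_monomial, Finset.sum_ite_eq', Finset.mem_range]
    split_ifs with h
    · rfl
    · exact (Polynomial.coeff_eq_zero_of_natDegree_lt ((hP b).trans_lt (by omega))).symm

lemma polynomial_pi_ext {K B : Type*} [CommSemiring K] {P Q : Polynomial (B → K)}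
    (h : ∀ b, P.map (Pi.evalRingHom (fun _ : B => K) b) =
      Q.map (Pi.evalRingHom (fun _ : B => K) b)) : P = Q := by
  ext m b
  have := congrArg (fun R => Polynomial.coeff R m) (h b)
  simpa [Polynomial.coeff_map] using this

end Specialization

/-! ### Primitive integral models over a valuation ring -/

section Primitive

variable {O 𝓕 Ω : Type*} [CommRing O] [IsDomain O] [ValuationRing O] [Field 𝓕] [Algebra O 𝓕]
  [IsFractionRing O 𝓕] [Field Ω]

lemma exists_mul_inv_mem_of_finite (s : Set 𝓕) (hs : s.Finite) (h0 : ∃ x ∈ s, x ≠ 0) :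
    ∃ x ∈ s, x ≠ 0 ∧ ∀ y ∈ s, ∃ a : O, algebraMap O 𝓕 a = x⁻¹ * y := by
  obtain ⟨x₀, hx₀, hne⟩ := h0
  obtain ⟨x, hx, hmax⟩ := Set.exists_max_image s (ValuationRing.valuation O 𝓕) hs ⟨x₀, hx₀⟩
  have hx0 : x ≠ 0 := by
    rintro rfl
    have := hmax x₀ hx₀
    rw [map_zero, le_zero_iff, map_eq_zero] at this
    exact hne this
  refine ⟨x, hx, hx0, fun y hy => ?_⟩
  rw [← ValuationRing.mem_integer_iff, Valuation.mem_integer_iff, map_mul, map_inv₀]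
  have hv : ValuationRing.valuation O 𝓕 x ≠ 0 := by rwa [Ne, map_eq_zero]
  calc _ ≤ (ValuationRing.valuation O 𝓕 x)⁻¹ * ValuationRing.valuation O 𝓕 x :=
        mul_le_mul_right (hmax y hy) _
    _ = 1 := inv_mul_cancel₀ hv

lemma isHomogeneous_of_map {σ A B : Type*} [CommSemiring A] [CommSemiring B] (φ : A →+* B)
    (hφ : Function.Injective φ) {P : MvPolynomial σ A} {k : ℕ} (h : (map φ P).IsHomogeneous k) :
    P.IsHomogeneous k := by
  intro m hm
  refine h ?_
  rw [coeff_map]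
  exact fun h0 => hm (hφ (by rw [h0, map_zero]))

/-- A finite family of polynomials over the fraction field of a valuation ring, not all zero, can
be scaled so as to be integral with nonzero reduction. -/
lemma exists_primitive {σ I : Type*} [Finite I] (res : O →+* Ω) (P : I → MvPolynomial σ 𝓕)
    (hP : ∃ i, P i ≠ 0) :
    ∃ c : 𝓕, c ≠ 0 ∧ ∃ P' : I → MvPolynomial σ O,
      (∀ i, map (algebraMap O 𝓕) (P' i) = C c * P i) ∧ (∃ i, map res (P' i) ≠ 0) ∧
      ((∀ i, ∃ Q, map (algebraMap O 𝓕) Q = P i) ∨ ∃ a : O, algebraMap O 𝓕 a = c ∧ ¬ IsUnit a) := by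
  classical
  have hinj := IsFractionRing.injective O 𝓕
  obtain ⟨x, hx, hx0, hs⟩ := exists_mul_inv_mem_of_finite (O := O)
    (⋃ i, (fun m => coeff m (P i)) '' ((P i).support : Set (σ →₀ ℕ)))
    (Set.finite_iUnion fun i => (P i).support.finite_toSet.image _) (by
      obtain ⟨i, hi⟩ := hP
      obtain ⟨m, hm⟩ := MvPolynomial.support_nonempty.2 hi
      exact ⟨_, Set.mem_iUnion.2 ⟨i, m, hm, rfl⟩, mem_support_iff.1 hm⟩)
  obtain ⟨i₀, m₀, -, hx⟩ := Set.mem_iUnion.1 hx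
  have hs' : ∀ i m, ∃ a : O, algebraMap O 𝓕 a = x⁻¹ * coeff m (P i) := by
    intro i m
    by_cases hm : coeff m (P i) = 0
    · exact ⟨0, by rw [hm, map_zero, mul_zero]⟩
    · exact hs _ (Set.mem_iUnion.2 ⟨i, m, mem_support_iff.2 hm, rfl⟩)
  have hlift : ∀ i, ∃ Q, map (algebraMap O 𝓕) Q = C x⁻¹ * P i := by
    intro i
    change C x⁻¹ * P i ∈ Set.range (map (algebraMap O 𝓕))
    rw [mem_range_map_iff_coeffs_subset]
    rintro _ hc
    obtain ⟨m, -, rfl⟩ := mem_coeffs_iff.1 hc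
    obtain ⟨a, ha⟩ := hs' i m
    exact ⟨a, by rw [ha, coeff_C_mul]⟩
  choose P' hP' using hlift
  refine ⟨x⁻¹, inv_ne_zero hx0, P', hP', ⟨i₀, fun h => ?_⟩, ?_⟩
  · have h1 : coeff m₀ (P' i₀) = 1 := by
      apply hinj
      have := congrArg (coeff m₀) (hP' i₀)
      rw [coeff_map, coeff_C_mul] at this
      rw [this, map_one, ← hx]
      exact inv_mul_cancel₀ (by rwa [← hx] at hx0)
    have h2 := congrArg (coeff m₀) h
    rw [coeff_map, h1, map_one, coeff_zero] at h2
    exact one_ne_zero h2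
  -- The scaling factor is `x⁻¹`. If `x` is integral, the original family was integral already;
  -- otherwise `x⁻¹` is integral, and it is a unit only if `x` is integral after all.
  · rcases ValuationRing.isInteger_or_isInteger O x with ⟨a, ha⟩ | ⟨a, ha⟩
    · refine Or.inl fun i => ⟨C a * P' i, ?_⟩
      rw [map_mul, hP', map_C, ha, ← mul_assoc, ← C_mul, mul_inv_cancel₀ hx0, C_1, one_mul]
    · by_cases hu : IsUnit a
      · refine Or.inl fun i => ⟨C (↑hu.unit⁻¹ : O) * P' i, ?_⟩
        have h1 : algebraMap O 𝓕 (↑hu.unit⁻¹ : O) = x := by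
          have : algebraMap O 𝓕 (↑hu.unit⁻¹ : O) * algebraMap O 𝓕 a = 1 := by
            rw [← map_mul, IsUnit.val_inv_mul, map_one]
          rw [ha] at this
          rwa [mul_inv_eq_one₀ hx0] at this
        rw [map_mul, hP', map_C, h1, ← mul_assoc, ← C_mul, mul_inv_cancel₀ hx0, C_1, one_mul]
      · exact Or.inr ⟨a, ha, hu⟩

end Primitive


/-! ### Division by a form that is monic in the first variable -/

section Division

variable {A : Type*} [CommRing A]

lemma monic_finSuccEquiv [Nontrivial A] {m d : ℕ} {f : MvPolynomial (Fin (m + 1)) A}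
    (hf : f.IsHomogeneous d) (h1 : coeff (Finsupp.single 0 d) f = 1) :
    (finSuccEquiv A m f).Monic ∧ (finSuccEquiv A m f).natDegree = d := by
  have hdeg : (finSuccEquiv A m f).natDegree ≤ d := by
    rw [natDegree_finSuccEquiv]
    exact (degreeOf_le_totalDegree _ _).trans hf.totalDegree_le
  have hcoeff : (finSuccEquiv A m f).coeff d = 1 := by
    have h2 : ((finSuccEquiv A m f).coeff d).IsHomogeneous 0 :=
      hf.finSuccEquiv_coeff_isHomogeneous _ _ (by omega)
    rw [← totalDegree_zero_iff_isHomogeneous, totalDegree_eq_zero_iff_eq_C] at h2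
    rw [h2, finSuccEquiv_coeff_coeff]
    have h3 : Finsupp.cons d (0 : Fin m →₀ ℕ) = Finsupp.single 0 d := by
      ext i
      refine Fin.cases ?_ (fun j => ?_) i
      · simp
      · simp
    rw [h3, h1, C_1]
  have hm := Polynomial.monic_of_natDegree_le_of_coeff_eq_one d hdeg hcoeff
  exact ⟨hm, le_antisymm hdeg (Polynomial.le_natDegree_of_ne_zero (by rw [hcoeff]; exact one_ne_zero))⟩

lemma eq_zero_of_dvd_of_degreeOf_lt [Nontrivial A] {m d : ℕ} {f r : MvPolynomial (Fin (m + 1)) A}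
    (hf : f.IsHomogeneous d) (h1 : coeff (Finsupp.single 0 d) f = 1) (hfr : f ∣ r)
    (hr : ∀ e, coeff e r ≠ 0 → e 0 < d) : r = 0 := by
  obtain ⟨hm, hd⟩ := monic_finSuccEquiv hf h1
  by_contra h0
  have h2 : finSuccEquiv A m r ≠ 0 := by simpa using h0
  refine hm.not_dvd_of_natDegree_lt h2 ?_ (map_dvd (finSuccEquiv A m) hfr)
  have hpos : 0 < d := by
    obtain ⟨e, he⟩ := MvPolynomial.support_nonempty.2 h0
    exact (Nat.zero_le _).trans_lt (hr e (mem_support_iff.1 he))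
  rw [hd, natDegree_finSuccEquiv, degreeOf_lt_iff hpos]
  exact fun e he => hr e (mem_support_iff.1 he)

lemma dvd_homogeneousComponent_mul {σ : Type*} {d : ℕ} {f : MvPolynomial σ A}
    (hf : f.IsHomogeneous d) (q : MvPolynomial σ A) (k : ℕ) :
    f ∣ homogeneousComponent k (f * q) := by
  rw [← sum_homogeneousComponent q, Finset.mul_sum, map_sum]
  refine Finset.dvd_sum fun i _ => ?_
  have h1 := hf.mul (homogeneousComponent_isHomogeneous i q)
  rw [homogeneousComponent_of_mem h1]
  split_ifs
  · exact dvd_mul_right _ _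
  · exact dvd_zero _

/-- Divide by `f`, monic in `X 0`, and keep the components of degree `k`: this does not raise the `X
0`-degree of the remainder, and multiples of the form `f` stay multiples. -/
lemma exists_eq_mul_add_of_isHomogeneous [Nontrivial A] {m d k : ℕ}
    {f h : MvPolynomial (Fin (m + 1)) A} (hf : f.IsHomogeneous d)
    (h1 : coeff (Finsupp.single 0 d) f = 1) (hd : 0 < d) (hh : h.IsHomogeneous k) :
    ∃ q r, r.IsHomogeneous k ∧ (∀ e, coeff e r ≠ 0 → e 0 < d) ∧ h = f * q + r := by
  obtain ⟨hm, hdeg⟩ := monic_finSuccEquiv hf h1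
  set F := finSuccEquiv A m f with hF
  set q₀ := (finSuccEquiv A m).symm (finSuccEquiv A m h /ₘ F) with hq₀
  set r₀ := (finSuccEquiv A m).symm (finSuccEquiv A m h %ₘ F) with hr₀
  have hsum : h = f * q₀ + r₀ := by
    apply (finSuccEquiv A m).injective
    rw [map_add, map_mul, hq₀, hr₀, AlgEquiv.apply_symm_apply, AlgEquiv.apply_symm_apply, ← hF]
    exact ((add_comm _ _).trans (Polynomial.modByMonic_add_div _ F)).symm
  have hr : ∀ e, coeff e r₀ ≠ 0 → e 0 < d := by
    have h2 : degreeOf 0 r₀ < d := by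
      rw [← natDegree_finSuccEquiv, hr₀, AlgEquiv.apply_symm_apply, ← hdeg]
      exact Polynomial.natDegree_modByMonic_lt _ hm (by
        intro h
        rw [h, Polynomial.natDegree_one] at hdeg
        omega)
    exact fun e he => (degreeOf_lt_iff hd).1 h2 e (mem_support_iff.2 he)
  obtain ⟨q, hq⟩ := dvd_homogeneousComponent_mul hf q₀ k
  refine ⟨q, homogeneousComponent k r₀, homogeneousComponent_isHomogeneous _ _, fun e he => ?_, ?_⟩
  · rw [coeff_homogeneousComponent] at he
    refine hr e fun h0 => he ?_
    rw [h0, ite_self]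
  · have := congrArg (homogeneousComponent k) hsum
    rwa [map_add, hq, homogeneousComponent_of_mem hh, if_pos rfl] at this

end Division

/-! ### Families specializing to the bicuspidal curve -/

section Families

lemma aeval_map_map {σ A B : Type*} [CommRing A] [CommRing B] (φ : A →+* B)
    (V : σ → Polynomial A) (P : MvPolynomial σ A) :
    aeval (fun i => (V i).map φ) (map φ P) = (aeval V P).map φ := by
  rw [aeval_def, eval₂_map, ← Polynomial.coe_mapRingHom, aeval_def, eval₂_comp_left]
  congr 1
  ext a
  simp

lemma coeff_ne_zero_of_map_eq {σ O 𝓕 Ω : Type*} [CommRing O] [Field 𝓕] [Algebra O 𝓕]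
    [IsFractionRing O 𝓕] [CommRing Ω] {res : O →+* Ω} {P' : MvPolynomial σ O}
    {P : MvPolynomial σ 𝓕} {c : 𝓕} (h : map (algebraMap O 𝓕) P' = C c * P) (e : σ →₀ ℕ)
    (he : coeff e (map res P') ≠ 0) : coeff e P ≠ 0 := by
  intro h0
  have h1 := congrArg (coeff e) h
  rw [coeff_map, coeff_C_mul, h0, mul_zero, ← map_zero (algebraMap O 𝓕)] at h1
  rw [coeff_map, IsFractionRing.injective O 𝓕 h1, map_zero] at he
  exact he rfl

lemma isHomogeneous_map_of_map_eq {σ O 𝓕 Ω : Type*} [CommRing O] [Field 𝓕] [Algebra O 𝓕]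
    [IsFractionRing O 𝓕] [CommRing Ω] (res : O →+* Ω) {P' : MvPolynomial σ O}
    {P : MvPolynomial σ 𝓕} {c : 𝓕} (h : map (algebraMap O 𝓕) P' = C c * P) {k : ℕ}
    (hP : P.IsHomogeneous k) : (map res P').IsHomogeneous k :=
  fun e he => hP (coeff_ne_zero_of_map_eq h e he)

variable {Ω : Type*} [Field Ω] [IsAlgClosed Ω] [CharZero Ω]

/-- Forms of small `X 0`-degree are normal forms on the curve: vanishing there means divisibility by
`f`, which the degree excludes unless the form is zero. -/
lemma eq_zero_of_aeval_bicuspidalParam {n : ℕ} (hn : n ≠ 0) {f : MvPolynomial (Fin 3) Ω}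
    (hf : f.IsHomogeneous (n + 2)) (hf1 : coeff (Finsupp.single 0 (n + 2)) f = 1) {c : Ω}
    (hc : f = C c * bicuspidalForm Ω n) {r : MvPolynomial (Fin 3) Ω} {k : ℕ}
    (hr : r.IsHomogeneous k) (hdeg : ∀ e, coeff e r ≠ 0 → e 0 < n + 2)
    (h : aeval (bicuspidalParam Ω n) r = 0) : r = 0 := by
  have hc0 : c ≠ 0 := by
    rintro rfl
    rw [hc, C_0, zero_mul, coeff_zero] at hf1
    exact zero_ne_one hf1
  refine eq_zero_of_dvd_of_degreeOf_lt hf hf1 ?_ hdeg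
  rw [hc]
  obtain ⟨s, hs⟩ := bicuspidalForm_dvd hn hr h
  refine ⟨C c⁻¹ * s, ?_⟩
  rw [hs]
  have : (C c * C c⁻¹ : MvPolynomial (Fin 3) Ω) = 1 := by
    rw [← C_mul, mul_inv_cancel₀ hc0, C_1]
  linear_combination (-bicuspidalForm Ω n * s) * this

variable {O 𝓕 : Type*} [CommRing O] [IsDomain O] [ValuationRing O] [Field 𝓕] [Algebra O 𝓕]
  [IsFractionRing O 𝓕]

/-- The equation of a family of rational curves specializing to the bicuspidal curve generates the
ideal of the generic curve. -/
theorem map_dvd_of_aeval_eq_zero {n : ℕ} (hn : n ≠ 0) (res : O →+* Ω)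
    {f : MvPolynomial (Fin 3) O} (hf : f.IsHomogeneous (n + 2))
    (hf1 : coeff (Finsupp.single 0 (n + 2)) f = 1) {c : Ω}
    (hc : map res f = C c * bicuspidalForm Ω n) {V : Fin 3 → Polynomial O}
    (hV : ∀ i, (V i).map res = bicuspidalParam Ω n i) (hfV : aeval V f = 0)
    {h : MvPolynomial (Fin 3) 𝓕} {k : ℕ} (hh : h.IsHomogeneous k)
    (hhV : aeval (fun i => (V i).map (algebraMap O 𝓕)) h = 0) : map (algebraMap O 𝓕) f ∣ h := by
  obtain ⟨q, r, hr, hrdeg, hsum⟩ := exists_eq_mul_add_of_isHomogeneous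
    (hf.map (algebraMap O 𝓕)) (by rw [coeff_map, hf1, map_one]) (by omega) hh
  have hrV : aeval (fun i => (V i).map (algebraMap O 𝓕)) r = 0 := by
    rw [hsum, map_add, map_mul, aeval_map_map, hfV, Polynomial.map_zero, zero_mul, zero_add] at hhV
    exact hhV
  suffices hr0 : r = 0 by rw [hsum, hr0, add_zero]; exact dvd_mul_right _ _
  by_contra hr0
  -- A nonzero remainder, scaled to be primitive, would reduce to a nonzero normal form vanishing on
  -- the bicuspidal curve.
  obtain ⟨c', -, P', hP', ⟨_, hne⟩, -⟩ := exists_primitive (O := O) res (fun _ : Unit => r) ⟨(), hr0⟩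
  refine hne (eq_zero_of_aeval_bicuspidalParam hn (hf.map res) (by rw [coeff_map, hf1, map_one]) hc
    (isHomogeneous_map_of_map_eq res (hP' ()) hr)
    (fun e he => hrdeg e (coeff_ne_zero_of_map_eq (hP' ()) e he)) ?_)
  have h1 : aeval V (P' ()) = 0 := by
    apply Polynomial.map_injective _ (IsFractionRing.injective O 𝓕)
    rw [← aeval_map_map, hP', map_mul, hrV, mul_zero, Polynomial.map_zero]
  rw [show bicuspidalParam Ω n = fun i => (V i).map res from funext fun i => (hV i).symm,
    aeval_map_map, h1, Polynomial.map_zero]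

/-- If the coefficients `a, b` had a denominator, clearing it and reducing would give a nontrivial
relation `0 = f a' + r b'`. On the bicuspidal curve `r` does not vanish identically, so the normal
form `b'` is zero, and then `a'` is. -/
lemma exists_residue_combination {n : ℕ} (hn : n ≠ 0) (res : O →+* Ω)
    (hres : ∀ x, ¬ IsUnit x → res x = 0)
    {f : MvPolynomial (Fin 3) O} (hf : f.IsHomogeneous (n + 2))
    (hf1 : coeff (Finsupp.single 0 (n + 2)) f = 1) {c : Ω}
    (hc : map res f = C c * bicuspidalForm Ω n) {u r : MvPolynomial (Fin 3) O}
    (hr : aeval (bicuspidalParam Ω n) (map res r) ≠ 0) {a b : MvPolynomial (Fin 3) 𝓕} {M : ℕ}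
    (hb : b.IsHomogeneous M) (hbdeg : ∀ e, coeff e b ≠ 0 → e 0 < n + 2)
    (h : map (algebraMap O 𝓕) u = map (algebraMap O 𝓕) f * a + map (algebraMap O 𝓕) r * b) :
    ∃ a' b', map res u = map res f * a' + map res r * b' := by
  have hinj : Function.Injective (map (σ := Fin 3) (algebraMap O 𝓕)) :=
    map_injective _ (IsFractionRing.injective O 𝓕)
  have hf1' : coeff (Finsupp.single 0 (n + 2)) (map res f) = 1 := by
    rw [coeff_map, hf1, map_one]
  by_cases h0 : ∃ i, (![a, b] : Fin 2 → _) i ≠ 0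
  · obtain ⟨x, hx, P, hP, ⟨i, hi⟩, hor⟩ := exists_primitive (O := O) res ![a, b] h0
    rcases hor with hor | ⟨y, hy, hyu⟩
    · obtain ⟨a', ha'⟩ := hor 0
      obtain ⟨b', hb'⟩ := hor 1
      refine ⟨map res a', map res b', ?_⟩
      rw [← map_mul, ← map_mul, ← map_add]
      congr 1
      apply hinj
      rw [h, map_add, map_mul, map_mul, ha', hb']
      rfl
    · exfalso
      have hPa : map (algebraMap O 𝓕) (P 0) = C x * a := hP 0
      have hPb : map (algebraMap O 𝓕) (P 1) = C x * b := hP 1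
      have h1 : C y * u = f * P 0 + r * P 1 := by
        apply hinj
        rw [map_add, map_mul, map_mul, map_mul, hPa, hPb, map_C, hy, h]
        ring
      have h2 := congrArg (map res) h1
      rw [map_mul, map_C, hres y hyu, C_0, zero_mul, map_add, map_mul, map_mul] at h2
      have h3 := congrArg (aeval (bicuspidalParam Ω n)) h2
      rw [map_add, map_mul, map_mul, hc, map_mul, aeval_bicuspidalParam, mul_zero, zero_mul,
        zero_add, map_zero, eq_comm, mul_eq_zero, or_iff_right hr] at h3
      have h4 : map res (P 1) = 0 := eq_zero_of_aeval_bicuspidalParam hn (hf.map res) hf1' hc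
        (isHomogeneous_map_of_map_eq res hPb hb)
        (fun e he => hbdeg e (coeff_ne_zero_of_map_eq hPb e he)) h3
      rw [h4, mul_zero, add_zero, eq_comm, mul_eq_zero] at h2
      have h5 : map res f ≠ 0 := by
        intro h5
        rw [h5, coeff_zero] at hf1'
        exact zero_ne_one hf1'
      have h6 := h2.resolve_left h5
      fin_cases i
      · exact hi h6
      · exact hi h4
  · push Not at h0
    have ha : a = 0 := h0 0
    have hb : b = 0 := h0 1
    refine ⟨0, 0, ?_⟩
    rw [ha, hb, mul_zero, mul_zero, add_zero, ← map_zero (map (algebraMap O 𝓕))] at h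
    rw [hinj h, map_zero, mul_zero, mul_zero, add_zero]

/-- No curve meets the generic member of a family specializing to the bicuspidal curve in a single
point. -/
theorem false_of_specializes_bicuspidal {n : ℕ} (hn : 2 ≤ n) (res : O →+* Ω) [IsLocalHom res]
    {f : MvPolynomial (Fin 3) O} (hf : f.IsHomogeneous (n + 2))
    (hf1 : coeff (Finsupp.single 0 (n + 2)) f = 1) {c : Ω}
    (hc : map res f = C c * bicuspidalForm Ω n) {k M N : ℕ} (hk : 0 < k)
    {r : MvPolynomial (Fin 3) 𝓕} (hr : r.IsHomogeneous k) (hfr : ¬ map (algebraMap O 𝓕) f ∣ r)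
    {p : Fin 3 → 𝓕} (hp : p ≠ 0) (a b : Fin 3 → Fin 3 → MvPolynomial (Fin 3) 𝓕)
    (hb : ∀ i j, (b i j).IsHomogeneous M)
    (h : ∀ i j, (C (p j) * X i - C (p i) * X j) ^ N = map (algebraMap O 𝓕) f * a i j + r * b i j) :
    False := by
  have hinj := IsFractionRing.injective O 𝓕
  have hf' := hf.map (algebraMap O 𝓕)
  have hf1' : coeff (Finsupp.single 0 (n + 2)) (map (algebraMap O 𝓕) f) = 1 := by
    rw [coeff_map, hf1, map_one]
  have hfr' : coeff (Finsupp.single 0 (n + 2)) (map res f) = 1 := by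
    rw [coeff_map, hf1, map_one]
  have hres0 : ∀ x, ¬ IsUnit x → res x = 0 := by
    intro x hx
    by_contra h0
    exact hx (isUnit_of_map_unit res x (isUnit_iff_ne_zero.2 h0))
  -- The reduction of a primitive multiple of `r` itself could vanish on the bicuspidal curve; that
  -- of its normal form cannot.
  obtain ⟨q, r₁, hr₁, hr₁deg, rfl⟩ := exists_eq_mul_add_of_isHomogeneous hf' hf1' (by omega) hr
  have hr₁0 : r₁ ≠ 0 := by
    rintro rfl
    rw [add_zero] at hfr
    exact hfr (dvd_mul_right _ _)
  -- integral models of the data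
  obtain ⟨cr, hcr, r₂, hr₂, ⟨_, hr₂ne⟩, -⟩ :=
    exists_primitive (O := O) res (fun _ : Unit => r₁) ⟨(), hr₁0⟩
  obtain ⟨l, hl⟩ := Function.ne_iff.1 hp
  obtain ⟨cp, hcp, p₂, hp₂, ⟨l', hl'⟩, -⟩ := exists_primitive (O := O) res
    (fun i => (C (p i) : MvPolynomial (Fin 3) 𝓕)) ⟨l, by simpa using hl⟩
  set ρ := map res (r₂ ()) with hρ
  have hρhom : ρ.IsHomogeneous k := isHomogeneous_map_of_map_eq res (hr₂ ()) hr₁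
  have hρV : aeval (bicuspidalParam Ω n) ρ ≠ 0 := fun h0 =>
    hr₂ne (eq_zero_of_aeval_bicuspidalParam (by omega) (hf.map res) hfr' hc hρhom
      (fun e he => hr₁deg e (coeff_ne_zero_of_map_eq (hr₂ ()) e he)) h0)
  have hC : Function.Injective (map (σ := Fin 3) (algebraMap O 𝓕)) := map_injective _ hinj
  let s : Fin 3 → O := fun i => coeff 0 (p₂ i)
  have hs : ∀ i, algebraMap O 𝓕 (s i) = cp * p i := by
    intro i
    have := congrArg (coeff 0) (hp₂ i)
    rwa [coeff_map, coeff_C_mul, coeff_C, if_pos rfl] at this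
  have hs0 : (fun i => res (s i)) ≠ 0 := by
    intro h0
    refine hl' ?_
    have h1 : p₂ l' = C (s l') := by
      apply hC
      rw [hp₂, map_C, hs, C_mul]
    rw [h1, map_C, congrFun h0 l', Pi.zero_apply, C_0]
  have key : ∀ i j, ∃ a' b', map res ((C (s j) * X i - C (s i) * X j) ^ N) =
      map res f * a' + ρ * b' := by
    intro i j
    obtain ⟨q', b', hb', hb'deg, hsum⟩ :=
      exists_eq_mul_add_of_isHomogeneous hf' hf1' (by omega) (hb i j)
    have hcr' : (C cr⁻¹ * C cr : MvPolynomial (Fin 3) 𝓕) = 1 := by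
      rw [← C_mul, inv_mul_cancel₀ hcr, C_1]
    refine exists_residue_combination (by omega) res hres0 hf hf1 hc hρV
      (a := C (cp ^ N) * (a i j + q * b i j + r₁ * q')) (b := C (cp ^ N * cr⁻¹) * b')
      (M := 0 + M) ((isHomogeneous_C _ _).mul hb') (fun e he => hb'deg e fun h0 => he ?_) ?_
    · rw [coeff_C_mul, h0, mul_zero]
    · rw [map_pow, hr₂]
      have h1 : map (algebraMap O 𝓕) (C (s j) * X i - C (s i) * X j) =
          C cp * (C (p j) * X i - C (p i) * X j) := by
        rw [map_sub, map_mul, map_mul, map_C, map_C, map_X, map_X, hs, hs, C_mul, C_mul]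
        ring
      rw [h1, mul_pow, h, C_mul, ← C_pow]
      linear_combination (C (cp ^ N) * r₁) * hsum - (C (cp ^ N) * r₁ * b') * hcr'
  refine not_onePoint_bicuspidal hn hk hρhom hρV hs0 fun q hq hρq i j => ?_
  obtain ⟨a', b', hab⟩ := key i j
  have h1 := congrArg (eval q) hab
  rw [map_add, map_mul, map_mul, hρq, hc, map_mul, hq, mul_zero, zero_mul, zero_mul, add_zero,
    map_pow, map_pow] at h1
  have h2 := eq_zero_of_pow_eq_zero h1
  simp only [map_sub, map_mul, map_C, map_X, eval_C, eval_X] at h2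
  exact sub_eq_zero.1 h2

end Families


/-! ### The equation of a rational plane curve -/

section ImplicitEquation

lemma isHomogeneous_det {σ A ι : Type*} [CommRing A] [Fintype ι] [DecidableEq ι]
    (M : Matrix ι ι (MvPolynomial σ A)) (hM : ∀ i j, (M i j).IsHomogeneous 1) :
    M.det.IsHomogeneous (Fintype.card ι) := by
  rw [Matrix.det_apply]
  refine IsHomogeneous.sum _ _ _ fun s _ => ?_
  have h1 : (∏ i, M (s i) i).IsHomogeneous (∑ _i : ι, 1) :=
    IsHomogeneous.prod _ _ _ fun i _ => hM _ _
  rw [Finset.sum_const, smul_eq_mul, mul_one, Finset.card_univ] at h1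
  exact (homogeneousSubmodule σ A _).smul_of_tower_mem (Equiv.Perm.sign s) h1

/-- The adjugate of the Sylvester map inverts it up to the resultant, so a unit resultant makes it
surjective. -/
lemma exists_mul_add_mul_eq_of_isUnit_resultant {A : Type*} [CommRing A] {P Q R : Polynomial A}
    {d : ℕ} (hP : P.natDegree ≤ d) (hQ : Q.natDegree ≤ d)
    (hu : IsUnit (Polynomial.resultant P Q d d)) (hR : R.degree < ((d + d : ℕ) : WithBot ℕ)) :
    ∃ a b : Fin d → A, P * ∑ i, Polynomial.C (a i) * Polynomial.X ^ (i : ℕ) +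
      Q * ∑ i, Polynomial.C (b i) * Polynomial.X ^ (i : ℕ) = R := by
  obtain ⟨u, hu⟩ := hu
  have key : ∀ T ∈ Polynomial.degreeLT A d,
      T = ∑ i : Fin d, Polynomial.C (T.coeff i) * Polynomial.X ^ (i : ℕ) := by
    intro T hT
    rw [Polynomial.mem_degreeLT] at hT
    rw [Fin.sum_univ_eq_sum_range (fun i => Polynomial.C (T.coeff i) * Polynomial.X ^ i) d]
    ext m
    rw [Polynomial.finsetSum_coeff]
    simp only [Polynomial.coeff_C_mul_X_pow, Finset.sum_ite_eq, Finset.mem_range]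
    split_ifs with h
    · rfl
    · exact Polynomial.coeff_eq_zero_of_degree_lt (hT.trans_le (by exact_mod_cast not_lt.1 h))
  let T : Polynomial.degreeLT A (d + d) :=
    (↑u⁻¹ : A) • ⟨R, Polynomial.mem_degreeLT.2 hR⟩
  have h1 := LinearMap.congr_fun (Polynomial.sylveserMap_comp_adjSylvester P Q hP hQ) T
  have h2 := congrArg Subtype.val h1
  rw [← hu, LinearMap.comp_apply, Polynomial.sylvesterMap_apply_coe] at h2
  refine ⟨fun i => Polynomial.coeff (Polynomial.adjSylvester P Q T).2 i,
    fun i => Polynomial.coeff (Polynomial.adjSylvester P Q T).1 i, ?_⟩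
  rw [← key _ (Polynomial.adjSylvester P Q T).2.2, ← key _ (Polynomial.adjSylvester P Q T).1.2, h2]
  change (u : A) • ((↑u⁻¹ : A) • R) = R
  rw [smul_smul, Units.mul_inv, one_smul]

/-- The equation of a rational plane curve that avoids the point `(1 : 0 : 0)`. -/
theorem exists_implicit_equation {A : Type*} [CommRing A] {d : ℕ} (hd : 0 < d)
    (V : Fin 3 → Polynomial A) (hV : ∀ i, (V i).natDegree ≤ d)
    (hu : IsUnit (Polynomial.resultant (V 1) (V 2) d d)) :
    ∃ f : MvPolynomial (Fin 3) A, f.IsHomogeneous d ∧ coeff (Finsupp.single 0 d) f = 1 ∧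
      aeval V f = 0 := by
  -- Each `V 0 * X ^ j` is a combination of `V 1` and `V 2` with multipliers of degree below `d`.
  -- The resulting matrix of linear forms kills the vector of powers of the parameter along the
  -- curve, and its determinant is the equation.
  have h1 : ∀ j : Fin d, ∃ a b : Fin d → A,
      V 1 * ∑ i, Polynomial.C (a i) * Polynomial.X ^ (i : ℕ) +
      V 2 * ∑ i, Polynomial.C (b i) * Polynomial.X ^ (i : ℕ) = V 0 * Polynomial.X ^ (j : ℕ) := by
    intro j
    refine exists_mul_add_mul_eq_of_isUnit_resultant (hV 1) (hV 2) hu ?_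
    refine lt_of_le_of_lt Polynomial.degree_le_natDegree ?_
    have := Polynomial.natDegree_mul_le_of_le (hV 0) (Polynomial.natDegree_X_pow_le (R := A) j)
    have hj := j.2
    exact_mod_cast (by omega : (V 0 * Polynomial.X ^ (j : ℕ)).natDegree < d + d)
  choose a b hab using h1
  let M : Matrix (Fin d) (Fin d) (MvPolynomial (Fin 3) A) := Matrix.of fun j i =>
    C (if j = i then 1 else 0) * X 0 - C (a j i) * X 1 - C (b j i) * X 2
  have hM : M.det.IsHomogeneous d := by
    have := isHomogeneous_det M fun j i => ((isHomogeneous_C_mul_X _ _).sub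
      (isHomogeneous_C_mul_X _ _)).sub (isHomogeneous_C_mul_X _ _)
    rwa [Fintype.card_fin] at this
  refine ⟨M.det, hM, ?_, ?_⟩
  · rw [← hM.eval_single, RingHom.map_det]
    have : (eval (Pi.single 0 1)).mapMatrix M = (1 : Matrix (Fin d) (Fin d) A) := by
      ext j i
      simp only [M, RingHom.mapMatrix_apply, Matrix.map_apply, Matrix.of_apply, Matrix.one_apply,
        map_sub, map_mul, eval_C, eval_X]
      simp
    rw [this, Matrix.det_one]
  · rw [AlgHom.map_det]
    set N := (aeval V).mapMatrix M with hN
    have h2 : N.mulVec (fun i => Polynomial.X ^ (i : ℕ)) = 0 := by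
      funext j
      have h3 : ∀ i, N j i * Polynomial.X ^ (i : ℕ) =
          (if j = i then V 0 * Polynomial.X ^ (i : ℕ) else 0) -
          V 1 * (Polynomial.C (a j i) * Polynomial.X ^ (i : ℕ)) -
          V 2 * (Polynomial.C (b j i) * Polynomial.X ^ (i : ℕ)) := by
        intro i
        simp only [hN, M, AlgHom.mapMatrix_apply, Matrix.map_apply, Matrix.of_apply, map_sub,
          map_mul, aeval_X, aeval_C, Polynomial.algebraMap_eq]
        split_ifs
        · rw [Polynomial.C_1]; ring
        · rw [Polynomial.C_0]; ring
      rw [Matrix.mulVec, dotProduct, Finset.sum_congr rfl fun i _ => h3 i,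
        Finset.sum_sub_distrib, Finset.sum_sub_distrib, ← Finset.mul_sum, ← Finset.mul_sum,
        Finset.sum_ite_eq, if_pos (Finset.mem_univ _), sub_sub, hab, sub_self, Pi.zero_apply]
    have h4 : (N.adjugate * N).mulVec (fun i => Polynomial.X ^ (i : ℕ)) = 0 := by
      rw [← Matrix.mulVec_mulVec, h2, Matrix.mulVec_zero]
    rw [Matrix.adjugate_mul, Matrix.smul_mulVec, Matrix.one_mulVec] at h4
    have h5 := congrFun h4 ⟨0, hd⟩
    simpa using h5

variable {O Ω : Type*} [CommRing O] [Field Ω] [IsAlgClosed Ω] [CharZero Ω]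

/-- The equation of a family of parametrized curves specializing to the bicuspidal curve. -/
theorem exists_equation_of_specializes_bicuspidal {n : ℕ} (hn : n ≠ 0) (res : O →+* Ω)
    [IsLocalHom res] {V : Fin 3 → Polynomial O} (hVdeg : ∀ i, (V i).natDegree ≤ n + 2)
    (hV : ∀ i, (V i).map res = bicuspidalParam Ω n i) :
    ∃ f : MvPolynomial (Fin 3) O, f.IsHomogeneous (n + 2) ∧
      coeff (Finsupp.single 0 (n + 2)) f = 1 ∧ aeval V f = 0 ∧
      map res f = C ((-1) ^ n) * bicuspidalForm Ω n := by
  obtain ⟨f, hf, hf1, hfV⟩ := exists_implicit_equation (by omega) V hVdeg (by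
    refine isUnit_of_map_unit res _ (isUnit_iff_ne_zero.2 ?_)
    have h2 : (bicuspidalParam Ω n 2).natDegree ≤ n + 2 := by
      rw [← hV]
      exact Polynomial.natDegree_map_le.trans (hVdeg 2)
    rw [← Polynomial.resultant_map_map, hV, hV]
    -- The second coordinate `X` has formal degree `n + 2`. Up to sign the resultant is a power of
    -- the leading coefficient `1` of the third coordinate times its constant term `(-1) ^ n`, hence
    -- nonzero in `Ω` and a unit in `O`.
    have h3 := Polynomial.resultant_add_left_deg (Polynomial.X ^ 1 : Polynomial Ω)
      (bicuspidalParam Ω n 2) 1 (n + 2) (n + 1) (Polynomial.natDegree_X_pow_le 1)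
    rw [Polynomial.resultant_X_pow_left _ _ _ h2, coeff_bicuspidalParam_two] at h3
    have h4 : (bicuspidalParam Ω n 2).coeff 0 = (-1) ^ n := by
      rw [Polynomial.coeff_zero_eq_eval_zero]
      simp [bicuspidalParam]
    rw [h4, pow_one, show 1 + (n + 1) = n + 2 by ring] at h3
    rw [show bicuspidalParam Ω n 1 = Polynomial.X from rfl, h3]
    simp)
  refine ⟨f, hf, hf1, hfV, ?_⟩
  have hone : ((-1 : Ω) ^ n) * (-1) ^ n = 1 := by rw [← mul_pow]; simp
  have hg : (C ((-1) ^ n) * bicuspidalForm Ω n).IsHomogeneous (n + 2) := by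
    have := (isHomogeneous_C (Fin 3) ((-1 : Ω) ^ n)).mul (bicuspidalForm_isHomogeneous Ω n)
    rwa [zero_add] at this
  have hg1 : coeff (Finsupp.single 0 (n + 2)) (C ((-1) ^ n) * bicuspidalForm Ω n) = 1 := by
    rw [coeff_C_mul, coeff_bicuspidalForm hn, hone]
  rw [← sub_eq_zero]
  -- Both forms have coefficient `1` at the top power of `X 0`, so their difference is a normal form
  -- vanishing on the curve.
  refine eq_zero_of_aeval_bicuspidalParam hn hg hg1 rfl ((hf.map res).sub hg) ?_ ?_
  · intro e he
    have h1 := ((hf.map res).sub hg) he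
    by_contra h2
    have h3 : e = Finsupp.single 0 (n + 2) := by
      have h4 : e 0 + e 1 + e 2 = n + 2 := by
        simpa [Finsupp.weight_apply, Finsupp.sum_fintype, Fin.sum_univ_three] using h1
      ext i
      fin_cases i
      · simp; omega
      · simp; omega
      · simp; omega
    rw [h3, coeff_sub, coeff_map, hf1, hg1, map_one, sub_self] at he
    exact he rfl
  · rw [map_sub, map_mul, aeval_bicuspidalParam, mul_zero, sub_zero,
      show bicuspidalParam Ω n = fun i => (V i).map res from funext fun i => (hV i).symm,
      aeval_map_map, hfV, Polynomial.map_zero]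

end ImplicitEquation


/-! ### Homogeneous coordinate rings and section rings -/

section Dimension

/-- The chain of primes is `0`, the kernel of `χ`, and the kernel of `χ` followed by evaluation at
`0`: the cone, a line through its vertex, the vertex. -/
lemma two_le_ringKrullDim {R k : Type*} [CommRing R] [IsDomain R] [Field k]
    (χ : R →+* Polynomial k) {a b : R} (ha : a ≠ 0) (hχa : χ a = 0) (hb : χ b ≠ 0)
    (hb0 : (χ b).eval 0 = 0) : 2 ≤ ringKrullDim R := by
  let P₀ : PrimeSpectrum R := ⟨⊥, Ideal.isPrime_bot⟩
  let P₁ : PrimeSpectrum R := ⟨RingHom.ker χ, RingHom.ker_isPrime _⟩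
  let P₂ : PrimeSpectrum R :=
    ⟨RingHom.ker ((Polynomial.evalRingHom 0).comp χ), RingHom.ker_isPrime _⟩
  have h01 : P₀ < P₁ := by
    refine lt_of_le_of_ne (show (⊥ : Ideal R) ≤ _ from bot_le) fun h => ha ?_
    have h1 : a ∈ P₁.asIdeal := hχa
    rw [← h] at h1
    exact h1
  have h12 : P₁ < P₂ := by
    refine lt_of_le_of_ne (fun x hx => ?_) fun h => hb ?_
    · change Polynomial.eval 0 (χ x) = 0
      rw [show χ x = 0 from hx, Polynomial.eval_zero]
    · have h1 : b ∈ P₂.asIdeal := hb0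
      rw [← h] at h1
      exact h1
  let c : LTSeries (PrimeSpectrum R) := ⟨2, ![P₀, P₁, P₂], by
    intro i
    fin_cases i
    · exact h01
    · exact h12⟩
  exact Order.LTSeries.length_le_krullDim c

lemma noKhovanskiiFiniteValuation_of_forall {K R : Type*} [Field K] [IsAlgClosed K] [CommRing R]
    [Algebra K R] {𝒜 : ℕ → Submodule K R} {x : Fin 3 → R} (hx : IsGradedBy 𝒜 x)
    (htr : ∀ g : Fin 3 → R, ¬ AlgebraicIndependent K g) (hdim : 2 ≤ ringKrullDim R)
    (h : ∀ k M, 0 < k → ¬ HasOnePointSection 𝒜 k M) : NoKhovanskiiFiniteValuation.{w} 𝒜 := by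
  intro Γ _ _ _ _ _ ν hK hν hrk hfin
  rw [IsFullRank] at hrk
  rw [← hrk] at hdim
  obtain ⟨k, M, hk, hs⟩ := exists_hasOnePointSection hx htr hK hν (by exact_mod_cast hdim) hfin
  exact h k M hk hs

end Dimension

lemma aeval_X_mul_C {σ A : Type*} [CommRing A] {k : ℕ} {r : MvPolynomial σ A}
    (hr : r.IsHomogeneous k) (v : σ → A) :
    aeval (fun i => Polynomial.X * Polynomial.C (v i)) r =
      Polynomial.X ^ k * Polynomial.C (eval v r) := by
  rw [hr.aeval_mul]
  congr 1
  rw [aeval_def, eval, Polynomial.algebraMap_eq, coe_eval₂Hom, eval₂_comp_left]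
  rfl

/-! ### Affine cones over plane curves -/

section ConeRing

variable {K : Type*} [Field K]

lemma isGradedBy_coneGrading (f : MvPolynomial (Fin 3) K) :
    IsGradedBy (coneGrading f) fun i => Ideal.Quotient.mk (Ideal.span {f}) (X i) := by
  have h : ∀ F : MvPolynomial (Fin 3) K,
      aeval (fun i => Ideal.Quotient.mk (Ideal.span {f}) (X i)) F =
        Ideal.Quotient.mk (Ideal.span {f}) F := by
    intro F
    have := aeval_unique (Ideal.Quotient.mkₐ K (Ideal.span {f}))
    exact (DFunLike.congr_fun this F).symm
  refine ⟨fun n a => ?_, fun a => ?_⟩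
  · simp only [h]
    exact Submodule.mem_map
  · obtain ⟨F, rfl⟩ := Ideal.Quotient.mk_surjective a
    exact ⟨F, h F⟩

lemma aeval_cons {A B : Type*} [CommRing A] [CommRing B] [Algebra A B] {m : ℕ} (b : B)
    (G : Fin m → B) (P : MvPolynomial (Fin (m + 1)) A) :
    aeval (Fin.cons b G : Fin (m + 1) → B) P =
      (finSuccEquiv A m P).eval₂ (aeval G : MvPolynomial (Fin m) A →ₐ[A] B).toRingHom b := by
  induction P using MvPolynomial.induction_on with
  | C a =>
    rw [aeval_C, finSuccEquiv_apply, eval₂Hom_C, RingHom.comp_apply, Polynomial.eval₂_C]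
    exact (aeval_C G a).symm
  | add p q hp hq => rw [map_add, map_add, Polynomial.eval₂_add, hp, hq]
  | mul_X p i hp =>
    rw [map_mul, map_mul, Polynomial.eval₂_mul, hp, aeval_X]
    congr 1
    refine Fin.cases ?_ (fun j => ?_) i
    · rw [Fin.cons_zero, finSuccEquiv_X_zero, Polynomial.eval₂_X]
    · rw [Fin.cons_succ, finSuccEquiv_X_succ, Polynomial.eval₂_C]
      exact (aeval_X G j).symm

/-- Lifts of three independent elements, together with `f`, would be four independent elements of
`K[x, y, z]`: reducing a relation modulo `f` kills its constant term in `f`, and then `f` can be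
cancelled. -/
lemma not_algebraicIndependent_coneRing {f : MvPolynomial (Fin 3) K} (hf : f ≠ 0)
    (g : Fin 3 → ConeRing f) : ¬ AlgebraicIndependent K g := by
  intro hg
  choose G hG using fun i => Ideal.Quotient.mk_surjective (I := Ideal.span {f}) (g i)
  have hmk : ∀ P : MvPolynomial (Fin 3) K,
      Ideal.Quotient.mk (Ideal.span {f}) (aeval G P) = aeval g P := by
    intro P
    have := comp_aeval_apply G (Ideal.Quotient.mkₐ K (Ideal.span {f})) P
    rwa [show (fun i => Ideal.Quotient.mkₐ K (Ideal.span {f}) (G i)) = g from funext hG] at this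
  have hmain : ∀ n : ℕ, ∀ Q : Polynomial (MvPolynomial (Fin 3) K), Q.natDegree ≤ n →
      Q.eval₂ (aeval G : MvPolynomial (Fin 3) K →ₐ[K] _).toRingHom f = 0 → Q = 0 := by
    intro n
    induction n with
    | zero =>
      intro Q hQ h
      rw [Polynomial.eq_C_of_natDegree_le_zero hQ] at h ⊢
      rw [Polynomial.eval₂_C] at h
      have h1 := hmk (Q.coeff 0)
      rw [show aeval G (Q.coeff 0) = 0 from h, map_zero] at h1
      rw [hg.eq_zero_of_aeval_eq_zero _ h1.symm, Polynomial.C_0]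
    | succ n ih =>
      intro Q hQ h
      rw [← Polynomial.divX_mul_X_add Q, Polynomial.eval₂_add, Polynomial.eval₂_mul,
        Polynomial.eval₂_X, Polynomial.eval₂_C] at h
      have h1 := hmk (Q.coeff 0)
      have h2 : aeval G (Q.coeff 0) ∈ Ideal.span {f} := by
        rw [Ideal.mem_span_singleton]
        exact (dvd_add_right (dvd_mul_left f _)).1 ((dvd_zero f).trans (dvd_of_eq h.symm))
      rw [Ideal.Quotient.eq_zero_iff_mem.2 h2] at h1
      have h3 := hg.eq_zero_of_aeval_eq_zero _ h1.symm
      rw [h3, map_zero, add_zero, mul_eq_zero, or_iff_left hf] at h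
      have h4 := ih Q.divX (by rw [Polynomial.natDegree_divX_eq_natDegree_tsub_one]; omega) h
      rw [← Polynomial.divX_mul_X_add Q, h4, h3, zero_mul, zero_add, Polynomial.C_0]
  have hind : AlgebraicIndependent K (Fin.cons f G : Fin 4 → MvPolynomial (Fin 3) K) := by
    rw [algebraicIndependent_iff]
    intro P hP
    have h1 := hmain _ (finSuccEquiv K 3 P) le_rfl (by
      rw [← hP, aeval_cons])
    simpa using h1
  have h1 := hind.lift_cardinalMk_le_trdeg
  rw [MvPolynomial.trdeg_of_isDomain] at h1
  simp at h1
  norm_num at h1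

lemma two_le_ringKrullDim_coneRing [IsAlgClosed K] {f : MvPolynomial (Fin 3) K} {d : ℕ}
    (hd : 2 ≤ d) (hf : f.IsHomogeneous d) (hf0 : f ≠ 0) [IsDomain (ConeRing f)]
    {q : Fin 3 → K} (hq : q ≠ 0) (hqf : eval q f = 0) : 2 ≤ ringKrullDim (ConeRing f) := by
  obtain ⟨i, hi⟩ := Function.ne_iff.1 hq
  rw [Pi.zero_apply] at hi
  obtain ⟨j, hj⟩ := exists_ne i
  let χ : ConeRing f →+* Polynomial K := Ideal.Quotient.lift (Ideal.span {f})
    (aeval fun i => Polynomial.X * Polynomial.C (q i) : MvPolynomial (Fin 3) K →ₐ[K] _).toRingHom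
    (by
      intro a ha
      obtain ⟨s, rfl⟩ := Ideal.mem_span_singleton.1 ha
      change aeval (fun i => Polynomial.X * Polynomial.C (q i)) (f * s) = 0
      rw [map_mul, aeval_X_mul_C hf, hqf, Polynomial.C_0, mul_zero, zero_mul])
  have hχ : ∀ F, χ (Ideal.Quotient.mk _ F) =
      aeval (fun i => Polynomial.X * Polynomial.C (q i)) F := fun F => Ideal.Quotient.lift_mk _ _ _
  have hl : (C (q i) * X j - C (q j) * X i : MvPolynomial (Fin 3) K).IsHomogeneous 1 :=
    (isHomogeneous_C_mul_X _ _).sub (isHomogeneous_C_mul_X _ _)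
  have hl0 : (C (q i) * X j - C (q j) * X i : MvPolynomial (Fin 3) K) ≠ 0 := by
    intro h
    have := congrArg (coeff (Finsupp.single j 1)) h
    rw [coeff_sub, coeff_C_mul, coeff_C_mul, coeff_X, coeff_X, if_pos rfl, if_neg, mul_one, mul_zero, sub_zero,
      coeff_zero] at this
    · exact hi this
    · rw [Finsupp.single_left_inj one_ne_zero]
      exact hj.symm
  refine two_le_ringKrullDim χ (a := Ideal.Quotient.mk _ (C (q i) * X j - C (q j) * X i))
    (b := Ideal.Quotient.mk _ (X i)) ?_ ?_ ?_ ?_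
  · rw [Ne, Ideal.Quotient.eq_zero_iff_mem, Ideal.mem_span_singleton]
    rintro ⟨s, hs⟩
    have hs0 : s ≠ 0 := by
      rintro rfl
      exact hl0 (by rw [hs, mul_zero])
    have h1 := totalDegree_mul_of_isDomain hf0 hs0
    rw [← hs, hl.totalDegree hl0, hf.totalDegree hf0] at h1
    omega
  · rw [hχ, map_sub, map_mul, map_mul, aeval_X, aeval_X, aeval_C, aeval_C,
      Polynomial.algebraMap_eq]
    ring
  · rw [hχ, aeval_X]
    exact mul_ne_zero Polynomial.X_ne_zero (by simpa using hi)
  · rw [hχ, aeval_X]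
    simp

end ConeRing

/-! ### Section rings of linear systems of binary forms -/

section SectionRing

variable {K : Type*} [Field K] {d : ℕ}

lemma toPolys_eq_span {L : Submodule K (BinaryForms K d)} {v : Fin 3 → BinaryForms K d}
    (hv : Submodule.span K (Set.range v) = L) :
    toPolys L = Submodule.span K (Set.range fun i => (v i : MvPolynomial (Fin 2) K)) := by
  rw [toPolys, ← hv, Submodule.map_span, ← Set.range_comp]
  rfl

lemma toPolys_pow {L : Submodule K (BinaryForms K d)} {v : Fin 3 → BinaryForms K d}
    (hv : Submodule.span K (Set.range v) = L) (n : ℕ) :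
    toPolys L ^ n = (homogeneousSubmodule (Fin 3) K n).map
      (aeval fun i => (v i : MvPolynomial (Fin 2) K)).toLinearMap := by
  rw [← homogeneousSubmodule_one_pow (σ := Fin 3), Submodule.map_pow, homogeneousSubmodule_one_eq_span_X,
    Submodule.map_span, ← Set.range_comp, toPolys_eq_span hv]
  congr 4
  ext i
  simp

lemma exists_isGradedBy_sectionGrading {L : Submodule K (BinaryForms K d)}
    {v : Fin 3 → BinaryForms K d} (hv : Submodule.span K (Set.range v) = L) :
    ∃ x : Fin 3 → SectionRing L, IsGradedBy (sectionGrading L) x ∧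
      (∀ i, (x i : MvPolynomial (Fin 2) K) = v i) ∧
      ∀ F : MvPolynomial (Fin 3) K, (aeval x F).1 =
        aeval (fun i => (v i : MvPolynomial (Fin 2) K)) F := by
  have hmem : ∀ i, (v i : MvPolynomial (Fin 2) K) ∈ SectionRing L := by
    intro i
    refine Algebra.subset_adjoin ?_
    rw [toPolys_eq_span hv]
    exact Submodule.subset_span ⟨i, rfl⟩
  have hval : ∀ F : MvPolynomial (Fin 3) K, ((aeval (fun i => (⟨v i, hmem i⟩ : SectionRing L)) F : SectionRing L) :
      MvPolynomial (Fin 2) K) = aeval (fun i => (v i : MvPolynomial (Fin 2) K)) F := by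
    intro F
    exact comp_aeval_apply (R := K) (fun i => (⟨v i, hmem i⟩ : SectionRing L)) (SectionRing L).val F
  refine ⟨fun i => ⟨v i, hmem i⟩, ⟨fun n a => ?_, fun a => ?_⟩, fun i => rfl, hval⟩
  · rw [sectionGrading, Submodule.mem_comap, toPolys_pow hv, Submodule.mem_map]
    refine exists_congr fun F => and_congr Iff.rfl ?_
    rw [Subtype.ext_iff, hval]
    rfl
  · have h1 : (a : MvPolynomial (Fin 2) K) ∈
        (aeval fun i => (v i : MvPolynomial (Fin 2) K) : MvPolynomial (Fin 3) K →ₐ[K] _).range := by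
      rw [← Algebra.adjoin_range_eq_range_aeval, ← Algebra.adjoin_span, ← toPolys_eq_span hv]
      exact a.2
    obtain ⟨F, hF⟩ := h1
    exact ⟨F, Subtype.ext ((hval F).trans hF)⟩

lemma not_algebraicIndependent_sectionRing (L : Submodule K (BinaryForms K d))
    (g : Fin 3 → SectionRing L) : ¬ AlgebraicIndependent K g := by
  intro hg
  have h1 := hg.map' (f := (SectionRing L).val) Subtype.val_injective
  have h2 := h1.lift_cardinalMk_le_trdeg
  rw [MvPolynomial.trdeg_of_isDomain] at h2
  simp at h2
  norm_num at h2

lemma two_le_ringKrullDim_sectionRing [Infinite K] (hd : 0 < d) {L : Submodule K (BinaryForms K d)}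
    (hL : 1 < Module.finrank K L) : 2 ≤ ringKrullDim (SectionRing L) := by
  have hnt : Nontrivial L := Module.nontrivial_of_finrank_pos (R := K) (by omega)
  obtain ⟨u, hu⟩ := exists_ne (0 : L)
  have hu' : (u : MvPolynomial (Fin 2) K) ≠ 0 := fun h => hu (Subtype.ext (Subtype.ext h))
  obtain ⟨a, ha⟩ : ∃ a : Fin 2 → K, eval a (u : MvPolynomial (Fin 2) K) ≠ 0 := by
    by_contra! h
    exact hu' (MvPolynomial.funext fun a => by rw [h a, map_zero])
  obtain ⟨l, hl, hl0⟩ : ∃ l : L, eval a (l : MvPolynomial (Fin 2) K) = 0 ∧ l ≠ 0 := by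
    by_contra! h
    refine absurd (finrank_le_one u fun w => ?_) (not_le.2 hL)
    let c := eval a (w : MvPolynomial (Fin 2) K) / eval a (u : MvPolynomial (Fin 2) K)
    refine ⟨c, ?_⟩
    have h1 := h (c • u - w) (by simp [c, ha])
    exact sub_eq_zero.1 h1
  have hmem : ∀ l : L, (l : MvPolynomial (Fin 2) K) ∈ SectionRing L := fun l =>
    Algebra.subset_adjoin ⟨l, l.2, rfl⟩
  let χ : SectionRing L →+* Polynomial K :=
    (aeval fun i => Polynomial.X * Polynomial.C (a i) : MvPolynomial (Fin 2) K →ₐ[K] _).toRingHom.comp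
      (SectionRing L).val.toRingHom
  have hχ : ∀ l : L, χ ⟨l, hmem l⟩ =
      Polynomial.X ^ d * Polynomial.C (eval a (l : MvPolynomial (Fin 2) K)) := fun l =>
    aeval_X_mul_C l.1.2 a
  refine two_le_ringKrullDim χ (a := ⟨l, hmem l⟩) (b := ⟨u, hmem u⟩) ?_ ?_ ?_ ?_
  · intro h
    exact hl0 (Subtype.ext (Subtype.ext (show (l : MvPolynomial (Fin 2) K) = 0 from
      congrArg (fun x : SectionRing L => (x : MvPolynomial (Fin 2) K)) h)))
  · rw [hχ, show eval a (l : MvPolynomial (Fin 2) K) = 0 from hl, Polynomial.C_0, mul_zero]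
  · rw [hχ]
    exact mul_ne_zero (pow_ne_zero _ Polynomial.X_ne_zero) (by simpa using ha)
  · rw [hχ]
    simp [hd.ne']

end SectionRing


/-! ### The bicuspidal curve is integral and rational -/

section Rationality

/-- Over `E`, the elements `t` and `t⁻¹` satisfy the same quadratic equation, so `(t - 1) ^ n = u (t
- 1) + v` holds for both with the same `u, v` in `E`. If `u = 0`, then `(t - 1) ^ n = (t⁻¹ - 1) ^
n`, that is `t ^ n = (-1) ^ n`. Hence `u ≠ 0` and `t` can be solved for. -/
lemma mem_of_quadratic {K M : Type*} [Field K] [Field M] [Algebra K M]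
    (E : IntermediateField K M) {t s : M} {n : ℕ} (ht : t ≠ 0) (ht1 : t ≠ 1)
    (htn : t ^ n ≠ (-1) ^ n) (hs : s ∈ E) (hst : (t - 1) ^ 2 = s * t) (hpow : (t - 1) ^ n ∈ E) :
    t ∈ E := by
  have key : ∀ m : ℕ, ∃ u ∈ E, ∃ v ∈ E, (t - 1) ^ m = u * (t - 1) + v ∧
      (t⁻¹ - 1) ^ m = u * (t⁻¹ - 1) + v := by
    have h1 : (t - 1) * (t - 1) = s * (t - 1) + s := by linear_combination hst
    have h2 : (t⁻¹ - 1) * (t⁻¹ - 1) = s * (t⁻¹ - 1) + s := by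
      field_simp
      linear_combination hst
    intro m
    induction m with
    | zero => exact ⟨0, E.zero_mem, 1, E.one_mem, by simp, by simp⟩
    | succ m ih =>
      obtain ⟨u, hu, v, hv, e1, e2⟩ := ih
      refine ⟨s * u + v, E.add_mem (E.mul_mem hs hu) hv, s * u, E.mul_mem hs hu, ?_, ?_⟩
      · rw [pow_succ, e1]
        linear_combination u * h1
      · rw [pow_succ, e2]
        linear_combination u * h2
  obtain ⟨u, hu, v, hv, e1, e2⟩ := key n
  have hu0 : u ≠ 0 := by
    rintro rfl
    rw [zero_mul, zero_add] at e1 e2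
    have h1 : t ^ n * (t⁻¹ - 1) ^ n = (-1) ^ n * (t - 1) ^ n := by
      rw [← mul_pow, ← mul_pow]
      congr 1
      field_simp
      ring
    rw [e2, ← e1] at h1
    exact htn (mul_right_cancel₀ (pow_ne_zero n (sub_ne_zero.2 ht1)) h1)
  have h2 : t = ((t - 1) ^ n - v) / u + 1 := by
    rw [e1]
    field_simp
    ring
  rw [h2]
  exact E.add_mem (E.div_mem (E.sub_mem hpow hv) hu) E.one_mem

variable {K : Type*} [Field K]

/-- The parametrization of the affine cone over the bicuspidal curve. -/
noncomputable def bicuspidalConeParam (K : Type*) [Field K] (n : ℕ) :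
    MvPolynomial (Fin 3) K →ₐ[K] Polynomial (Polynomial K) :=
  aeval fun i => Polynomial.X * Polynomial.C (bicuspidalParam K n i)

lemma bicuspidalConeParam_apply {n k : ℕ} {F : MvPolynomial (Fin 3) K} (hF : F.IsHomogeneous k) :
    bicuspidalConeParam K n F =
      Polynomial.X ^ k * Polynomial.C (aeval (bicuspidalParam K n) F) := by
  rw [bicuspidalConeParam, hF.aeval_mul]
  congr 1
  exact (comp_aeval_apply (bicuspidalParam K n)
    (IsScalarTower.toAlgHom K (Polynomial K) (Polynomial (Polynomial K))) F).symm

lemma nonempty_homogeneousFractions_algEquiv {R M : Type*} [CommRing R] [IsDomain R] [Algebra K R]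
    [Field M] [Algebra K M] {𝒜 : ℕ → Submodule K R} {Φ₀ : R →ₐ[K] M} (hΦ₀ : Function.Injective Φ₀)
    {t : M} (ht : Transcendental K t)
    (h1 : ∀ k, ∀ a ∈ 𝒜 k, ∀ b ∈ 𝒜 k, b ≠ 0 → Φ₀ a / Φ₀ b ∈ IntermediateField.adjoin K {t})
    (h2 : ∀ E : IntermediateField K M,
      (∀ k, ∀ a ∈ 𝒜 k, ∀ b ∈ 𝒜 k, b ≠ 0 → Φ₀ a / Φ₀ b ∈ E) → t ∈ E) :
    Nonempty (homogeneousFractions 𝒜 ≃ₐ[K] RatFunc K) := by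
  let Φ : FractionRing R →ₐ[K] M := IsFractionRing.liftAlgHom hΦ₀
  have hΦ : ∀ a, Φ (algebraMap R _ a) = Φ₀ a := fun a =>
    IsFractionRing.lift_algebraMap (g := Φ₀.toRingHom) hΦ₀ a
  have hmap : (homogeneousFractions 𝒜).map Φ = IntermediateField.adjoin K {t} := by
    rw [homogeneousFractions, IntermediateField.adjoin_map]
    apply le_antisymm
    · rw [IntermediateField.adjoin_le_iff]
      rintro _ ⟨_, ⟨k, a, ha, b, hb, hb0, rfl⟩, rfl⟩
      rw [map_div₀, hΦ, hΦ]
      exact h1 k a ha b hb hb0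
    · rw [IntermediateField.adjoin_le_iff, Set.singleton_subset_iff]
      refine h2 _ fun k a ha b hb hb0 => IntermediateField.subset_adjoin _ _ ?_
      exact ⟨_, ⟨k, a, ha, b, hb, hb0, rfl⟩, by rw [map_div₀, hΦ, hΦ]⟩
  exact ⟨(IntermediateField.equivMap _ Φ).trans ((IntermediateField.equivOfEq hmap).trans
    (RatFunc.algEquivOfTranscendental t ht).symm)⟩

variable [IsAlgClosed K]

/-- The additional scaling variable separates degrees, which reduces the kernel to its homogeneous
elements. -/
lemma bicuspidalConeParam_eq_zero_iff {n : ℕ} (hn : n ≠ 0) {f : MvPolynomial (Fin 3) K} {c : K}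
    (hc : c ≠ 0) (hf : f = C c * bicuspidalForm K n) (F : MvPolynomial (Fin 3) K) :
    bicuspidalConeParam K n F = 0 ↔ f ∣ F := by
  have hff : f ∣ bicuspidalForm K n := ⟨C c⁻¹, by
    rw [hf, mul_comm, ← mul_assoc, ← C_mul, inv_mul_cancel₀ hc, C_1, one_mul]⟩
  constructor
  · intro h
    refine hff.trans ?_
    rw [← sum_homogeneousComponent F, map_sum, Finset.sum_congr rfl fun k _ =>
      bicuspidalConeParam_apply (homogeneousComponent_isHomogeneous k F)] at h
    rw [← sum_homogeneousComponent F]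
    refine Finset.dvd_sum fun k hk => bicuspidalForm_dvd hn
      (homogeneousComponent_isHomogeneous k F) ?_
    have h1 := congrArg (fun P => Polynomial.coeff P k) h
    simpa only [Polynomial.finsetSum_coeff, Polynomial.X_pow_mul_C, Polynomial.coeff_C_mul_X_pow,
      Finset.sum_ite_eq, if_pos hk, Polynomial.coeff_zero] using h1
  · rintro ⟨s, rfl⟩
    rw [map_mul, hf, map_mul, bicuspidalConeParam_apply (bicuspidalForm_isHomogeneous K n),
      aeval_bicuspidalParam]
    simp

lemma isIntegralRationalCurve_of_isFractionRing {M : Type*} [Field M] [Algebra K M]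
    [Algebra (Polynomial (Polynomial K)) M] [IsFractionRing (Polynomial (Polynomial K)) M]
    [IsScalarTower K (Polynomial (Polynomial K)) M] {n : ℕ} (hn : n ≠ 0)
    {f : MvPolynomial (Fin 3) K} {c : K} (hc : c ≠ 0) (hf : f = C c * bicuspidalForm K n) :
    IsIntegralRationalCurve f := by
  let ψ : Polynomial (Polynomial K) →ₐ[K] M := IsScalarTower.toAlgHom K _ M
  have hψ : Function.Injective ψ := IsFractionRing.injective (Polynomial (Polynomial K)) M
  let ι : Polynomial K →ₐ[K] M :=
    ψ.comp (IsScalarTower.toAlgHom K (Polynomial K) (Polynomial (Polynomial K)))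
  have hι : Function.Injective ι := hψ.comp Polynomial.C_injective
  let φ : MvPolynomial (Fin 3) K →ₐ[K] M := ψ.comp (bicuspidalConeParam K n)
  have hφ0 : ∀ F, φ F = 0 ↔ f ∣ F := by
    intro F
    rw [← bicuspidalConeParam_eq_zero_iff hn hc hf]
    exact map_eq_zero_iff ψ hψ
  have hφh : ∀ {k : ℕ} {F : MvPolynomial (Fin 3) K}, F.IsHomogeneous k →
      φ F = ψ Polynomial.X ^ k * ι (aeval (bicuspidalParam K n) F) := by
    intro k F hF
    change ψ (bicuspidalConeParam K n F) = _
    rw [bicuspidalConeParam_apply hF, map_mul, map_pow]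
    rfl
  have hT : ψ Polynomial.X ≠ 0 := by
    rw [Ne, map_eq_zero_iff ψ hψ]
    exact Polynomial.X_ne_zero
  let Φ₀ : ConeRing f →ₐ[K] M := Ideal.Quotient.liftₐ (Ideal.span {f}) φ (by
    intro a ha
    exact (hφ0 a).2 (Ideal.mem_span_singleton.1 ha))
  have hΦ₀mk : ∀ F, Φ₀ (Ideal.Quotient.mk _ F) = φ F := fun F => Ideal.Quotient.lift_mk _ _ _
  have hΦ₀ : Function.Injective Φ₀ := by
    rw [injective_iff_map_eq_zero]
    intro a ha
    obtain ⟨F, rfl⟩ := Ideal.Quotient.mk_surjective a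
    rw [hΦ₀mk, hφ0] at ha
    exact Ideal.Quotient.eq_zero_iff_mem.2 (Ideal.mem_span_singleton.2 ha)
  have hdom : IsDomain (ConeRing f) := Function.Injective.isDomain Φ₀.toRingHom hΦ₀
  have hιX : ∀ P : Polynomial K, ι P = Polynomial.aeval (ι Polynomial.X) P := by
    intro P
    rw [Polynomial.aeval_algHom_apply, Polynomial.aeval_X_left_apply]
  have hmem : ∀ (k : ℕ) (F : MvPolynomial (Fin 3) K), F.IsHomogeneous k →
      Ideal.Quotient.mk (Ideal.span {f}) F ∈ coneGrading f k := fun k F hF => ⟨F, hF, rfl⟩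
  have hιV : ∀ i, ι (bicuspidalParam K n i) ≠ 0 → ∀ j, ∀ E : IntermediateField K M,
      (∀ k, ∀ a ∈ coneGrading f k, ∀ b ∈ coneGrading f k, b ≠ 0 → Φ₀ a / Φ₀ b ∈ E) →
      ι (bicuspidalParam K n j) / ι (bicuspidalParam K n i) ∈ E := by
    intro i hi j E hE
    have hX : ∀ l, φ (X l) = ψ Polynomial.X * ι (bicuspidalParam K n l) := by
      intro l
      rw [hφh (isHomogeneous_X K l), pow_one, aeval_X]
    have h1 := hE 1 _ (hmem 1 _ (isHomogeneous_X K j)) _ (hmem 1 _ (isHomogeneous_X K i)) (by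
      intro h
      have h2 := hΦ₀mk (X i)
      rw [h, map_zero, hX] at h2
      exact mul_ne_zero hT hi h2.symm)
    rwa [hΦ₀mk, hΦ₀mk, hX, hX, mul_div_mul_left _ _ hT] at h1
  refine ⟨hdom, nonempty_homogeneousFractions_algEquiv hΦ₀ (t := ι Polynomial.X) ?_ ?_ ?_⟩
  · rw [transcendental_iff]
    intro P hP
    rw [← hιX, map_eq_zero_iff ι hι] at hP
    exact hP
  · rintro k _ ⟨F, hF, rfl⟩ _ ⟨G, hG, rfl⟩ -
    have hin : ∀ P : Polynomial K, ι P ∈ IntermediateField.adjoin K {ι Polynomial.X} := by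
      intro P
      rw [hιX P]
      exact IntermediateField.algebra_adjoin_le_adjoin K _
        (Polynomial.aeval_mem_adjoin_singleton K _)
    change Φ₀ (Ideal.Quotient.mk _ F) / Φ₀ (Ideal.Quotient.mk _ G) ∈ _
    rw [hΦ₀mk, hΦ₀mk, hφh hF, hφh hG, mul_div_mul_left _ _ (pow_ne_zero k hT)]
    exact div_mem (hin _) (hin _)
  · intro E hE
    have h0 : ι Polynomial.X ≠ 0 := by
      rw [Ne, map_eq_zero_iff ι hι]
      exact Polynomial.X_ne_zero
    have hm1 : ι (Polynomial.X + 1) ≠ 0 := by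
      rw [Ne, map_eq_zero_iff ι hι]
      exact Polynomial.X_add_C_ne_zero 1
    have e1 := hιV 1 h0 0 E hE
    have e2 := hιV 0 (by
      rw [show bicuspidalParam K n 0 = (Polynomial.X + 1) ^ 2 from rfl, map_pow]
      exact pow_ne_zero 2 hm1) 2 E hE
    -- Ratios of coordinates give `(w + 1)² / w` and `(w - 1) ^ n`; subtracting `4` from the first
    -- gives `(w - 1)² / w`.
    refine mem_of_quadratic E h0 ?_ ?_ (E.sub_mem e1 (ofNat_mem E 4)) ?_ ?_ (n := n)
    · rw [← map_one ι]
      exact fun h => Polynomial.X_ne_C 1 (hι h)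
    · rw [← map_one ι, ← map_neg, ← map_pow, ← map_pow]
      intro h
      have h1 := congrArg Polynomial.natDegree (hι h)
      rw [Polynomial.natDegree_X_pow, ← Polynomial.C_1, ← Polynomial.C_neg, ← Polynomial.C_pow,
        Polynomial.natDegree_C] at h1
      exact hn h1
    · change _ = (ι ((Polynomial.X + 1) ^ 2) / ι Polynomial.X - 4) * ι Polynomial.X
      rw [sub_mul, div_mul_cancel₀ _ h0, map_pow, map_add, map_one]
      ring
    · have h1 : (ι Polynomial.X - 1) ^ n =
          ι (bicuspidalParam K n 2) / ι (bicuspidalParam K n 0) := by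
        change _ = ι ((Polynomial.X + 1) ^ 2 * (Polynomial.X - 1) ^ n) /
          ι ((Polynomial.X + 1) ^ 2)
        rw [map_mul, mul_div_cancel_left₀, map_pow, map_sub, map_one]
        rw [map_pow]
        exact pow_ne_zero 2 hm1
      rw [h1]
      exact e2

theorem isIntegralRationalCurve_bicuspidalForm {n : ℕ} (hn : n ≠ 0) {f : MvPolynomial (Fin 3) K}
    {c : K} (hc : c ≠ 0) (hf : f = C c * bicuspidalForm K n) : IsIntegralRationalCurve f :=
  isIntegralRationalCurve_of_isFractionRing (M := FractionRing (Polynomial (Polynomial K))) hn hc hf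

end Rationality


/-! ### Zariski closures -/

section Closure

variable {K E : Type*} [Field K] [AddCommGroup E] [Module K E]

variable (K) in
/-- The Zariski closure of a subset of a vector space. -/
def zariskiClosure (W : Set E) : Set E :=
  {v | ∀ P : MvPolynomial (Module.Dual K E) K,
    (∀ w ∈ W, eval (fun φ : Module.Dual K E => φ w) P = 0) →
      eval (fun φ : Module.Dual K E => φ v) P = 0}

lemma isZariskiClosed_zariskiClosure (W : Set E) : IsZariskiClosed K (zariskiClosure K W) :=
  ⟨{P | ∀ w ∈ W, eval (fun φ : Module.Dual K E => φ w) P = 0}, rfl⟩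

lemma subset_zariskiClosure (W : Set E) : W ⊆ zariskiClosure K W :=
  fun w hw _ hP => hP w hw

lemma map_mem_zariskiClosure {W : Set E} (T : E →ₗ[K] E) (hT : ∀ w ∈ W, T w ∈ W) {v : E}
    (hv : v ∈ zariskiClosure K W) : T v ∈ zariskiClosure K W := by
  intro P hP
  have key : ∀ w, eval (fun φ : Module.Dual K E => φ w) (rename (fun φ => φ ∘ₗ T) P) =
      eval (fun φ : Module.Dual K E => φ (T w)) P := by
    intro w
    rw [eval_rename]
    rfl
  rw [← key]
  exact hv _ fun w hw => by rw [key]; exact hP _ (hT w hw)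

lemma smul_mem_zariskiClosure {W : Set E} {c : K} (hc : ∀ w ∈ W, c • w ∈ W) {v : E}
    (hv : v ∈ zariskiClosure K W) : c • v ∈ zariskiClosure K W := by
  have h : ∀ w, LinearMap.lsmul K E c w = c • w := fun w => rfl
  rw [← h]
  exact map_mem_zariskiClosure _ (fun w hw => by rw [h]; exact hc w hw) hv

end Closure

lemma map_eval_eq_eval_map {A B σ : Type*} [CommSemiring A] [CommSemiring B] (φ : A →+* B)
    (q : σ → A) (P : MvPolynomial σ A) : φ (eval q P) = eval (fun i => φ (q i)) (map φ P) := by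
  rw [eval_map, eval, coe_eval₂Hom, eval₂_comp_left]
  rfl

/-! ### Rational plane curves -/

section PlaneCurves

variable {K : Type*} [Field K]

/-- The point has coordinates `p i` with `x i` congruent to `p i • z` modulo `H`. They are not all
zero, since `z` is a combination of the `x i` outside `H`. -/
lemma HasOnePointSection.exists_point {R : Type*} [CommRing R] [Algebra K R]
    {𝒜 : ℕ → Submodule K R} {x : Fin 3 → R} (hx : IsGradedBy 𝒜 x) {k M : ℕ}
    (h : HasOnePointSection 𝒜 k M) : ∃ F ∈ 𝒜 k, F ≠ 0 ∧ ∃ p : Fin 3 → K, p ≠ 0 ∧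
      ∀ i j, ∃ G ∈ 𝒜 M, (p j • x i - p i • x j) ^ (k + M) = F * G := by
  obtain ⟨F, hF, hF0, H, z, hz, hzH, hH, hpow⟩ := h
  choose p hp using fun i => hH (x i) (hx.X_mem i)
  refine ⟨F, hF, hF0, p, ?_, fun i j => hpow _ ?_ ?_⟩
  · rintro rfl
    obtain ⟨l, hl, rfl⟩ := (hx.mem_iff 1 z).1 hz
    refine hzH ?_
    rw [← mem_homogeneousSubmodule, homogeneousSubmodule_one_eq_span_X] at hl
    have h1 : Submodule.span K (Set.range X) ≤
        H.comap (aeval x : MvPolynomial (Fin 3) K →ₐ[K] R).toLinearMap := by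
      rw [Submodule.span_le]
      rintro _ ⟨i, rfl⟩
      simpa using hp i
    exact h1 hl
  · exact (𝒜 1).sub_mem ((𝒜 1).smul_mem _ (hx.X_mem i)) ((𝒜 1).smul_mem _ (hx.X_mem j))
  · have h1 : p j • x i - p i • x j = p j • (x i - p i • z) - p i • (x j - p j • z) := by
      rw [smul_sub, smul_sub, smul_smul, smul_smul, mul_comm (p i) (p j)]
      abel
    rw [h1]
    exact H.sub_mem (H.smul_mem _ (hp i)) (H.smul_mem _ (hp j))

/-- Some form `F` of degree `k` that does not vanish on the curve `f = 0` meets it in at most one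
point, with bounded certificates. -/
def IsOnePointForm (k M : ℕ) (f : MvPolynomial (Fin 3) K) : Prop :=
  ∃ (F : MvPolynomial (Fin 3) K) (p : Fin 3 → K) (G a : Fin 3 → Fin 3 → MvPolynomial (Fin 3) K)
    (q : Fin 3 → K), F.IsHomogeneous k ∧ p ≠ 0 ∧ (∀ i j, (G i j).IsHomogeneous M) ∧
    (∀ i j, (a i j).totalDegree ≤ k + M) ∧
    (∀ i j, (C (p j) * X i - C (p i) * X j) ^ (k + M) = F * G i j + f * a i j) ∧
    eval q f = 0 ∧ eval q F ≠ 0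

lemma IsOnePointForm.const_mul {k M : ℕ} {f : MvPolynomial (Fin 3) K} (h : IsOnePointForm k M f)
    {c : K} (hc : c ≠ 0) : IsOnePointForm k M (C c * f) := by
  obtain ⟨F, p, G, a, q, hF, hp, hG, ha, heq, hq, hqF⟩ := h
  refine ⟨F, p, G, fun i j => C c⁻¹ * a i j, q, hF, hp, hG, fun i j => ?_, fun i j => ?_, ?_, hqF⟩
  · exact (totalDegree_mul _ _).trans (by simpa using ha i j)
  · have : (C c * C c⁻¹ : MvPolynomial (Fin 3) K) = 1 := by
      rw [← C_mul, mul_inv_cancel₀ hc, C_1]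
    rw [heq]
    linear_combination (- f * a i j) * this
  · rw [map_mul, hq, mul_zero]

/-- By the Nullstellensatz, nonvanishing of `F` modulo the prime `f` is witnessed by a point `q`, a
condition that passes to the generic point. Homogeneity bounds the degree of the cofactor of `f`. -/
lemma isOnePointForm_of_hasOnePointSection [IsAlgClosed K] {k M : ℕ} {f : MvPolynomial (Fin 3) K}
    (hf0 : f ≠ 0) [hdom : IsDomain (ConeRing f)] (h : HasOnePointSection (coneGrading f) k M) :
    IsOnePointForm k M f := by
  obtain ⟨_, ⟨F, hF, rfl⟩, hF0, p, hp, hG⟩ := h.exists_point (isGradedBy_coneGrading f)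
  have hpr : (Ideal.span {f}).IsPrime := Ideal.Quotient.isDomain_iff_prime _ |>.1 hdom
  obtain ⟨q, hq, hqF⟩ : ∃ q : Fin 3 → K, eval q f = 0 ∧ eval q F ≠ 0 := by
    by_contra! hcon
    refine hF0 (Ideal.Quotient.eq_zero_iff_mem.2 ?_)
    rw [← hpr.radical, ← vanishingIdeal_zeroLocus_eq_radical (K := K), mem_vanishingIdeal_iff]
    intro q hq
    exact hcon q (mem_zeroLocus_iff.1 hq f (Ideal.mem_span_singleton_self f))
  have hex : ∀ i j, ∃ G a : MvPolynomial (Fin 3) K, G.IsHomogeneous M ∧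
      a.totalDegree ≤ k + M ∧
      (C (p j) * X i - C (p i) * X j) ^ (k + M) = F * G + f * a := by
    intro i j
    obtain ⟨_, ⟨G, hGM, rfl⟩, he⟩ := hG i j
    have hu : ((C (p j) * X i - C (p i) * X j : MvPolynomial (Fin 3) K) ^ (k + M)).IsHomogeneous
        (k + M) := by
      have := ((isHomogeneous_C_mul_X (p j) i).sub (isHomogeneous_C_mul_X (p i) j)).pow (k + M)
      rwa [one_mul] at this
    have hmem : (C (p j) * X i - C (p i) * X j) ^ (k + M) - F * G ∈ Ideal.span {f} := by
      rw [← Ideal.Quotient.eq]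
      have e1 : ∀ i, Ideal.Quotient.mk (Ideal.span {f}) (C (p i)) =
        algebraMap K (ConeRing f) (p i) := fun i => rfl
      rw [map_pow, map_sub, map_mul, map_mul, map_mul, e1, e1, ← Algebra.smul_def,
        ← Algebra.smul_def]
      exact he
    obtain ⟨a, ha⟩ := Ideal.mem_span_singleton.1 hmem
    refine ⟨G, a, hGM, ?_, by rw [← ha]; ring⟩
    by_cases ha0 : a = 0
    · rw [ha0, totalDegree_zero]
      exact Nat.zero_le _
    · have h1 := totalDegree_mul_of_isDomain hf0 ha0
      rw [← ha] at h1
      have h2 := (hu.sub (hF.mul hGM)).totalDegree_le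
      omega
  choose G a hGM ha he using hex
  exact ⟨F, p, G, a, q, hF, hp, hGM, ha, he, hq, hqF⟩

lemma exists_ne_zero_eval_eq_zero [IsAlgClosed K] {f : MvPolynomial (Fin 3) K} {d : ℕ}
    (hd : 0 < d) (hf : f.IsHomogeneous d) : ∃ q : Fin 3 → K, q ≠ 0 ∧ eval q f = 0 := by
  let V : Fin 3 → Polynomial K := ![1, Polynomial.X, 0]
  obtain ⟨-, h1⟩ := coeff_aeval_of_natDegree_le (d := 1) hf (V := V) (by
    intro i
    fin_cases i <;> simp [V])
  by_cases h : (aeval V f).coeff (d * 1) = 0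
  · rw [h] at h1
    refine ⟨_, ?_, h1.symm⟩
    exact fun h0 => by simpa [V] using congrFun h0 1
  · have hdeg : (aeval V f).degree ≠ 0 := by
      intro h2
      rw [Polynomial.eq_C_of_degree_eq_zero h2, Polynomial.coeff_C, if_neg (by omega)] at h
      exact h rfl
    obtain ⟨t, ht⟩ := IsAlgClosed.exists_root _ hdeg
    rw [Polynomial.IsRoot, aeval_polynomial_eval] at ht
    exact ⟨_, fun h0 => by simpa [V] using congrFun h0 0, ht⟩

variable [CharZero K]

lemma exists_map_eq_and_map_eq {A B O 𝓕 Ω σ : Type*} [CommRing A] [CommRing B] [CommRing O]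
    [Field 𝓕] [Field Ω] [Algebra O 𝓕] (hinj : Function.Injective (algebraMap O 𝓕)) (π : A →+* 𝓕)
    (res : O →+* Ω) (τ : B →+* Ω) {P : MvPolynomial σ A} {P₀ : MvPolynomial σ B}
    (h : ∀ m, ∃ x : O, algebraMap O 𝓕 x = π (coeff m P) ∧ res x = τ (coeff m P₀)) :
    ∃ Q : MvPolynomial σ O, map (algebraMap O 𝓕) Q = map π P ∧ map res Q = map τ P₀ := by
  have h1 : map π P ∈ Set.range (map (σ := σ) (algebraMap O 𝓕)) := by
    rw [mem_range_map_iff_coeffs_subset]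
    intro y hy
    obtain ⟨m, -, rfl⟩ := mem_coeffs_iff.1 hy
    obtain ⟨x, hx, -⟩ := h m
    exact ⟨x, by rw [hx, coeff_map]⟩
  obtain ⟨Q, hQ⟩ := h1
  refine ⟨Q, hQ, ?_⟩
  ext m
  obtain ⟨x, hx, hx'⟩ := h m
  rw [coeff_map, coeff_map, ← hx']
  congr 1
  apply hinj
  rw [hx, ← coeff_map, hQ, coeff_map]

/-- Otherwise the bicuspidal curve would be a specialization of the family of curves with
certificates. Assembled over `B → K` and pushed to `𝓕`, the certificates would contradict
`false_of_specializes_bicuspidal`. -/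
theorem bicuspidalForm_notMem_zariskiClosure {n : ℕ} (hn : 2 ≤ n) {k : ℕ} (hk : 0 < k) (M : ℕ) :
    (⟨bicuspidalForm K n, bicuspidalForm_isHomogeneous K n⟩ :
      homogeneousSubmodule (Fin 3) K (n + 2)) ∉
      zariskiClosure K {f : homogeneousSubmodule (Fin 3) K (n + 2) |
        IsOnePointForm k M (f : MvPolynomial (Fin 3) K)} := by
  intro hmem
  let B := {f : homogeneousSubmodule (Fin 3) K (n + 2) //
    IsOnePointForm k M (f : MvPolynomial (Fin 3) K)}
  choose F p G a q hF hp hG ha heq hq hqF using fun b : B => b.2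
  obtain ⟨𝓕, _, π, O, Ω, _, _, τ, res, _, hspec⟩ := exists_specialization
    (fun (b : B) (φ : Module.Dual K (homogeneousSubmodule (Fin 3) K (n + 2))) => φ b.1)
    (fun φ => φ ⟨bicuspidalForm K n, bicuspidalForm_isHomogeneous K n⟩)
    (fun Q hQ => hmem Q fun w hw => hQ ⟨w, hw⟩)
  have : CharZero Ω := charZero_of_injective_ringHom τ.injective
  obtain ⟨f', hf'⟩ := exists_mvPolynomial_pi (fun b : B => (b.1 : MvPolynomial (Fin 3) K))
    (fun b => IsHomogeneous.totalDegree_le b.1.2)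
  obtain ⟨F', hF'⟩ := exists_mvPolynomial_pi F fun b => (hF b).totalDegree_le
  choose G' hG' using fun i j => exists_mvPolynomial_pi (fun b => G b i j)
    fun b => (hG b i j).totalDegree_le
  choose a' ha' using fun i j => exists_mvPolynomial_pi (fun b => a b i j) fun b => ha b i j
  have hinj : Function.Injective (algebraMap O 𝓕) := Subtype.val_injective
  obtain ⟨f₁, hf₁, hf₁res⟩ := exists_map_eq_and_map_eq hinj π res τ (P := f')
    (P₀ := bicuspidalForm K n) (by
      intro m
      let φ : Module.Dual K (homogeneousSubmodule (Fin 3) K (n + 2)) :=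
        (lcoeff K m) ∘ₗ (homogeneousSubmodule (Fin 3) K (n + 2)).subtype
      obtain ⟨h1, h2⟩ := hspec (X φ)
      simp only [eval_X] at h1 h2
      have h3 : (fun b : B => φ b.1) = coeff m f' := funext fun b => (hf' m b).symm
      exact ⟨⟨_, h1⟩, congrArg π h3, h2⟩)
  rw [map_bicuspidalForm] at hf₁res
  have hf₁hom : f₁.IsHomogeneous (n + 2) := by
    refine isHomogeneous_of_map _ hinj ?_
    rw [hf₁]
    exact (isHomogeneous_of_coeff hf' fun b => b.1.2).map π
  -- This coefficient reduces to `(-1) ^ n`, so dividing by it makes the integral equation monic in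
  -- `X 0`.
  have hunit : IsUnit (coeff (Finsupp.single 0 (n + 2)) f₁) := by
    refine isUnit_of_map_unit res _ ?_
    rw [← coeff_map, hf₁res, coeff_bicuspidalForm (by omega)]
    exact isUnit_one.neg.pow n
  obtain ⟨u, hu⟩ := hunit
  have huC : (C (u : O) * C (↑u⁻¹ : O) : MvPolynomial (Fin 3) O) = 1 := by
    rw [← C_mul, Units.mul_inv, C_1]
  have huC' := congrArg (map (algebraMap O 𝓕)) huC
  rw [map_mul, map_one] at huC'
  -- the identities over the generic point
  let p' : Fin 3 → B → K := fun i b => p b i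
  let q' : Fin 3 → B → K := fun i b => q b i
  have heq' : ∀ i j, (C (p' j) * X i - C (p' i) * X j) ^ (k + M) =
      F' * G' i j + f' * a' i j := by
    intro i j
    refine mvPolynomial_pi_ext fun b => ?_
    simp only [map_pow, map_sub, map_mul, map_add, map_C, map_X, map_evalRingHom_eq hF',
      map_evalRingHom_eq hf', map_evalRingHom_eq (hG' i j), map_evalRingHom_eq (ha' i j)]
    exact heq b i j
  have hev : ∀ (P' : MvPolynomial (Fin 3) (B → K)) (P : B → MvPolynomial (Fin 3) K),
      (∀ m b, coeff m P' b = coeff m (P b)) → ∀ b, eval q' P' b = eval (q b) (P b) := by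
    intro P' P hP b
    rw [← map_evalRingHom_eq hP b]
    exact map_eval_eq_eval_map (Pi.evalRingHom (fun _ : B => K) b) q' P'
  have hqf' : eval q' f' = 0 := by
    funext b
    rw [hev f' (fun b => b.1) hf' b, hq b, Pi.zero_apply]
  refine false_of_specializes_bicuspidal hn res (f := C (↑u⁻¹ : O) * f₁) (c := res (↑u⁻¹ : O))
    (k := k) (M := M) (N := k + M) (r := map π F') (p := fun i => π (p' i))
    ?_ ?_ ?_ hk ?_ ?_ ?_ (fun i j => map (algebraMap O 𝓕) (C (u : O)) * map π (a' i j))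
    (fun i j => map π (G' i j)) ?_ ?_
  · have := (isHomogeneous_C (Fin 3) (↑u⁻¹ : O)).mul hf₁hom
    rwa [zero_add] at this
  · rw [coeff_C_mul, ← hu, Units.inv_mul]
  · rw [map_mul, map_C, hf₁res]
  · exact (isHomogeneous_of_coeff hF' hF).map π
  · rintro ⟨s, hs⟩
    have h1 := congrArg (eval fun i => π (q' i)) hs
    rw [map_mul, map_mul, hf₁, map_mul, ← map_eval_eq_eval_map, ← map_eval_eq_eval_map,
      hqf', map_zero, mul_zero,
      zero_mul] at h1
    obtain ⟨-, h2⟩ := exists_map_ne_zero π (fun _ : Unit => eval q' F') fun b =>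
      ⟨(), by rw [hev F' F hF' b]; exact hqF b⟩
    exact h2 h1
  · obtain ⟨i, hi⟩ := exists_map_ne_zero π p' fun b => Function.ne_iff.1 (hp b)
    exact fun h0 => hi (congrFun h0 i)
  · exact fun i j => (isHomogeneous_of_coeff (hG' i j) fun b => hG b i j).map π
  · intro i j
    have h1 := congrArg (map π) (heq' i j)
    simp only [map_pow, map_sub, map_mul, map_add, map_C, map_X] at h1
    rw [h1, map_mul, hf₁]
    linear_combination (- map π f' * map π (a' i j)) * huC'

variable [IsAlgClosed K]

theorem holdsVeryGenerally_coneGrading {n : ℕ} (hn : 2 ≤ n) :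
    HoldsVeryGenerally (IsClosedInProjectiveSpace K) (integralRationalPlaneCurves K (n + 2))
      (fun Y => NoKhovanskiiFiniteValuation.{w} (coneGrading (definingForm Y))) := by
  let W : ℕ → ℕ → Set (homogeneousSubmodule (Fin 3) K (n + 2)) := fun k M =>
    {f | IsOnePointForm k M (f : MvPolynomial (Fin 3) K)}
  have hinv : ∀ k M (c : K), c ≠ 0 → ∀ v ∈ zariskiClosure K (W k M),
      c • v ∈ zariskiClosure K (W k M) := by
    intro k M c hc v hv
    refine smul_mem_zariskiClosure (fun f hf => ?_) hv
    have h1 := IsOnePointForm.const_mul hf hc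
    rw [← smul_eq_C_mul] at h1
    exact h1
  have hrep : ∀ k M (v : homogeneousSubmodule (Fin 3) K (n + 2)) (hv : v ≠ 0),
      v ∈ zariskiClosure K (W k M) ↔
        (Projectivization.mk K v hv).rep ∈ zariskiClosure K (W k M) := by
    intro k M v hv
    obtain ⟨c, hc⟩ := Projectivization.exists_smul_eq_mk_rep K v hv
    rw [← hc]
    refine ⟨hinv k M _ c.ne_zero v, fun h => ?_⟩
    have := hinv k M _ (c⁻¹).ne_zero _ h
    rwa [Units.smul_def, smul_smul, Units.inv_mul, one_smul] at this
  -- One closed set for each pair `(k, M)`, with a shift by one because `k` is positive. Invariance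
  -- under scaling lets it descend to projective space.
  refine ⟨fun i => {Y | Y.rep ∈ zariskiClosure K (W (i.unpair.1 + 1) i.unpair.2)},
    fun i => ⟨⟨_, isZariskiClosed_zariskiClosure _, fun v hv => hrep _ _ v hv⟩, fun hsub => ?_⟩,
    fun Y hY hYZ => ?_⟩
  · let f₀ : homogeneousSubmodule (Fin 3) K (n + 2) :=
      ⟨bicuspidalForm K n, bicuspidalForm_isHomogeneous K n⟩
    have hf₀ : f₀ ≠ 0 := by
      intro h
      have h1 := congrArg (coeff (Finsupp.single 0 (n + 2)))
        (show bicuspidalForm K n = 0 from congrArg Subtype.val h)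
      rw [coeff_bicuspidalForm (by omega), coeff_zero] at h1
      exact pow_ne_zero n (neg_ne_zero.2 one_ne_zero) h1
    refine bicuspidalForm_notMem_zariskiClosure (K := K) hn (Nat.succ_pos i.unpair.1) i.unpair.2
      ((hrep _ _ f₀ hf₀).2 (hsub ?_))
    obtain ⟨c, hc⟩ := Projectivization.exists_smul_eq_mk_rep K f₀ hf₀
    refine isIntegralRationalCurve_bicuspidalForm (n := n) (by omega) c.ne_zero ?_
    rw [definingForm, ← hc, ← smul_eq_C_mul]
    rfl
  · obtain ⟨hdom, -⟩ := hY
    have hhom : (definingForm Y).IsHomogeneous (n + 2) := Y.rep.2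
    have hne : definingForm Y ≠ 0 := fun h => Y.rep_nonzero (Subtype.ext h)
    obtain ⟨q, hq, hqf⟩ := exists_ne_zero_eval_eq_zero (by omega) hhom
    refine noKhovanskiiFiniteValuation_of_forall (isGradedBy_coneGrading _)
      (not_algebraicIndependent_coneRing hne)
      (two_le_ringKrullDim_coneRing (by omega) hhom hne hq hqf) fun k M hk h => ?_
    refine hYZ (Nat.pair (k - 1) M) ?_
    change Y.rep ∈ zariskiClosure K (W _ _)
    rw [Nat.unpair_pair, Nat.sub_add_cancel hk]
    exact subset_zariskiClosure _ (isOnePointForm_of_hasOnePointSection (f := definingForm Y) hne h)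

end PlaneCurves


/-! ### Linear systems on the projective line -/

section Dehomogenization

variable (K : Type*) [Field K]

/-- Dehomogenization of binary forms. -/
noncomputable def dehomogenize : MvPolynomial (Fin 2) K →ₐ[K] Polynomial K :=
  aeval ![Polynomial.X, 1]

variable {K}

lemma eq_zero_of_dehomogenize_eq_zero {P : MvPolynomial (Fin 2) K} {m : ℕ}
    (hP : P.IsHomogeneous m) (h : dehomogenize K P = 0) : P = 0 := by
  rw [← Polynomial.homogenize_eq_of_isHomogeneous hP rfl]
  change (dehomogenize K P).homogenize m = 0
  rw [h, Polynomial.homogenize_zero]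

lemma natDegree_dehomogenize_le {P : MvPolynomial (Fin 2) K} {m : ℕ} (hP : P.IsHomogeneous m) :
    (dehomogenize K P).natDegree ≤ m := by
  rw [dehomogenize, aeval_def, eval₂_eq']
  refine Polynomial.natDegree_sum_le_of_forall_le _ _ fun e he => ?_
  have h1 : e 0 + e 1 = m := by
    have := hP (mem_support_iff.1 he)
    simpa [Finsupp.weight_apply, Finsupp.sum_fintype, Fin.sum_univ_two] using this
  rw [Polynomial.algebraMap_eq, Fin.prod_univ_two]
  refine (Polynomial.natDegree_C_mul_le _ _).trans ?_
  simp only [Matrix.cons_val_zero, Matrix.cons_val_one, one_pow, mul_one]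
  exact (Polynomial.natDegree_X_pow_le _).trans (by omega)

lemma dehomogenize_aeval {σ : Type*} (v : σ → MvPolynomial (Fin 2) K) (F : MvPolynomial σ K) :
    dehomogenize K (aeval v F) = aeval (fun i => dehomogenize K (v i)) F :=
  comp_aeval_apply v (dehomogenize K) F

/-- The binary forms that parametrize the bicuspidal curve. -/
noncomputable def bicuspidalTuple (K : Type*) [Field K] (n : ℕ) (i : Fin 3) :
    BinaryForms K (n + 2) :=
  ⟨(bicuspidalParam K n i).homogenize (n + 2), Polynomial.isHomogeneous_homogenize _⟩

lemma dehomogenize_bicuspidalTuple (n : ℕ) (i : Fin 3) :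
    dehomogenize K (bicuspidalTuple K n i : MvPolynomial (Fin 2) K) = bicuspidalParam K n i :=
  Polynomial.aeval_homogenize_X_one _ (natDegree_bicuspidalParam_le n i)

lemma linearIndependent_bicuspidalTuple {n : ℕ} (hn : n ≠ 0) :
    LinearIndependent K (bicuspidalTuple K n) := by
  rw [Fintype.linearIndependent_iff]
  intro g hg
  have h1 : ∑ i, Polynomial.C (g i) * bicuspidalParam K n i = 0 := by
    have := congrArg (fun P : BinaryForms K (n + 2) =>
      dehomogenize K (P : MvPolynomial (Fin 2) K)) hg
    simpa [dehomogenize_bicuspidalTuple, Polynomial.smul_eq_C_mul, Fin.sum_univ_three] using this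
  rw [Fin.sum_univ_three] at h1
  have hc := fun i => congrFun (coeff_bicuspidalParam (Ω := K) hn) i
  have h2 : g 2 = 0 := by
    have := congrArg (fun P => Polynomial.coeff P (n + 2)) h1
    simp only [Polynomial.coeff_add, Polynomial.coeff_C_mul] at this
    simpa [hc 0, hc 1, hc 2] using this
  have h0 : g 0 = 0 := by
    have := congrArg (Polynomial.eval 0) h1
    simpa [h2, bicuspidalParam] using this
  have h1' : g 1 = 0 := by
    have := congrArg (Polynomial.eval 1) h1
    simpa [h2, h0, bicuspidalParam] using this
  intro i
  fin_cases i <;> assumption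

end Dehomogenization

/-! ### Triples of binary forms with a one-point section -/

section Tuples

variable {K : Type*} [Field K] {d : ℕ}

/-- The linearly independent triples of binary forms whose span has a one-point section. -/
def onePointTuples (K : Type*) [Field K] (d k M : ℕ) : Set (Fin 3 → BinaryForms K d) :=
  {v | LinearIndependent K v ∧
    HasOnePointSection (sectionGrading (Submodule.span K (Set.range v))) k M}

lemma exists_of_mem_onePointTuples {k M : ℕ} {v : Fin 3 → BinaryForms K d}
    (hv : v ∈ onePointTuples K d k M) :
    ∃ (F : MvPolynomial (Fin 3) K) (p : Fin 3 → K) (G : Fin 3 → Fin 3 → MvPolynomial (Fin 3) K),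
      F.IsHomogeneous k ∧ p ≠ 0 ∧ (∀ i j, (G i j).IsHomogeneous M) ∧
      aeval (fun i => dehomogenize K (v i : MvPolynomial (Fin 2) K)) F ≠ 0 ∧
      ∀ i j, aeval (fun i => dehomogenize K (v i : MvPolynomial (Fin 2) K))
        ((C (p j) * X i - C (p i) * X j) ^ (k + M) - F * G i j) = 0 := by
  obtain ⟨x, hx, hxv, hxF⟩ := exists_isGradedBy_sectionGrading
    (L := Submodule.span K (Set.range v)) (v := v) rfl
  obtain ⟨F', hF', hF0, p, hp, hG⟩ := hv.2.exists_point hx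
  obtain ⟨F, hF, rfl⟩ := (hx.mem_iff _ _).1 hF'
  have hG' : ∀ i j, ∃ G : MvPolynomial (Fin 3) K, G.IsHomogeneous M ∧
      aeval (fun i => dehomogenize K (v i : MvPolynomial (Fin 2) K))
        ((C (p j) * X i - C (p i) * X j) ^ (k + M) - F * G) = 0 := by
    intro i j
    obtain ⟨_, hmem, he⟩ := hG i j
    obtain ⟨G, hGM, rfl⟩ := (hx.mem_iff _ _).1 hmem
    refine ⟨G, hGM, ?_⟩
    have h1 : aeval x ((C (p j) * X i - C (p i) * X j) ^ (k + M) - F * G) = 0 := by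
      rw [map_sub, map_mul, ← he, map_pow, map_sub, map_mul, map_mul, aeval_X, aeval_X, aeval_C,
        aeval_C, ← Algebra.smul_def, ← Algebra.smul_def, sub_self]
    rw [← dehomogenize_aeval, ← hxF, h1]
    exact map_zero _
  choose G hGM hG using hG'
  refine ⟨F, p, G, hF, hp, hGM, fun h => hF0 (Subtype.ext ?_), hG⟩
  rw [hxF]
  refine eq_zero_of_dehomogenize_eq_zero (m := d * k) ?_ ?_
  · exact hF.aeval _ fun i => (v i).2
  · rw [dehomogenize_aeval, h]

variable [CharZero K]

/-- Here the parametrization specializes rather than the equation. The equation is first rebuilt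
over `O`, and identities valid along the generic curve then become congruences modulo it. -/
theorem bicuspidalTuple_notMem_zariskiClosure {n : ℕ} (hn : 2 ≤ n) {k : ℕ} (hk : 0 < k) (M : ℕ) :
    bicuspidalTuple K n ∉ zariskiClosure K (onePointTuples K (n + 2) k M) := by
  intro hmem
  let E := Fin 3 → BinaryForms K (n + 2)
  let B := {v : E // v ∈ onePointTuples K (n + 2) k M}
  choose F p G hF hp hG hF0 heq using fun b : B => exists_of_mem_onePointTuples b.2
  obtain ⟨𝓕, _, π, O, Ω, _, _, τ, res, _, hspec⟩ := exists_specialization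
    (fun (b : B) (φ : Module.Dual K E) => φ b.1) (fun φ => φ (bicuspidalTuple K n))
    (fun Q hQ => hmem Q fun w hw => hQ ⟨w, hw⟩)
  have : CharZero Ω := charZero_of_injective_ringHom τ.injective
  have hinj : Function.Injective (algebraMap O 𝓕) := Subtype.val_injective
  obtain ⟨F', hF'⟩ := exists_mvPolynomial_pi F fun b => (hF b).totalDegree_le
  choose G' hG' using fun i j => exists_mvPolynomial_pi (fun b => G b i j)
    fun b => (hG b i j).totalDegree_le
  choose V' hV'deg hV' using fun i => exists_polynomial_pi
    (fun b : B => dehomogenize K (b.1 i : MvPolynomial (Fin 2) K))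
    fun b => natDegree_dehomogenize_le (b.1 i).2
  have hV'map : ∀ b i, (V' i).map (Pi.evalRingHom (fun _ : B => K) b) =
      dehomogenize K (b.1 i : MvPolynomial (Fin 2) K) := by
    intro b i
    ext m
    rw [Polynomial.coeff_map]
    exact hV' i m b
  -- an integral model of the parametrization
  have hlift : ∀ i, ∃ V : Polynomial O, V.map (algebraMap O 𝓕) = (V' i).map π ∧
      V.map res = bicuspidalParam Ω n i := by
    intro i
    have hx : ∀ m, ∃ x : O, algebraMap O 𝓕 x = π ((V' i).coeff m) ∧
        res x = τ ((bicuspidalParam K n i).coeff m) := by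
      intro m
      let φ : Module.Dual K E := Polynomial.lcoeff K m ∘ₗ (dehomogenize K).toLinearMap ∘ₗ
        (homogeneousSubmodule (Fin 2) K (n + 2)).subtype ∘ₗ LinearMap.proj i
      obtain ⟨h1, h2⟩ := hspec (X φ)
      simp only [eval_X] at h1 h2
      have h3 : (fun b : B => φ b.1) = (V' i).coeff m := funext fun b => (hV' i m b).symm
      refine ⟨⟨_, h1⟩, congrArg π h3, h2.trans (congrArg τ ?_)⟩
      rw [← dehomogenize_bicuspidalTuple]
      rfl
    have h1 : (V' i).map π ∈ Polynomial.lifts (algebraMap O 𝓕) := by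
      rw [Polynomial.lifts_iff_coeff_lifts]
      intro m
      obtain ⟨x, hx, -⟩ := hx m
      exact ⟨x, by rw [hx, Polynomial.coeff_map]⟩
    obtain ⟨V, hV⟩ := (Polynomial.mem_lifts _).1 h1
    refine ⟨V, hV, ?_⟩
    ext m
    obtain ⟨x, hx, hx'⟩ := hx m
    rw [Polynomial.coeff_map, ← map_bicuspidalParam τ, Polynomial.coeff_map, ← hx']
    congr 1
    apply hinj
    rw [hx, ← Polynomial.coeff_map, hV, Polynomial.coeff_map]
  choose V hVπ hVres using hlift
  have hVdeg : ∀ i, (V i).natDegree ≤ n + 2 := by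
    intro i
    rw [← Polynomial.natDegree_map_eq_of_injective hinj, hVπ]
    exact Polynomial.natDegree_map_le.trans (hV'deg i)
  obtain ⟨f, hf, hf1, hfV, hfres⟩ :=
    exists_equation_of_specializes_bicuspidal (by omega) res hVdeg hVres
  have haev : ∀ P : MvPolynomial (Fin 3) (B → K),
      aeval (fun i => (V i).map (algebraMap O 𝓕)) (map π P) = (aeval V' P).map π := by
    intro P
    simp only [hVπ]
    exact aeval_map_map π V' P
  have haev' : ∀ (b : B) (P : MvPolynomial (Fin 3) (B → K)),
      (aeval V' P).map (Pi.evalRingHom (fun _ : B => K) b) =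
        aeval (fun i => dehomogenize K (b.1 i : MvPolynomial (Fin 2) K))
          (map (Pi.evalRingHom (fun _ : B => K) b) P) := by
    intro b P
    rw [← aeval_map_map]
    simp only [hV'map]
  let p' : Fin 3 → B → K := fun i b => p b i
  have hdvd : ∀ i j, map (algebraMap O 𝓕) f ∣
      map π ((C (p' j) * X i - C (p' i) * X j) ^ (k + M) - F' * G' i j) := by
    intro i j
    refine map_dvd_of_aeval_eq_zero (k := k + M) (by omega) res hf hf1 hfres hVres hfV ?_ ?_
    · refine IsHomogeneous.map ?_ π
      have h1 := ((isHomogeneous_C_mul_X (p' j) i).sub (isHomogeneous_C_mul_X (p' i) j)).pow (k + M)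
      rw [one_mul] at h1
      exact h1.sub ((isHomogeneous_of_coeff hF' hF).mul
        (isHomogeneous_of_coeff (hG' i j) fun b => hG b i j))
    · rw [haev]
      have h1 : aeval V' ((C (p' j) * X i - C (p' i) * X j) ^ (k + M) - F' * G' i j) = 0 := by
        refine polynomial_pi_ext fun b => ?_
        have h2 : map (Pi.evalRingHom (fun _ : B => K) b)
            ((C (p' j) * X i - C (p' i) * X j) ^ (k + M) - F' * G' i j) =
            (C (p b j) * X i - C (p b i) * X j) ^ (k + M) - F b * G b i j := by
          rw [map_sub, map_mul, map_pow, map_sub, map_mul, map_mul, map_C, map_C, map_X, map_X,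
            map_evalRingHom_eq hF', map_evalRingHom_eq (hG' i j)]
          rfl
        rw [haev', Polynomial.map_zero, h2]
        exact heq b i j
      rw [h1, Polynomial.map_zero]
  choose a ha using hdvd
  refine false_of_specializes_bicuspidal hn res hf hf1 hfres (k := k) (M := M) (N := k + M)
    (r := map π F') (p := fun i => π (p' i)) hk ((isHomogeneous_of_coeff hF' hF).map π) ?_ ?_ a
    (fun i j => map π (G' i j)) (fun i j => (isHomogeneous_of_coeff (hG' i j) fun b => hG b i j).map π)
    ?_
  · rintro ⟨s, hs⟩
    have h1 : (aeval V' F').map π = 0 := by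
      rw [← haev, hs, map_mul, aeval_map_map, hfV, Polynomial.map_zero, zero_mul]
    obtain ⟨m, hm⟩ := exists_map_ne_zero π
      -- At each member some coefficient of the pullback of `F` is nonzero; only finitely many
      -- indices occur, so one stays nonzero in `𝓕`.
      (fun m : Fin ((aeval V' F').natDegree + 1) => (aeval V' F').coeff m) (by
        intro b
        by_contra! hcon
        refine hF0 b ?_
        rw [← map_evalRingHom_eq hF' b, ← haev']
        ext m
        rw [Polynomial.coeff_map, Polynomial.coeff_zero]
        by_cases hm : m < (aeval V' F').natDegree + 1
        · exact hcon ⟨m, hm⟩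
        · rw [Polynomial.coeff_eq_zero_of_natDegree_lt (by omega), map_zero])
    rw [← Polynomial.coeff_map, h1, Polynomial.coeff_zero] at hm
    exact hm rfl
  · obtain ⟨i, hi⟩ := exists_map_ne_zero π p' fun b => Function.ne_iff.1 (hp b)
    exact fun h0 => hi (congrFun h0 i)
  · intro i j
    have h1 := ha i j
    simp only [map_pow, map_sub, map_mul, map_C, map_X] at h1
    linear_combination h1

end Tuples


/-! ### Change of basis in a linear system -/

section ChangeOfBasis

variable {K E : Type*} [Field K] [AddCommGroup E] [Module K E]

/-- The action of matrices on tuples of vectors. -/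
def matrixAction {m : ℕ} (A : Matrix (Fin m) (Fin m) K) : (Fin m → E) →ₗ[K] (Fin m → E) :=
  LinearMap.pi fun i => ∑ j, A i j • LinearMap.proj j

lemma matrixAction_apply {m : ℕ} (A : Matrix (Fin m) (Fin m) K) (w : Fin m → E) (i : Fin m) :
    matrixAction A w i = ∑ j, A i j • w j := by
  simp [matrixAction]

lemma matrixAction_mul {m : ℕ} (A B : Matrix (Fin m) (Fin m) K) (w : Fin m → E) :
    matrixAction (A * B) w = matrixAction A (matrixAction B w) := by
  ext i
  simp only [matrixAction_apply, Matrix.mul_apply, Finset.sum_smul, Finset.smul_sum, smul_smul]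
  rw [Finset.sum_comm]

lemma span_matrixAction_le {m : ℕ} (A : Matrix (Fin m) (Fin m) K) (w : Fin m → E) :
    Submodule.span K (Set.range (matrixAction A w)) ≤ Submodule.span K (Set.range w) := by
  rw [Submodule.span_le]
  rintro _ ⟨i, rfl⟩
  rw [matrixAction_apply]
  exact Submodule.sum_mem _ fun j _ =>
    Submodule.smul_mem _ _ (Submodule.subset_span ⟨j, rfl⟩)

/-- The change-of-basis matrix acts linearly on all tuples and preserves spans. It thus preserves
any set of independent tuples defined through the span, and the closure of such a set, which lets
the closure descend to the Grassmannian. -/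
lemma exists_linearMap_of_span_eq {m : ℕ} {v v' : Fin m → E} (hv : LinearIndependent K v)
    (h : Submodule.span K (Set.range v) = Submodule.span K (Set.range v')) :
    ∃ T : (Fin m → E) →ₗ[K] (Fin m → E), T v = v' ∧ ∀ w, LinearIndependent K w →
      LinearIndependent K (T w) ∧
      Submodule.span K (Set.range (T w)) = Submodule.span K (Set.range w) := by
  have h1 : ∀ i, ∃ c : Fin m → K, ∑ j, c j • v j = v' i := fun i =>
    (Submodule.mem_span_range_iff_exists_fun K).1 (h ▸ Submodule.subset_span ⟨i, rfl⟩)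
  have h2 : ∀ i, ∃ c : Fin m → K, ∑ j, c j • v' j = v i := fun i =>
    (Submodule.mem_span_range_iff_exists_fun K).1 (h ▸ Submodule.subset_span ⟨i, rfl⟩)
  choose A hA using h1
  choose B hB using h2
  have hAv : matrixAction (Matrix.of A) v = v' := funext fun i =>
    (matrixAction_apply _ _ _).trans (hA i)
  have hBv : matrixAction (Matrix.of B) v' = v := funext fun i =>
    (matrixAction_apply _ _ _).trans (hB i)
  have hone : ∀ w : Fin m → E, matrixAction (1 : Matrix (Fin m) (Fin m) K) w = w := by
    intro w
    ext i
    simp [matrixAction_apply, Matrix.one_apply]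
  have hBA : Matrix.of B * Matrix.of A = 1 := by
    ext i j
    have h3 : matrixAction (Matrix.of B * Matrix.of A - 1) v i = 0 := by
      have h4 : matrixAction (Matrix.of B * Matrix.of A - 1) v =
          matrixAction (Matrix.of B * Matrix.of A) v - matrixAction (1 : Matrix (Fin m) (Fin m) K) v := by
        ext i
        simp only [matrixAction_apply, Pi.sub_apply, Matrix.sub_apply, sub_smul,
          Finset.sum_sub_distrib]
      rw [h4, matrixAction_mul, hAv, hBv, hone, sub_self, Pi.zero_apply]
    rw [matrixAction_apply] at h3
    exact sub_eq_zero.1 (Fintype.linearIndependent_iff.1 hv _ h3 j)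
  refine ⟨matrixAction (Matrix.of A), hAv, fun w hw => ?_⟩
  have hspan : Submodule.span K (Set.range (matrixAction (Matrix.of A) w)) =
      Submodule.span K (Set.range w) := by
    refine le_antisymm (span_matrixAction_le _ _) ?_
    have h3 := span_matrixAction_le (Matrix.of B) (matrixAction (Matrix.of A) w)
    rwa [← matrixAction_mul, hBA, hone] at h3
  refine ⟨?_, hspan⟩
  rw [linearIndependent_iff_card_eq_finrank_span, Set.finrank] at hw ⊢
  rwa [hspan]

lemma exists_linearIndependent_span_eq {m : ℕ} {L : Submodule K E} (hL : Module.finrank K L = m)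
    (hm : 0 < m) :
    ∃ v : Fin m → E, LinearIndependent K v ∧ Submodule.span K (Set.range v) = L := by
  have hfin : Module.Finite K L := Module.finite_of_finrank_pos (by omega)
  let b := Module.finBasisOfFinrankEq K L hL
  refine ⟨fun i => b i, b.linearIndependent.map' L.subtype (Submodule.ker_subtype L), ?_⟩
  have h1 : Set.range (fun i => (b i : E)) = L.subtype '' Set.range b := by
    rw [← Set.range_comp]
    rfl
  rw [h1, ← Submodule.map_span, b.span_eq, Submodule.map_top, Submodule.range_subtype]

end ChangeOfBasis

/-! ### Very general linear systems -/

section VeryGeneral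

variable {K : Type*} [Field K] [IsAlgClosed K] [CharZero K]

theorem holdsVeryGenerally_sectionGrading {n : ℕ} (hn : 2 ≤ n) :
    HoldsVeryGenerally (IsClosedInGrassmannian K 3)
      {L : Submodule K (BinaryForms K (n + 2)) | Module.finrank K L = 3}
      (fun L => NoKhovanskiiFiniteValuation.{w} (sectionGrading L)) := by
  let S : ℕ → ℕ → Set (Fin 3 → BinaryForms K (n + 2)) := fun k M =>
    zariskiClosure K (onePointTuples K (n + 2) k M)
  have hinv : ∀ k M (v v' : Fin 3 → BinaryForms K (n + 2)), LinearIndependent K v →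
      Submodule.span K (Set.range v) = Submodule.span K (Set.range v') → v ∈ S k M →
      v' ∈ S k M := by
    intro k M v v' hv h hvS
    obtain ⟨T, hT, hTw⟩ := exists_linearMap_of_span_eq hv h
    rw [← hT]
    refine map_mem_zariskiClosure T (fun w hw => ?_) hvS
    obtain ⟨h1, h2⟩ := hTw w hw.1
    refine ⟨h1, ?_⟩
    rw [h2]
    exact hw.2
  refine ⟨fun i => {L | ∃ v, LinearIndependent K v ∧ Submodule.span K (Set.range v) = L ∧
      v ∈ S (i.unpair.1 + 1) i.unpair.2}, fun i => ⟨⟨_, isZariskiClosed_zariskiClosure _,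
      fun v hv => ⟨fun h => ⟨v, hv, rfl, h⟩, ?_⟩⟩, fun hsub => ?_⟩, fun L hL hLZ => ?_⟩
  · rintro ⟨v', hv', hspan, hvS⟩
    exact hinv _ _ v' v hv' hspan hvS
  · have hv₀ := linearIndependent_bicuspidalTuple (K := K) (n := n) (by omega)
    obtain ⟨v, hv, hspan, hvS⟩ := hsub
      (show Module.finrank K (Submodule.span K (Set.range (bicuspidalTuple K n))) = 3 from
        finrank_span_eq_card hv₀)
    exact bicuspidalTuple_notMem_zariskiClosure hn (Nat.succ_pos _) _ (hinv _ _ v _ hv hspan hvS)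
  · have hL3 : Module.finrank K L = 3 := hL
    obtain ⟨v, hv, hspan⟩ := exists_linearIndependent_span_eq hL3 (by norm_num)
    obtain ⟨x, hx, -⟩ := exists_isGradedBy_sectionGrading hspan
    refine noKhovanskiiFiniteValuation_of_forall hx (not_algebraicIndependent_sectionRing L)
      (two_le_ringKrullDim_sectionRing (by omega) (by omega)) fun k M hk h => ?_
    refine hLZ (Nat.pair (k - 1) M) ⟨v, hv, hspan, ?_⟩
    rw [Nat.unpair_pair, Nat.sub_add_cancel hk]
    refine subset_zariskiClosure _ ⟨hv, ?_⟩
    rw [hspan]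
    exact h

end VeryGeneral

end Khovanskii

theorem corollary3p12 {K : Type*} [Field K] [IsAlgClosed K] [CharZero K] (d : ℕ) (hd : 3 < d) :
    Khovanskii.HoldsVeryGenerally (Khovanskii.IsClosedInProjectiveSpace K)
      (Khovanskii.integralRationalPlaneCurves K d)
      (fun Y => Khovanskii.NoKhovanskiiFiniteValuation.{w} (Khovanskii.coneGrading (Khovanskii.definingForm Y))) ∧
    Khovanskii.HoldsVeryGenerally (Khovanskii.IsClosedInGrassmannian K 3)
      {L : Submodule K (Khovanskii.BinaryForms K d) | Module.finrank K L = 3}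
      (fun L => Khovanskii.NoKhovanskiiFiniteValuation.{w} (Khovanskii.sectionGrading L)) := by
  obtain ⟨n, rfl⟩ : ∃ n, d = n + 2 := ⟨d - 2, by omega⟩
  exact ⟨Khovanskii.holdsVeryGenerally_coneGrading (by omega),
    Khovanskii.holdsVeryGenerally_sectionGrading (by omega)⟩
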